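/- Let $n\ge 0$ and let $B_n$ be the braid group on $n$ strands, with positive Artin generators $\sigma_1,\dots,\sigma_{n-1}$. A braid is *quasipositive* if it is a (possibly empty) product $\prod_{j=1}^{c} w_j\sigma_{i_j}w_j^{-1}$ with $w_j\in B_n$; its *writhe* is its exponent sum in the $\sigma_i$. Let $\widehat\sigma$ be the closure of $\sigma\in B_n$ in the thickened annulus, with the orientation in which all strands wind positively (counterclockwise) around the braid axis, and take as its diagram in the annulus the closure of any braid word for $\sigma$, with $n_+$ positive and $n_-$ negative crossings. Let $(\mathcal C,\partial)$ be its Lee complex over $\mathbb C$. It has a basis of pairs (complete resolution, marking of each of its circles by $v_+$ or $v_-$), and $\partial$ is the signed sum, over the edges of the cube of resolutions, of merge and split maps, given by $v_+v_+=v_+$, $v_+v_-=v_-v_+=v_-$, $v_-v_-=v_+$ and $v_+\mapsto v_+\otimes v_-+v_-\otimes v_+$, $v_-\mapsto v_-\otimes v_-+v_+\otimes v_+$. A basis element with $r$ crossings resolved by the $1$-resolution has gradings $$j=\#v_+-\#v_-+r+n_+-2n_-,\qquad k=\#\{v_+\text{ on nontrivial circles}\}-\#\{v_-\text{ on nontrivial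 circles}\},$$ where a circle is nontrivial if it is essential in the annulus. For $t\in[0,2]$ put $j_t=j-tk$. The $j_t$ grading of a nonzero chain is the minimum of $j_t$ over the basis elements that occur in it, and the $j_t$ grading of a nonzero homology class is the maximum of the $j_t$ gradings of the cycles that represent it. Let $\mathfrak s$ be the canonical Lee generator of the chosen orientation: it lives in the oriented resolution, which consists of $n$ concentric circles, and marks them alternately, starting from the outermost, by $\mathbf b=v_--v_+$ and $\mathbf a=v_-+v_+$. Define $d_t(\widehat\sigma)$ to be the $j_t$ grading of the homology class $[\mathfrak s]$. **Theorem.** Let $\sigma\in B_n$ be quasipositive with writhe $w$. Then, for every braid word for $\sigma$, the chain $\mathfrak s$ is a cycle, its class $[\mathfrak s]$ is nonzero, and $$d_t(\widehat\sigma)=-n\,|1-t|+w\qquad\text{for all }t\in[0,2].$$ In particular, the right slope $m_t(\widehat\sigma)=\lim_{\varepsilon\to0^+}\dfrac{d_{t+\varepsilon}(\widehat\sigma)-d_t(\widehat\sigma)}{\varepsilon}$ exists and equals $n$ for all $t\in[0,1)$. -/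

import Mathlib

namespace AnnularLee

/-! The braid group. -/

/-- The relators of the Artin presentation of the braid group on `n` strands; the generator with
index `i` exchanges the strands in positions `i` and `i + 1` (positions are counted from `0`). -/
def braidRels (n : ℕ) : Set (FreeGroup (Fin (n - 1))) :=
  {r | (∃ i j : Fin (n - 1), i.val + 2 ≤ j.val ∧
          r = FreeGroup.of i * FreeGroup.of j * (FreeGroup.of j * FreeGroup.of i)⁻¹) ∨
       (∃ i j : Fin (n - 1), i.val + 1 = j.val ∧
          r = FreeGroup.of i * FreeGroup.of j * FreeGroup.of i *
            (FreeGroup.of j * FreeGroup.of i * FreeGroup.of j)⁻¹)}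

/-- The braid group on `n` strands. -/
abbrev BraidGroup (n : ℕ) : Type := PresentedGroup (braidRels n)

/-- The positive elementary Artin generators. -/
def artinGen {n : ℕ} (i : Fin (n - 1)) : BraidGroup n := PresentedGroup.of i

/-- The exponent sum, as a homomorphism from the braid group to the integers. -/
def writheHom (n : ℕ) : BraidGroup n →* Multiplicative ℤ :=
  PresentedGroup.toGroup (f := fun _ : Fin (n - 1) => Multiplicative.ofAdd (1 : ℤ)) (by
    rintro r (⟨i, j, _, rfl⟩ | ⟨i, j, _, rfl⟩) <;> simp)

/-- The writhe (exponent sum) of a braid. -/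
def writhe {n : ℕ} (σ : BraidGroup n) : ℤ := Multiplicative.toAdd (writheHom n σ)

/-- A braid is quasipositive if it is a (possibly empty) product of conjugates of positive
elementary Artin generators. -/
def IsQuasipositive {n : ℕ} (σ : BraidGroup n) : Prop :=
  ∃ L : List (BraidGroup n × Fin (n - 1)),
    σ = (L.map fun b => b.1 * artinGen b.2 * b.1⁻¹).prod

/-! Braid words and the diagrams of their annular closures. -/

/-- A braid word: the letter `(i, true)` is the generator with index `i` (a positive crossing), the
letter `(i, false)` is its inverse (a negative crossing). -/
abbrev BraidWord (n : ℕ) : Type := List (Fin (n - 1) × Bool)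

/-- The braid that a braid word represents. -/
def toBraid {n : ℕ} (β : BraidWord n) : BraidGroup n :=
  PresentedGroup.mk (braidRels n) (FreeGroup.mk β)

/-- The number of positive crossings. -/
def nPos {n : ℕ} (β : BraidWord n) : ℕ := β.countP fun a => a.2

/-- The number of negative crossings. -/
def nNeg {n : ℕ} (β : BraidWord n) : ℕ := β.countP fun a => !a.2

/-- The left strand position at a crossing. -/
def leftPos {n : ℕ} (i : Fin (n - 1)) : Fin n := ⟨i.val, by omega⟩

/-- The right strand position at a crossing. -/
def rightPos {n : ℕ} (i : Fin (n - 1)) : Fin n := ⟨i.val + 1, by omega⟩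

/-- Points on the diagram of the annular closure. Write `m` for the number of crossings. The braid
is drawn with the strand positions `0, …, n - 1` from left to right, and with levels `0, …, m` such
that crossing `l` (and no other) lies between the levels `l` and `l + 1`. The node `(p, s)` is the
point in position `p` at level `s`. -/
abbrev Node {n : ℕ} (β : BraidWord n) : Type := Fin n × Fin (β.length + 1)

/-- A complete resolution of the diagram, as a vertex of the cube of resolutions: `false` is the
`0`-resolution and `true` is the `1`-resolution of a crossing. -/
abbrev Resolution {n : ℕ} (β : BraidWord n) : Type := Fin β.length → Bool

/-- The resolution `v` resolves crossing `l` like a braid (that is, in the oriented way). For a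
positive crossing this is the `0`-resolution, for a negative crossing the `1`-resolution. -/
def Braidlike {n : ℕ} (β : BraidWord n) (v : Resolution β) (l : Fin β.length) : Prop :=
  v l = !(β.get l).2

/-- The arcs between the nodes in a complete resolution. The annulus is cut along a radial arc `γ`
from its inner to its outer boundary, which misses all crossings; the `n` arcs that cross `γ` are
the closing arcs, from `(p, m)` to `(p, 0)`. The closure winds counterclockwise around the
annulus, position `0` is innermost and position `n - 1` is outermost. -/
inductive Arc {n : ℕ} (β : BraidWord n) (v : Resolution β) : Node β → Node β → Prop
  /-- the closing arcs, each of which crosses `γ` once -/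
  | closing (p : Fin n) : Arc β v (p, Fin.last β.length) (p, 0)
  /-- a strand that passes by crossing `l` -/
  | pass (l : Fin β.length) (p : Fin n)
      (h : p ≠ leftPos (β.get l).1) (h' : p ≠ rightPos (β.get l).1) :
      Arc β v (p, l.castSucc) (p, l.succ)
  /-- the left strand of the braidlike resolution -/
  | left (l : Fin β.length) (h : Braidlike β v l) :
      Arc β v (leftPos (β.get l).1, l.castSucc) (leftPos (β.get l).1, l.succ)
  /-- the right strand of the braidlike resolution -/
  | right (l : Fin β.length) (h : Braidlike β v l) :
      Arc β v (rightPos (β.get l).1, l.castSucc) (rightPos (β.get l).1, l.succ)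
  /-- the lower arc of the other resolution -/
  | lower (l : Fin β.length) (h : ¬ Braidlike β v l) :
      Arc β v (leftPos (β.get l).1, l.castSucc) (rightPos (β.get l).1, l.castSucc)
  /-- the upper arc of the other resolution -/
  | upper (l : Fin β.length) (h : ¬ Braidlike β v l) :
      Arc β v (leftPos (β.get l).1, l.succ) (rightPos (β.get l).1, l.succ)

/-- The circles of a complete resolution: the quotient of the set of nodes by the equivalence
relation that the arcs generate. -/
abbrev StateCircle {n : ℕ} (β : BraidWord n) (v : Resolution β) : Type := Quot (Arc β v)

/-- The circle through a node. -/
abbrev circ {n : ℕ} (β : BraidWord n) (v : Resolution β) (x : Node β) : StateCircle β v :=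
  Quot.mk (Arc β v) x

noncomputable instance {n : ℕ} (β : BraidWord n) (v : Resolution β) :
    Fintype (StateCircle β v) := Fintype.ofFinite _

/-- A circle is nontrivial if it crosses `γ` an odd number of times. -/
def IsNontrivial {n : ℕ} (β : BraidWord n) (v : Resolution β) (c : StateCircle β v) : Prop :=
  Odd {p : Fin n | circ β v (p, 0) = c}.ncard

/-! The Khovanov-Lee complex with its gradings. -/

/-- The distinguished basis: a complete resolution together with a mark on each of its circles.
The mark `true` is `v₊` and the mark `false` is `v₋`. -/
abbrev EnhancedState {n : ℕ} (β : BraidWord n) : Type :=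
  Σ v : Resolution β, (StateCircle β v → Bool)

/-- The value `1` of the mark `v₊` and the value `-1` of the mark `v₋`. -/
def markSign (b : Bool) : ℤ := if b then 1 else -1

/-- The number of `1`-resolutions. -/
def height {n : ℕ} (β : BraidWord n) (v : Resolution β) : ℕ :=
  (Finset.univ.filter fun l => v l = true).card

/-- The quantum grading `j`. -/
noncomputable def jGr {n : ℕ} (β : BraidWord n) (S : EnhancedState β) : ℤ :=
  (∑ c, markSign (S.2 c)) + height β S.1 + nPos β - 2 * nNeg β

open Classical in
/-- The annular grading `k`: the algebraic intersection number with `γ` of the oriented state in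
which a circle marked `v₊` is counterclockwise and a circle marked `v₋` is clockwise. A trivial
circle contributes `0`, and a nontrivial one `1` or `-1` according to its mark. -/
noncomputable def kGr {n : ℕ} (β : BraidWord n) (S : EnhancedState β) : ℤ :=
  ∑ c, if IsNontrivial β S.1 c then markSign (S.2 c) else 0

/-- The grading `j_t = j - t k`. -/
noncomputable def jtGr {n : ℕ} (β : BraidWord n) (t : ℝ) (S : EnhancedState β) : ℝ :=
  jGr β S - t * kGr β S

/-- The vector space underlying the Khovanov-Lee complex. -/
abbrev Chain {n : ℕ} (β : BraidWord n) : Type := EnhancedState β →₀ ℂ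

/-- The coefficient of `c` in the Lee product of `a` and `b`:
`v₊ v₊ = v₊`, `v₊ v₋ = v₋ v₊ = v₋`, `v₋ v₋ = v₊`. -/
def mergeCoeff : Bool → Bool → Bool → ℂ
  | true, true, true => 1
  | true, false, false => 1
  | false, true, false => 1
  | false, false, true => 1
  | _, _, _ => 0

/-- The coefficient of `b ⊗ c` in the Lee coproduct of `a`:
`v₊ ↦ v₊ ⊗ v₋ + v₋ ⊗ v₊`, `v₋ ↦ v₋ ⊗ v₋ + v₊ ⊗ v₊`. -/
def splitCoeff : Bool → Bool → Bool → ℂ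
  | true, true, false => 1
  | true, false, true => 1
  | false, false, false => 1
  | false, true, true => 1
  | _, _, _ => 0

/-- The lower left corner of crossing `l`. -/
def cornerA {n : ℕ} (β : BraidWord n) (l : Fin β.length) : Node β :=
  (leftPos (β.get l).1, l.castSucc)

/-- The upper right corner of crossing `l`. In either resolution of the crossing, the two local
arcs are the one through the lower left corner and the one through the upper right corner. -/
def cornerB {n : ℕ} (β : BraidWord n) (l : Fin β.length) : Node β :=
  (rightPos (β.get l).1, l.succ)

open Classical in
/-- The matrix entry at `(S, T)`, without sign, of the merge or split map at crossing `l`: a merge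
if the two local arcs lie on different circles of `S`, and a split otherwise. The marks on the
circles away from the crossing are kept. -/
noncomputable def saddleCoeff {n : ℕ} (β : BraidWord n) (l : Fin β.length)
    (S T : EnhancedState β) : ℂ :=
  if ∀ x : Node β, circ β S.1 x ≠ circ β S.1 (cornerA β l) →
      circ β S.1 x ≠ circ β S.1 (cornerB β l) → T.2 (circ β T.1 x) = S.2 (circ β S.1 x) then
    if circ β S.1 (cornerA β l) ≠ circ β S.1 (cornerB β l) then
      mergeCoeff (S.2 (circ β S.1 (cornerA β l))) (S.2 (circ β S.1 (cornerB β l)))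
        (T.2 (circ β T.1 (cornerA β l)))
    else
      splitCoeff (S.2 (circ β S.1 (cornerA β l)))
        (T.2 (circ β T.1 (cornerA β l))) (T.2 (circ β T.1 (cornerB β l)))
  else 0

/-- The sign of the edge of the cube of resolutions that changes crossing `l`: `-1` to the number
of `1`-resolutions among the crossings before `l`. -/
def edgeSign {n : ℕ} (β : BraidWord n) (v : Resolution β) (l : Fin β.length) : ℂ :=
  (-1) ^ (Finset.univ.filter fun l' => l' < l ∧ v l' = true).card

open Classical in
/-- The matrix entry at `(S, T)` of the Lee differential. -/
noncomputable def leeCoeff {n : ℕ} (β : BraidWord n) (S T : EnhancedState β) : ℂ :=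
  ∑ l : Fin β.length,
    if S.1 l = false ∧ T.1 = Function.update S.1 l true then
      edgeSign β S.1 l * saddleCoeff β l S T
    else 0

/-- The Lee differential. -/
noncomputable def leeD {n : ℕ} (β : BraidWord n) : Chain β →ₗ[ℂ] Chain β :=
  Finsupp.linearCombination ℂ fun S => Finsupp.equivFunOnFinite.symm (leeCoeff β S)

/-- The descending filtration of the complex by the grading `j_t`: the level `a` is spanned by
the basis elements of grading at least `a`. -/
noncomputable def filtration {n : ℕ} (β : BraidWord n) (t a : ℝ) : Submodule ℂ (Chain β) :=
  Submodule.span ℂ ((fun S => Finsupp.single S (1 : ℂ)) '' {S | a ≤ jtGr β t S})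

/-! The canonical generator and the annular Rasmussen invariants. -/

/-- The oriented resolution for the braidlike orientation. -/
def orientedRes {n : ℕ} (β : BraidWord n) : Resolution β := fun l => !(β.get l).2

/-- The coefficient of a mark in the label that the canonical generator puts on the circle of the
oriented resolution in position `p`. The labels are `𝐚 = v₋ + v₊` and `𝐛 = v₋ - v₊`; the outermost
circle has label `𝐛`, and the labels alternate from there. -/
def canonicalCoeff {n : ℕ} (p : Fin n) (b : Bool) : ℂ :=
  if Even (n - 1 - p.val) ∧ b = true then -1 else 1

open Classical in
/-- The canonical Lee generator of the braidlike orientation. Its resolution is the oriented one,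
the circles of which are the `n` concentric circles through the nodes `(p, 0)`. -/
noncomputable def canonicalGen {n : ℕ} (β : BraidWord n) : Chain β :=
  Finsupp.equivFunOnFinite.symm fun S =>
    if S.1 = orientedRes β then ∏ p : Fin n, canonicalCoeff p (S.2 (circ β S.1 (p, 0))) else 0

/-- The `j_t` gradings of the cycles in the homology class of the canonical generator, where the
grading of a chain `x` is the greatest `a` such that `x` is in level `a` of the filtration. -/
def classGradings {n : ℕ} (β : BraidWord n) (t : ℝ) : Set ℝ :=
  {a | ∃ x : Chain β, leeD β x = 0 ∧ x - canonicalGen β ∈ LinearMap.range (leeD β) ∧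
    IsGreatest {b | x ∈ filtration β t b} a}

/-- The annular Rasmussen invariant `d_t` of the annular closure of a braid word, with its
braidlike orientation: the grading of the homology class of the canonical generator. -/
noncomputable def annularRasmussen {n : ℕ} (β : BraidWord n) (t : ℝ) : ℝ :=
  sSup (classGradings β t)

end AnnularLee

namespace AnnularLee

/-! Colourings of the resolutions of a braid closure, as paths of rows. -/

/-! Lower bound. All `n` circles of the oriented resolution are essential, so `j = k + w` there and
`j_t = w + (1 - t) k` with `|k| ≤ n`. The canonical generator itself therefore lies in level `w - n
|1 - t|` (`canonicalGen_mem_filtration`). The work is to show that no homologous cycle lies deeper.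

Reduction to `t = 0`. From `j_t ≥ b` follows `j = j_t + t k ≥ b - t n`. For `t ≥ 1` the marks on the
nontrivial circles are flipped first, which turns `j` into `j - 2 k = j_t - (2 - t) k ≥ b - (2 - t)
n`. In both cases it suffices that the class has quantum grading at most `w - n`. This is
`UpperBound`, stated for any nonzero multiple of the generator.

Colourings. The Lee algebra is `ℂ[X]/(X² - 1)` with `v₊ = 1` and `v₋ = X`. Evaluating `X` at `±1`
turns a chain into a function on the two-colourings of the circles of each resolution. A saddle map
vanishes unless the colours at the crossing agree, and then it changes no colour. If every circle of
colour `c` is normalized by the inverse of `rt c`, merges and splits both multiply by `rt c`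
(`saddleEval_eq`, `toFun_leeD`). So the differential preserves the row of colours along the cut `γ`,
and it commutes with every multiplier that depends on this row only. Flipping the marks of the
nontrivial circles is such a multiplier (`prod_sg_rowOf`). The canonical generator is a multiple of
the delta function at the alternating row. Neighbouring colours differ there, so no saddle acts: the
generator is a cycle and not a boundary. The quantum filtration becomes a bound on the degree of
polynomials in the signs of the colours, because a basis element is the product of the signs of its
circles marked `v₋`.

Topology. An upper bound passes backwards along a filtered chain map that keeps the generator up to
a nonzero scalar (`UpperBound.of_op`). The second and third Reidemeister moves and the exchange of
distant crossings have such maps of degree `0` in both directions, so the bound depends on the braid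
only (`upperBound_congr`). Homotopy inverses are not needed. Deleting a positive crossing is a
projection that costs `1`. A product of `w` conjugates of generators becomes the trivial braid after
`w` deletions, each followed by the cancellation of a conjugating word against its inverse
(`exists_word_of_quasipositive`). For the trivial braid the differential is zero, and a delta
function on `n` signs has full degree `n`, hence grading `-n` (`upperBound_nil`).

Degrees. The local maps are composed of elementary moves whose degrees depend on the numbers of
circles. A saddle changes this number by exactly one: the circles are the cycles of a permutation,
and a saddle multiplies it by a transposition (`circ_corner_eq_iff`). The numbers of circles are
compared under local moves through counts of colourings, which satisfy a recursion along the word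
(`closedCount_eq_two_pow`). -/

/-- A colouring of the `n` points of the diagram on one level. -/
abbrev Row (n : ℕ) : Type := Fin n → Bool

/-- A complete resolution together with a colouring above a given initial row: `none` is a crossing
with the braidlike resolution, `some c` is one with the other resolution, the upper arc of which
has colour `c`. -/
abbrev Path : Type := List (Option Bool)

/-- The sign of a colour. -/
def sg (b : Bool) : ℂ := if b then 1 else -1

/-- A square root of twice the sign of a colour. -/
noncomputable def rt (b : Bool) : ℂ :=
  if b then (Real.sqrt 2 : ℂ) else (Real.sqrt 2 : ℂ) * Complex.I

theorem sg_mul_self (b : Bool) : sg b * sg b = 1 := by cases b <;> simp [sg]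

/-- A split of a circle of colour `b` multiplies values by `2 * sg b`, a merge by `1`. The square
root distributes this factor evenly over the two. -/
theorem rt_mul_self (b : Bool) : rt b * rt b = 2 * sg b := by
  have h : (Real.sqrt 2 : ℂ) * (Real.sqrt 2 : ℂ) = 2 := by
    rw [← Complex.ofReal_mul, Real.mul_self_sqrt (by norm_num)]; norm_num
  cases b
  · simp only [rt, sg, Bool.false_eq_true, if_false]
    linear_combination h * (Complex.I * Complex.I) + 2 * Complex.I_mul_I
  · simpa [rt, sg] using h

theorem rt_ne_zero (b : Bool) : rt b ≠ 0 := by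
  intro h
  have := rt_mul_self b
  rw [h] at this
  cases b <;> simp [sg] at this

/-! ### Rows and their recolouring at a crossing. -/

variable {n : ℕ}

/-- The row has the same colour in both positions of a crossing. -/
def IsFlat (i : Fin (n - 1)) (r : Row n) : Prop := r (leftPos i) = r (rightPos i)

instance (i : Fin (n - 1)) (r : Row n) : Decidable (IsFlat i r) :=
  inferInstanceAs (Decidable (r (leftPos i) = r (rightPos i)))

/-- The row `r` with both positions of a crossing coloured by `c`. -/
def recolor (i : Fin (n - 1)) (c : Bool) (r : Row n) : Row n := fun p =>
  if p = leftPos i ∨ p = rightPos i then c else r p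

theorem leftPos_ne_rightPos (i : Fin (n - 1)) : leftPos i ≠ rightPos i := by
  simp [leftPos, rightPos, Fin.ext_iff]

@[simp] theorem recolor_left (i : Fin (n - 1)) (c : Bool) (r : Row n) :
    recolor i c r (leftPos i) = c := by simp [recolor]

@[simp] theorem recolor_right (i : Fin (n - 1)) (c : Bool) (r : Row n) :
    recolor i c r (rightPos i) = c := by simp [recolor]

@[simp] theorem recolor_recolor (i : Fin (n - 1)) (c d : Bool) (r : Row n) :
    recolor i c (recolor i d r) = recolor i c r := by
  funext p; simp only [recolor]; split_ifs <;> rfl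

theorem recolor_self {i : Fin (n - 1)} {r : Row n} (h : IsFlat i r) :
    recolor i (r (leftPos i)) r = r := by
  funext p; simp only [recolor]; split_ifs with hp
  · rcases hp with rfl | rfl
    · rfl
    · exact h
  · rfl

theorem recolor_self' {i : Fin (n - 1)} {r : Row n} {c : Bool} (h : IsFlat i r)
    (hc : r (leftPos i) = c) : recolor i c r = r := by
  subst hc; exact recolor_self h

theorem recolor_mono {i : Fin (n - 1)} {r s : Row n} {c d : Bool} (h : s ≤ r) (hc : d ≤ c) :
    recolor i d s ≤ recolor i c r := by
  intro p; simp only [recolor]; split_ifs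
  · exact hc
  · exact h p

/-- Two crossings without a common position. -/
def Far (i j : Fin (n - 1)) : Prop := i.val + 2 ≤ j.val ∨ j.val + 2 ≤ i.val

theorem Far.symm {i j : Fin (n - 1)} (h : Far i j) : Far j i := Or.symm h

theorem recolor_far_left {i j : Fin (n - 1)} (h : Far i j) (c : Bool) (r : Row n) :
    recolor i c r (leftPos j) = r (leftPos j) := by
  have : ¬ (leftPos j = leftPos i ∨ leftPos j = rightPos i) := by
    rcases h with h | h <;> simp [leftPos, rightPos, Fin.ext_iff] <;> omega
  simp [recolor, this]

theorem recolor_far_right {i j : Fin (n - 1)} (h : Far i j) (c : Bool) (r : Row n) :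
    recolor i c r (rightPos j) = r (rightPos j) := by
  have : ¬ (rightPos j = leftPos i ∨ rightPos j = rightPos i) := by
    rcases h with h | h <;> simp [leftPos, rightPos, Fin.ext_iff] <;> omega
  simp [recolor, this]

theorem recolor_comm {i j : Fin (n - 1)} (h : Far i j) (c d : Bool) (r : Row n) :
    recolor i c (recolor j d r) = recolor j d (recolor i c r) := by
  funext p
  simp only [recolor]
  by_cases h1 : p = leftPos i ∨ p = rightPos i <;> by_cases h2 : p = leftPos j ∨ p = rightPos j
  · exfalso
    rcases h with h | h <;> simp only [leftPos, rightPos, Fin.ext_iff] at h1 h2 <;> omega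
  all_goals simp [h1, h2]

/-! ### Paths, and the differential on functions of paths. -/

/-- The path is a colouring of a resolution of the word (not necessarily closed). -/
def Valid : BraidWord n → Row n → Path → Prop
  | [], _, [] => True
  | _ :: β, r, none :: π => Valid β r π
  | a :: β, r, some c :: π => IsFlat a.1 r ∧ Valid β (recolor a.1 c r) π
  | [], _, _ :: _ => False
  | _ :: _, _, [] => False

/-- The final row of a path. -/
def finalRow : BraidWord n → Row n → Path → Row n
  | _ :: β, r, none :: π => finalRow β r π
  | a :: β, r, some c :: π => finalRow β (recolor a.1 c r) π
  | [], r, _ => r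
  | _ :: _, r, [] => r

/-- The row of a path on a given level. -/
def rowAt : BraidWord n → Row n → Path → ℕ → Row n
  | _ :: β, r, none :: π, l + 1 => rowAt β r π l
  | a :: β, r, some c :: π, l + 1 => rowAt β (recolor a.1 c r) π l
  | _ :: _, r, _ :: _, 0 => r
  | [], r, _, _ => r
  | _ :: _, r, [], _ => r

@[simp] theorem rowAt_zero (β : BraidWord n) (r : Row n) (π : Path) : rowAt β r π 0 = r := by
  rcases β with _ | ⟨a, β⟩ <;> rcases π with _ | ⟨_ | c, π⟩ <;> simp [rowAt]

/-- The sign with which the differential passes a crossing. -/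
def passSign (s : Bool) (o : Option Bool) : ℂ := if o.isSome = s then -1 else 1

/-- The Lee differential in the basis of colourings, normalized so that merge and split maps have
the same coefficients. -/
noncomputable def colD : BraidWord n → Row n → (Path → ℂ) → Path → ℂ
  | a :: β, r, Y, none :: π =>
      (if a.2 = false ∧ IsFlat a.1 r then rt (r (leftPos a.1)) * Y (some (r (leftPos a.1)) :: π)
        else 0) + passSign a.2 none * colD β r (fun ρ => Y (none :: ρ)) π
  | a :: β, r, Y, some c :: π =>
      (if a.2 = true ∧ c = r (leftPos a.1) then rt c * Y (none :: π) else 0) +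
        passSign a.2 (some c) * colD β (recolor a.1 c r) (fun ρ => Y (some c :: ρ)) π
  | [], _, _, _ => 0
  | _ :: _, _, _, [] => 0

theorem colD_add (β : BraidWord n) (r : Row n) (Y Z : Path → ℂ) (π : Path) :
    colD β r (fun ρ => Y ρ + Z ρ) π = colD β r Y π + colD β r Z π := by
  induction β generalizing r Y Z π with
  | nil => simp [colD]
  | cons a β ih =>
    rcases π with _ | ⟨_ | c, π⟩
    · simp [colD]
    · simp only [colD, ih]; split_ifs <;> ring
    · simp only [colD, ih]; split_ifs <;> ring

theorem colD_mul (β : BraidWord n) (r : Row n) (k : ℂ) (Y : Path → ℂ) (π : Path) :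
    colD β r (fun ρ => k * Y ρ) π = k * colD β r Y π := by
  induction β generalizing r Y π with
  | nil => simp [colD]
  | cons a β ih =>
    rcases π with _ | ⟨_ | c, π⟩
    · simp [colD]
    · simp only [colD, ih]; split_ifs <;> ring
    · simp only [colD, ih]; split_ifs <;> ring

theorem colD_zero (β : BraidWord n) (r : Row n) (π : Path) :
    colD β r (fun _ => 0) π = 0 := by
  simpa using colD_mul β r 0 (fun _ => 0) π

theorem colD_sub (β : BraidWord n) (r : Row n) (Y Z : Path → ℂ) (π : Path) :
    colD β r (fun ρ => Y ρ - Z ρ) π = colD β r Y π - colD β r Z π := by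
  have := colD_add β r Y (fun ρ => -1 * Z ρ) π
  rw [colD_mul] at this
  simpa [sub_eq_add_neg] using this

theorem colD_neg (β : BraidWord n) (r : Row n) (Y : Path → ℂ) (π : Path) :
    colD β r (fun ρ => -Y ρ) π = -colD β r Y π := by
  simpa using colD_mul β r (-1) Y π

/-! ### Local operators and their extension by a prefix. -/

/-- An operator between functions on paths, local at the beginning of a word. -/
abbrev LocalOp (n : ℕ) : Type := Row n → (Path → ℂ) → Path → ℂ

/-- The extension of a local operator by a prefix of the word, with a sign `η` for every
`1`-resolution in the prefix. -/
noncomputable def extend (η : ℂ) : BraidWord n → LocalOp n → LocalOp n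
  | [], F => F
  | a :: α, F => fun r Y π =>
    match π with
    | [] => 0
    | none :: π => (if a.2 = false then η else 1) * extend η α F r (fun ρ => Y (none :: ρ)) π
    | some c :: π =>
      (if a.2 = true then η else 1) * extend η α F (recolor a.1 c r) (fun ρ => Y (some c :: ρ)) π

/-- The sign in the extension of a local operator. -/
noncomputable def prefixSign (η : ℂ) : BraidWord n → Path → ℂ
  | a :: α, none :: π => (if a.2 = false then η else 1) * prefixSign η α π
  | a :: α, some _ :: π => (if a.2 = true then η else 1) * prefixSign η α π
  | [], _ => 1
  | _ :: _, [] => 1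

theorem extend_append (η : ℂ) (α : BraidWord n) (F : LocalOp n) (r : Row n) (Y : Path → ℂ)
    (πα ρ : Path) (h : πα.length = α.length) :
    extend η α F r Y (πα ++ ρ) =
      prefixSign η α πα * F (finalRow α r πα) (fun ρ => Y (πα ++ ρ)) ρ := by
  induction α generalizing r Y πα with
  | nil => simp at h; subst h; simp [extend, prefixSign, finalRow]
  | cons a α ih =>
    rcases πα with _ | ⟨_ | c, πα⟩
    · simp at h
    · simp at h; simp [extend, prefixSign, finalRow, ih _ _ _ h, mul_assoc]
    · simp at h; simp [extend, prefixSign, finalRow, ih _ _ _ h, mul_assoc]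

/-- The local operator is linear. -/
structure IsLinearOp (F : LocalOp n) : Prop where
  add : ∀ r Y Z π, F r (fun ρ => Y ρ + Z ρ) π = F r Y π + F r Z π
  mul : ∀ r (k : ℂ) Y π, F r (fun ρ => k * Y ρ) π = k * F r Y π

theorem IsLinearOp.zero {F : LocalOp n} (hF : IsLinearOp F) (r : Row n) (π : Path) :
    F r (fun _ => 0) π = 0 := by
  simpa using hF.mul r 0 (fun _ => 0) π

theorem IsLinearOp.extend {F : LocalOp n} (hF : IsLinearOp F) (η : ℂ) (α : BraidWord n) :
    IsLinearOp (extend η α F) := by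
  induction α with
  | nil => exact hF
  | cons a α ih =>
    refine ⟨fun r Y Z π => ?_, fun r k Y π => ?_⟩ <;> rcases π with _ | ⟨_ | c, π⟩ <;>
      simp [AnnularLee.extend, ih.add, ih.mul, mul_add, mul_left_comm]

/-- The local operator commutes with the differentials up to the sign `η`. -/
def IsChainOp (η : ℂ) (τ τ' : BraidWord n) (F : LocalOp n) : Prop :=
  ∀ r Y π, Valid τ' r π → F r (colD τ r Y) π = η * colD τ' r (F r Y) π

/-- A saddle in the prefix recolours a flat row by its own colour, so `F` sees the same row before
and after it. The prefix then has one more `1`-resolution, and the factor `η` which this contributes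
is the one in the commutation rule. Saddles behind the prefix are covered by induction. -/
theorem IsChainOp.extend {F : LocalOp n} {η : ℂ} {τ τ' : BraidWord n} (h : IsChainOp η τ τ' F)
    (hF : IsLinearOp F) (α : BraidWord n) :
    IsChainOp η (α ++ τ) (α ++ τ') (extend η α F) := by
  induction α with
  | nil => exact h
  | cons a α ih =>
    have hL := hF.extend η α
    intro r Y π hπ
    rcases π with _ | ⟨_ | c, π⟩
    · simp [Valid] at hπ
    · have ih' := ih r (fun ρ => Y (none :: ρ)) π hπ
      obtain ⟨i, s⟩ := a
      by_cases hf : IsFlat i r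
      · have hr : recolor i (r (leftPos i)) r = r := recolor_self hf
        cases s <;>
        · simp only [AnnularLee.extend, List.cons_append, colD, hf, hL.add, hL.mul, ih', passSign,
            reduceIte, and_self, and_true, Option.isSome_none, reduceCtorEq, hL.zero, colD_mul, hr]
          try ring
      · cases s <;>
        · simp only [AnnularLee.extend, List.cons_append, colD, hf, hL.add, hL.mul, ih', passSign,
            reduceIte, and_false, Option.isSome_none, reduceCtorEq, hL.zero, colD_mul]
          try ring
    · have ih' := ih (recolor a.1 c r) (fun ρ => Y (some c :: ρ)) π hπ.2
      obtain ⟨i, s⟩ := a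
      by_cases hc : c = r (leftPos i)
      · have hr : recolor i c r = r := recolor_self' hπ.1 hc.symm
        simp only [hr] at ih'
        cases s <;>
        · simp only [AnnularLee.extend, List.cons_append, colD, ← hc, hL.add, hL.mul, ih', passSign,
            reduceIte, and_self, and_true, Option.isSome_some, reduceCtorEq, hL.zero,
            colD_mul, hr]
          try ring
      · cases s <;>
        · simp only [AnnularLee.extend, List.cons_append, colD, hc, hL.add, hL.mul, ih', passSign,
            reduceIte, and_self, and_false, Option.isSome_some, reduceCtorEq, hL.zero,
            colD_mul]
          try ring

/-! ### The chain maps of Reidemeister moves and of a deleted crossing. -/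

/-- The counit of a circle, in the normalized basis of colourings. -/
noncomputable def circleSum (f : Bool → ℂ) : ℂ :=
  2⁻¹ * (rt true * f true - rt false * f false)

theorem circleSum_add (f g : Bool → ℂ) :
    circleSum (fun c => f c + g c) = circleSum f + circleSum g := by
  simp only [circleSum]; ring

theorem circleSum_mul (k : ℂ) (f : Bool → ℂ) :
    circleSum (fun c => k * f c) = k * circleSum f := by
  simp only [circleSum]; ring

theorem rt_true_mul : rt true * rt true = 2 := by simpa [sg] using rt_mul_self true

theorem rt_false_mul : rt false * rt false = -2 := by simpa [sg] using rt_mul_self false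

/-- The map of the second Reidemeister move that removes two adjacent inverse crossings. -/
noncomputable def cancelOp (i : Fin (n - 1)) : LocalOp n := fun r Y ρ =>
  Y (none :: none :: ρ) - if IsFlat i r then
    rt (r (leftPos i)) * circleSum fun c => Y (some c :: some (r (leftPos i)) :: ρ) else 0

theorem isLinearOp_cancelOp (i : Fin (n - 1)) : IsLinearOp (cancelOp i) := by
  constructor
  · intro r Y Z π; simp only [cancelOp, circleSum_add]; split_ifs <;> ring
  · intro r k Y π; simp only [cancelOp, circleSum_mul]; split_ifs <;> ring

/-- The braidlike resolution of the pair contains one `1`-resolution, hence the sign `-1`. The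
resolution with both crossings `0`-resolved maps to both terms of `cancelOp`, and these
contributions cancel: the counit undoes the split because `2⁻¹ * sg c * rt c * rt c = 1`. -/
theorem isChainOp_cancelOp (i : Fin (n - 1)) (s : Bool) (γ : BraidWord n) :
    IsChainOp (-1) ((i, s) :: (i, !s) :: γ) γ (cancelOp i) := by
  intro r Y π _
  have h1 := rt_true_mul
  have h2 := rt_false_mul
  have e : cancelOp i r Y = fun ρ => Y (none :: none :: ρ) - if IsFlat i r then
    rt (r (leftPos i)) * circleSum fun c => Y (some c :: some (r (leftPos i)) :: ρ) else 0 := rfl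
  by_cases hf : IsFlat i r
  · have hr : recolor i (r (leftPos i)) r = r := recolor_self hf
    rw [e]
    generalize hb : r (leftPos i) = b at *
    cases s <;> cases b <;>
    · simp [cancelOp, colD, hf, passSign, colD_sub, colD_mul, circleSum, hr, hb]
      grind
  · rw [e]
    cases s <;> simp [cancelOp, colD, hf, passSign]

/-- The map of the second Reidemeister move that inserts two adjacent inverse crossings. -/
noncomputable def insertOp (i : Fin (n - 1)) : LocalOp n := fun r Y π =>
  match π with
  | none :: none :: ρ => Y ρ
  | some c :: some d :: ρ =>
      if d = r (leftPos i) then (rt c)⁻¹ * (rt d * Y ρ) else 0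
  | _ => 0

theorem isLinearOp_insertOp (i : Fin (n - 1)) : IsLinearOp (insertOp i) := by
  constructor
  · intro r Y Z π; unfold insertOp; split <;> try split_ifs
    all_goals ring
  · intro r k Y π; unfold insertOp; split <;> try split_ifs
    all_goals ring

theorem isChainOp_insertOp (i : Fin (n - 1)) (s : Bool) (γ : BraidWord n) :
    IsChainOp (-1) γ ((i, s) :: (i, !s) :: γ) (insertOp i) := by
  intro r Y π hπ
  have h1 := rt_ne_zero
  rcases π with _ | ⟨_ | c, _ | ⟨_ | d, ρ⟩⟩
  · simp [Valid] at hπ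
  · simp [Valid] at hπ
  · cases s <;> simp [insertOp, colD, passSign]
  · have hf : IsFlat i r := hπ.1
    generalize hb : r (leftPos i) = b
    cases s <;> cases b <;> cases d <;> simp [insertOp, colD, passSign, hf, hb, h1, colD_zero]
  · simp [Valid] at hπ
  · have hf : IsFlat i r := hπ.1
    generalize hb : r (leftPos i) = b
    have hf' : IsFlat i (recolor i c r) := by simp [IsFlat]
    cases s <;> cases b <;> cases c <;> simp [insertOp, colD, passSign, hb, h1, colD_zero, hf']
  · have hf : IsFlat i r := hπ.1
    have hr : recolor i (r (leftPos i)) r = r := recolor_self hf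
    generalize hb : r (leftPos i) = b at *
    cases s <;> cases b <;> cases c <;> cases d <;>
      simp [insertOp, colD, passSign, hb, h1, colD_zero, hr, colD_mul]

/-- The map that exchanges two distant positive crossings. -/
noncomputable def commOp : LocalOp n := fun _ Y π =>
  match π with
  | none :: none :: ρ => Y (none :: none :: ρ)
  | some c :: none :: ρ => Y (none :: some c :: ρ)
  | none :: some c :: ρ => Y (some c :: none :: ρ)
  | some c :: some d :: ρ => -Y (some d :: some c :: ρ)
  | _ => 0

theorem isLinearOp_commOp : IsLinearOp (commOp (n := n)) := by
  constructor
  · intro r Y Z π; unfold commOp; split <;> ring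
  · intro r k Y π; unfold commOp; split <;> ring

/-- The edge signs depend on the order of the crossings. The minus sign of `commOp` on paths with
both crossings `1`-resolved accounts for this. -/
theorem isChainOp_commOp {i j : Fin (n - 1)} (h : Far i j) (γ : BraidWord n) :
    IsChainOp 1 ((i, true) :: (j, true) :: γ) ((j, true) :: (i, true) :: γ) commOp := by
  intro r Y π hπ
  rcases π with _ | ⟨_ | c, _ | ⟨_ | d, ρ⟩⟩
  · simp [Valid] at hπ
  · simp [Valid] at hπ
  · simp [commOp, colD, passSign]
  · simp [commOp, colD, passSign]
    try ring
  · simp [Valid] at hπ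
  · simp [commOp, colD, passSign]
    try ring
  · simp [commOp, colD, passSign, colD_neg, recolor_far_left h.symm, recolor_far_left h,
      recolor_comm h]
    split_ifs <;> ring

/-- The map that deletes a crossing. -/
noncomputable def deleteOp : LocalOp n := fun _ Y π => Y (none :: π)

theorem isLinearOp_deleteOp : IsLinearOp (deleteOp (n := n)) :=
  ⟨fun _ _ _ _ => rfl, fun _ _ _ _ => rfl⟩

/-- The braidlike resolution of a positive crossing is its `0`-resolution. No saddle at the crossing
leads into it, so the restriction to it is the projection to a quotient complex. -/
theorem isChainOp_deleteOp (i : Fin (n - 1)) (γ : BraidWord n) :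
    IsChainOp 1 ((i, true) :: γ) γ deleteOp := by
  intro r Y π _
  simp [deleteOp, colD, passSign]
  rfl

/-- Two crossings with one common position. -/
def Adjacent (i j : Fin (n - 1)) : Prop := i.val + 1 = j.val ∨ j.val + 1 = i.val

/-- The map of the third Reidemeister move. -/
noncomputable def triangleOp (i j : Fin (n - 1)) : LocalOp n := fun r Y π =>
  match π with
  | none :: none :: none :: ρ => Y (none :: none :: none :: ρ)
  | none :: some b :: none :: ρ => Y (some b :: none :: none :: ρ)
  | some b :: none :: none :: ρ => Y (none :: some b :: none :: ρ)
  | none :: none :: some b :: ρ => Y (none :: some b :: none :: ρ)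
  | some a :: some b :: none :: ρ => Y (none :: some a :: some b :: ρ) -
      if a = r (leftPos j) then
        rt (r (leftPos j)) * circleSum fun c => Y (some c :: none :: some b :: ρ) else 0
  | none :: some a :: some b :: ρ => Y (some a :: some b :: none :: ρ)
  | some a :: none :: some b :: ρ => (rt a)⁻¹ *
      ((if IsFlat i r then rt (r (leftPos i)) * Y (some (r (leftPos i)) :: some b :: none :: ρ)
        else 0) +
      ((if IsFlat i (recolor j b r) then rt (recolor j b r (leftPos i)) *
          Y (none :: some b :: some (recolor j b r (leftPos i)) :: ρ) else 0) -
        if IsFlat i r ∧ b = r (leftPos j) then rt (r (leftPos i)) * (rt (r (leftPos j)) *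
          circleSum fun c => Y (some c :: none :: some (r (leftPos i)) :: ρ)) else 0))
  | _ => 0

theorem isLinearOp_triangleOp (i j : Fin (n - 1)) : IsLinearOp (triangleOp i j) := by
  constructor
  · intro r Y Z π; unfold triangleOp; split <;> (try simp only [circleSum]) <;> try split_ifs
    all_goals ring
  · intro r k Y π; unfold triangleOp; split <;> (try simp only [circleSum]) <;> try split_ifs
    all_goals ring

theorem Adjacent.eval {i j : Fin (n - 1)} (h : Adjacent i j) :
    ((∀ (r : Row n) c, recolor i c r (leftPos j) = c) ∧
      (∀ (r : Row n) c, recolor i c r (rightPos j) = r (rightPos j)) ∧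
      (∀ (r : Row n) c, recolor j c r (rightPos i) = c) ∧
      (∀ (r : Row n) c, recolor j c r (leftPos i) = r (leftPos i)) ∧ rightPos i = leftPos j) ∨
    ((∀ (r : Row n) c, recolor j c r (leftPos i) = c) ∧
      (∀ (r : Row n) c, recolor j c r (rightPos i) = r (rightPos i)) ∧
      (∀ (r : Row n) c, recolor i c r (rightPos j) = c) ∧
      (∀ (r : Row n) c, recolor i c r (leftPos j) = r (leftPos j)) ∧ rightPos j = leftPos i) := by
  rcases h with h | h
  · left
    simp only [recolor, leftPos, rightPos, Fin.ext_iff]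
    refine ⟨fun r c => if_pos ?_, fun r c => if_neg ?_, fun r c => if_pos ?_,
      fun r c => if_neg ?_, ?_⟩ <;> omega
  · right
    simp only [recolor, leftPos, rightPos, Fin.ext_iff]
    refine ⟨fun r c => if_pos ?_, fun r c => if_neg ?_, fun r c => if_pos ?_,
      fun r c => if_neg ?_, ?_⟩ <;> omega

-- On either side the only resolution with a small circle has its outer crossings not braidlike and
-- its middle crossing braidlike. The map identifies the resolutions that agree as planar pictures.
-- It is corrected by the counit of the small circle of the source and by its unit in the target.
-- The terms at the three crossings involve only the colours in three positions, so each type of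
-- path leaves a finite check.
set_option maxHeartbeats 2000000 in
theorem isChainOp_triangleOp {i j : Fin (n - 1)} (h : Adjacent i j) (γ : BraidWord n) :
    IsChainOp 1 ((i, true) :: (j, true) :: (i, true) :: γ)
      ((j, true) :: (i, true) :: (j, true) :: γ) (triangleOp i j) := by
  intro r Y π hπ
  have h1 := rt_true_mul
  have h2 := rt_false_mul
  have h3 := rt_ne_zero true
  have h4 := rt_ne_zero false
  have key : ∀ k (r : Row n) c, IsFlat k r → r (leftPos k) = c → recolor k c r = r :=
    fun k r c => recolor_self'
  have hs : ∀ b, rt b ≠ 0 := rt_ne_zero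
  rcases π with _ | ⟨_ | a, _ | ⟨_ | b, _ | ⟨_ | c, ρ⟩⟩⟩
  any_goals simp [Valid] at hπ
  · simp [triangleOp, colD, passSign]
  · rcases h.eval with ⟨e1, e2, e3, e4, e5⟩ | ⟨e1, e2, e3, e4, e5⟩ <;>
    simp only [IsFlat, e5] at hπ <;>
    cases x1 : r (leftPos i) <;> cases x2 : r (rightPos i) <;> cases x3 : r (leftPos j) <;>
    cases x4 : r (rightPos j) <;> cases c <;>
    -- Colours that contradict the validity of the path, or that differ at the position `e5` shared
    -- by the two crossings, are discarded first.
    first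
    | (exfalso; simp [x1, x3, x4] at hπ; done)
    | (exfalso; simp [x1, x2, x3, x4] at e5; done)
    | (simp [triangleOp, colD, passSign, IsFlat, e1, e2, e3, e4, x1, x2, x3, x4]; done)
    | (simp [triangleOp, colD, passSign, IsFlat, e1, e2, e3, e4, x1, x2, x3, x4, key,
        colD_sub, colD_mul, colD_add, circleSum, colD_zero]; grind)
  · rcases h.eval with ⟨e1, e2, e3, e4, e5⟩ | ⟨e1, e2, e3, e4, e5⟩ <;>
    simp only [IsFlat, e5] at hπ <;>
    cases x1 : r (leftPos i) <;> cases x2 : r (rightPos i) <;> cases x3 : r (leftPos j) <;>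
    cases x4 : r (rightPos j) <;> cases b <;>
    first
    | (exfalso; simp [x1, x2, x3] at hπ; done)
    | (exfalso; simp [x1, x2, x3, x4] at e5; done)
    | (simp [triangleOp, colD, passSign, IsFlat, e1, e2, e3, e4, x1, x3, x4]; done)
    | (simp [triangleOp, colD, passSign, IsFlat, e1, e2, e3, e4, x1, x2, x3, x4, key,
        colD_sub, colD_mul, colD_add, circleSum, colD_zero]; grind)
  · rcases h.eval with ⟨e1, e2, e3, e4, e5⟩ | ⟨e1, e2, e3, e4, e5⟩ <;>
    simp only [IsFlat, e1, e2, e4, e5, recolor_left] at hπ <;>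
    cases x1 : r (leftPos i) <;> cases x2 : r (rightPos i) <;> cases x3 : r (leftPos j) <;>
    cases x4 : r (rightPos j) <;> cases b <;> cases c <;>
    first
    | (exfalso; simp [x1, x2, x3, x4] at hπ; done)
    | (exfalso; simp [x1, x2, x3, x4] at e5; done)
    | (simp [triangleOp, colD, passSign, IsFlat, e1, e2, e3, e4, x1, x3, x4]; done)
    | (simp [triangleOp, colD, passSign, IsFlat, e1, e2, e3, e4, x1, x2, x3, x4, key,
        colD_sub, colD_mul, colD_add, circleSum, colD_zero]; grind)
  · rcases h.eval with ⟨e1, e2, e3, e4, e5⟩ | ⟨e1, e2, e3, e4, e5⟩ <;>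
    simp only [IsFlat, e5] at hπ <;>
    cases x1 : r (leftPos i) <;> cases x2 : r (rightPos i) <;> cases x3 : r (leftPos j) <;>
    cases x4 : r (rightPos j) <;> cases a <;>
    first
    | (exfalso; simp [x1, x3, x4] at hπ; done)
    | (exfalso; simp [x1, x2, x3, x4] at e5; done)
    | (simp [triangleOp, colD, passSign, IsFlat, e1, e2, e3, e4, x1, x2, x3]; done)
    | (simp [triangleOp, colD, passSign, IsFlat, e1, e2, e3, e4, x1, x2, x3, x4, key,
        colD_sub, colD_mul, colD_add, circleSum, colD_zero]; grind)
  · have k1 : r (leftPos i) = r (rightPos i) → recolor i (r (leftPos i)) r = r := recolor_self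
    have k2 : r (leftPos j) = r (rightPos j) → recolor j (r (leftPos j)) r = r := recolor_self
    have k3 : recolor j c r (leftPos i) = recolor j c r (rightPos i) →
      recolor i (recolor j c r (leftPos i)) (recolor j c r) = recolor j c r := recolor_self
    rcases h.eval with ⟨e1, e2, e3, e4, e5⟩ | ⟨e1, e2, e3, e4, e5⟩ <;>
    simp only [IsFlat, e1, e2, e4, e5, recolor_left, recolor_right] at hπ k1 k2 k3 <;>
    cases x1 : r (leftPos i) <;> cases x2 : r (rightPos i) <;> cases x3 : r (leftPos j) <;>
    cases x4 : r (rightPos j) <;> cases a <;> cases c <;>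
    first
    | (exfalso; simp [x1, x3, x4] at hπ; done)
    | (exfalso; simp [x1, x2, x3, x4] at e5; done)
    | (simp only [x1, x2, x3, x4, forall_const] at k1 k2 k3
       simp [triangleOp, colD, passSign, IsFlat, e1, e2, e3, e4, x1, x2, x3, x4, k1, k2, k3,
        colD_sub, colD_mul, colD_add, circleSum, colD_zero]; done)
    | (simp only [x1, x2, x3, x4, forall_const] at k1 k2 k3
       simp [triangleOp, colD, passSign, IsFlat, e1, e2, e3, e4, x1, x2, x3, x4, k1, k2, k3,
        colD_sub, colD_mul, colD_add, circleSum, colD_zero]; grind)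
  · have k1 : r (leftPos i) = r (rightPos i) → recolor i (r (leftPos i)) r = r := recolor_self
    have k2 : r (leftPos j) = r (rightPos j) → recolor j (r (leftPos j)) r = r := recolor_self
    rcases h.eval with ⟨e1, e2, e3, e4, e5⟩ | ⟨e1, e2, e3, e4, e5⟩ <;>
    simp only [IsFlat, e1, e2, e4, e5, recolor_left] at hπ k1 k2 <;>
    cases x1 : r (leftPos i) <;> cases x2 : r (rightPos i) <;> cases x3 : r (leftPos j) <;>
    cases x4 : r (rightPos j) <;> cases a <;> cases b <;>
    first
    | (exfalso; simp [x1, x2, x3, x4] at hπ; done)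
    | (exfalso; simp [x1, x2, x3, x4] at e5; done)
    | (simp only [x1, x2, x3, x4, forall_const] at k1 k2
       simp [triangleOp, colD, passSign, IsFlat, e1, e2, e3, e4, x1, x2, x3, x4, k1, k2,
        colD_sub, colD_mul, circleSum]; done)
    | (simp only [x1, x2, x3, x4, forall_const] at k1 k2
       simp [triangleOp, colD, passSign, IsFlat, e1, e2, e3, e4, x1, x2, x3, x4, k1, k2,
        colD_sub, colD_mul, circleSum]; grind)
  · rcases h.eval with ⟨e1, e2, e3, e4, e5⟩ | ⟨e1, e2, e3, e4, e5⟩ <;>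
    simp only [IsFlat, e1, e2, e4, e5, recolor_left, recolor_right] at hπ <;>
    cases x1 : r (leftPos i) <;> cases x2 : r (rightPos i) <;> cases x3 : r (leftPos j) <;>
    cases x4 : r (rightPos j) <;> cases a <;> cases b <;> cases c <;>
    first
    | (exfalso; simp [x1, x2, x3, x4] at hπ; done)
    | (exfalso; simp [x1, x2, x3, x4] at e5; done)
    | (simp [triangleOp, colD, passSign, IsFlat, e1, e2, e3, e4, x1, x2, x3, circleSum, colD_zero]; done)
    | (simp [triangleOp, colD, passSign, IsFlat, e1, e2, e3, e4, x1, x2, x3, circleSum, colD_zero]; grind)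

/-! ### The circles of a resolution as the cycles of a permutation. -/

theorem not_sameCycle_of_periodic {α : Type*} [Finite α] (f : Equiv.Perm α) {a b : α} {k : ℕ}
    (hk : 0 < k) (ha : f^[k] a = a) (hj : ∀ j, 0 < j → j < k → f^[j] a ≠ b) (hab : a ≠ b) :
    ¬ f.SameCycle a b := by
  intro h
  obtain ⟨i, -, -, hi⟩ := h.exists_pow_eq''
  rw [← Equiv.Perm.iterate_eq_pow] at hi
  have hper : Function.IsPeriodicPt f k a := ha
  rw [← hper.iterate_mod_apply] at hi
  rcases Nat.eq_zero_or_pos (i % k) with h0 | h0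
  · rw [h0] at hi; exact hab hi
  · exact hj _ h0 (Nat.mod_lt _ hk) hi

/-- Follow `a` under `f` until the first visit to `a` or `b`. Until then the product with the swap,
started at `b`, runs through the same points. If `f` reaches `b` first, it joins `a` and `b`, while
the product returns to `b` without meeting `a`; if `f` returns to `a` first, the roles are
exchanged. -/
theorem sameCycle_iff_not_mul_swap {α : Type*} [Finite α] [DecidableEq α] (f : Equiv.Perm α)
    {a b : α} (hab : a ≠ b) :
    f.SameCycle a b ↔ ¬ (f * Equiv.swap a b).SameCycle a b := by
  set g := f * Equiv.swap a b with hg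
  have ga : g b = f a := by simp [hg]
  have gx : ∀ x, x ≠ a → x ≠ b → g x = f x := fun x h1 h2 => by
    simp [hg, Equiv.swap_apply_of_ne_of_ne h1 h2]
  have hex : ∃ k, 0 < k ∧ (f^[k] a = a ∨ f^[k] a = b) :=
    ⟨orderOf f, orderOf_pos f, Or.inl (by rw [Equiv.Perm.iterate_eq_pow, pow_orderOf_eq_one]; rfl)⟩
  classical
  obtain ⟨hk, hk'⟩ := Nat.find_spec hex
  have hmin : ∀ j, 0 < j → j < Nat.find hex → f^[j] a ≠ a ∧ f^[j] a ≠ b := fun j h0 hj => by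
    have := Nat.find_min hex hj
    simpa [h0] using this
  generalize Nat.find hex = k at *
  have hiter : ∀ j, 0 < j → j ≤ k → g^[j] b = f^[j] a := by
    intro j h0 hj
    induction j with
    | zero => omega
    | succ j ih =>
      rw [Function.iterate_succ_apply', Function.iterate_succ_apply']
      rcases Nat.eq_zero_or_pos j with rfl | hj0
      · exact ga
      · rw [ih hj0 (by omega)]
        obtain ⟨h1, h2⟩ := hmin j hj0 (by omega)
        exact gx _ h1 h2
  rcases hk' with hka | hkb
  · constructor
    · intro h
      exact absurd h (not_sameCycle_of_periodic f hk hka (fun j h0 hj => (hmin j h0 hj).2) hab)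
    · intro h
      exfalso
      apply h
      have : g^[k] b = a := by rw [hiter k hk le_rfl, hka]
      rw [Equiv.Perm.iterate_eq_pow] at this
      exact Equiv.Perm.SameCycle.symm ⟨k, by exact_mod_cast this⟩
  · constructor
    · intro _ h
      refine not_sameCycle_of_periodic g hk (a := b) (b := a) ?_ ?_ hab.symm h.symm
      · rw [hiter k hk le_rfl, hkb]
      · intro j h0 hj
        rw [hiter j h0 hj.le]
        exact (hmin j h0 hj).1
    · intro _
      rw [Equiv.Perm.iterate_eq_pow] at hkb
      exact ⟨k, by exact_mod_cast hkb⟩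

instance (β : BraidWord n) (v : Resolution β) (l : Fin β.length) : Decidable (Braidlike β v l) :=
  inferInstanceAs (Decidable (_ = _))

/-- The position to which a strand turns back in a resolved crossing, if it does. -/
def turn (β : BraidWord n) (v : Resolution β) (k : Fin β.length) (p : Fin n) : Option (Fin n) :=
  if Braidlike β v k then none
  else if p = leftPos (β.get k).1 then some (rightPos (β.get k).1)
  else if p = rightPos (β.get k).1 then some (leftPos (β.get k).1)
  else none

theorem decide_even_rightPos (i : Fin (n - 1)) :
    decide (Even (rightPos i).val) = !decide (Even (leftPos i).val) := by
  have h : Even (rightPos i).val ↔ ¬ Even (leftPos i).val := by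
    simp only [leftPos, rightPos, Nat.even_add_one]
  by_cases hi : Even (leftPos i).val
  · simp only [h, hi, not_true, decide_true, decide_false, Bool.not_true]
  · simp only [h, hi, not_false_iff, decide_true, decide_false, Bool.not_false]

theorem turn_symm {β : BraidWord n} {v : Resolution β} {k : Fin β.length} {p q : Fin n}
    (h : turn β v k p = some q) :
    turn β v k q = some p ∧ decide (Even q.val) = !decide (Even p.val) := by
  have hne := leftPos_ne_rightPos (β.get k).1
  unfold turn at h ⊢
  split_ifs at h with h1 h2 h3
  · simp at h; subst h h2
    exact ⟨by simp [h1], decide_even_rightPos _⟩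
  · simp at h; subst h h3
    exact ⟨by simp [h1], by simp [decide_even_rightPos]⟩

/-- The next node above. -/
def stepUp (β : BraidWord n) (v : Resolution β) (p : Fin n) (l : Fin (β.length + 1)) : Node β :=
  Fin.lastCases (motive := fun _ => Node β) (p, 0)
    (fun k => match turn β v k p with
      | some q => (q, k.castSucc)
      | none => (p, k.succ)) l

/-- The next node below. -/
def stepDown (β : BraidWord n) (v : Resolution β) (p : Fin n) (l : Fin (β.length + 1)) : Node β :=
  Fin.cases (motive := fun _ => Node β) (p, Fin.last _)
    (fun k => match turn β v k p with
      | some q => (q, k.succ)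
      | none => (p, k.castSucc)) l

/-- The next node on the circles, oriented upwards in the positions with parity `b` and downwards
in the others. -/
def step (β : BraidWord n) (v : Resolution β) (b : Bool) (x : Node β) : Node β :=
  if decide (Even x.1.val) = b then stepUp β v x.1 x.2 else stepDown β v x.1 x.2

theorem step_eq_stepUp {b : Bool} (β : BraidWord n) (v : Resolution β) {p : Fin n}
    (h : decide (Even p.val) = b) (l : Fin (β.length + 1)) :
    step β v b (p, l) = stepUp β v p l := if_pos h

theorem step_eq_stepDown {b : Bool} (β : BraidWord n) (v : Resolution β) {p : Fin n}
    (h : decide (Even p.val) = !b) (l : Fin (β.length + 1)) :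
    step β v b (p, l) = stepDown β v p l := if_neg (by rw [h]; cases b <;> simp)

/-- A strand that turns back at a crossing reverses its vertical direction and moves to a
neighbouring position, which has the other parity. So the orientation upwards or downwards by parity
is consistent in every resolution. -/
theorem step_step (β : BraidWord n) (v : Resolution β) (b : Bool) (x : Node β) :
    step β v (!b) (step β v b x) = x := by
  obtain ⟨p, l⟩ := x
  by_cases hp : decide (Even p.val) = b
  · have hp' : decide (Even p.val) = !!b := by rw [hp, Bool.not_not]
    rw [step_eq_stepUp β v hp]
    refine Fin.lastCases ?_ (fun k => ?_) l
    · rw [stepUp, Fin.lastCases_last, step_eq_stepDown β v hp', stepDown, Fin.cases_zero]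
    · rcases ht : turn β v k p with _ | q
      · rw [stepUp, Fin.lastCases_castSucc, ht]
        simp only
        rw [step_eq_stepDown β v hp', stepDown, Fin.cases_succ, ht]
      · obtain ⟨h1, h2⟩ := turn_symm ht
        have hq : decide (Even q.val) = !b := by rw [h2, hp]
        rw [stepUp, Fin.lastCases_castSucc, ht]
        simp only
        rw [step_eq_stepUp β v hq, stepUp, Fin.lastCases_castSucc, h1]
  · have hp' : decide (Even p.val) = !b := by
      revert hp; cases decide (Even p.val) <;> cases b <;> simp
    rw [step_eq_stepDown β v hp']
    refine Fin.cases ?_ (fun k => ?_) l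
    · rw [stepDown, Fin.cases_zero, step_eq_stepUp β v hp', stepUp, Fin.lastCases_last]
    · rcases ht : turn β v k p with _ | q
      · rw [stepDown, Fin.cases_succ, ht]
        simp only
        rw [step_eq_stepUp β v hp', stepUp, Fin.lastCases_castSucc, ht]
      · obtain ⟨h1, h2⟩ := turn_symm ht
        have hq : decide (Even q.val) = !!b := by rw [h2, hp']
        rw [stepDown, Fin.cases_succ, ht]
        simp only
        rw [step_eq_stepDown β v hq, stepDown, Fin.cases_succ, h1]

/-- The permutation of the nodes, the cycles of which are the circles of the resolution. -/
def circlePerm (β : BraidWord n) (v : Resolution β) : Equiv.Perm (Node β) where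
  toFun := step β v true
  invFun := step β v false
  left_inv x := by simpa using step_step β v true x
  right_inv x := by simpa using step_step β v false x

theorem arc_of_turn {β : BraidWord n} {v : Resolution β} {k : Fin β.length} {p q : Fin n}
    (h : turn β v k p = some q) :
    circ β v (p, k.castSucc) = circ β v (q, k.castSucc) ∧
      circ β v (p, k.succ) = circ β v (q, k.succ) := by
  unfold turn at h
  split_ifs at h with h1 h2 h3
  · simp at h; subst h h2
    exact ⟨Quot.sound (Arc.lower k h1), Quot.sound (Arc.upper k h1)⟩
  · simp at h; subst h h3
    exact ⟨(Quot.sound (Arc.lower k h1)).symm, (Quot.sound (Arc.upper k h1)).symm⟩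

theorem arc_of_turn_eq_none {β : BraidWord n} {v : Resolution β} {k : Fin β.length} {p : Fin n}
    (h : turn β v k p = none) : Arc β v (p, k.castSucc) (p, k.succ) := by
  by_cases h1 : Braidlike β v k
  · by_cases h2 : p = leftPos (β.get k).1
    · subst h2; exact Arc.left k h1
    · by_cases h3 : p = rightPos (β.get k).1
      · subst h3; exact Arc.right k h1
      · exact Arc.pass k p h2 h3
  · unfold turn at h
    split_ifs at h with h2 h3
    exact Arc.pass k p h2 h3

theorem circ_stepUp (β : BraidWord n) (v : Resolution β) (p : Fin n) (l : Fin (β.length + 1)) :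
    circ β v (stepUp β v p l) = circ β v (p, l) := by
  refine Fin.lastCases ?_ (fun k => ?_) l
  · simpa [stepUp] using (Quot.sound (Arc.closing p)).symm
  · rcases ht : turn β v k p with _ | q
    · simpa [stepUp, ht] using (Quot.sound (arc_of_turn_eq_none ht)).symm
    · simpa [stepUp, ht] using (arc_of_turn ht).1.symm

theorem circ_stepDown (β : BraidWord n) (v : Resolution β) (p : Fin n) (l : Fin (β.length + 1)) :
    circ β v (stepDown β v p l) = circ β v (p, l) := by
  refine Fin.cases ?_ (fun k => ?_) l
  · exact Quot.sound (Arc.closing p)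
  · rcases ht : turn β v k p with _ | q
    · simpa [stepDown, ht] using (Quot.sound (arc_of_turn_eq_none ht))
    · simpa [stepDown, ht] using (arc_of_turn ht).2.symm

theorem circ_circlePerm (β : BraidWord n) (v : Resolution β) (x : Node β) :
    circ β v (circlePerm β v x) = circ β v x := by
  change circ β v (step β v true x) = _
  unfold step
  split_ifs
  · exact circ_stepUp β v x.1 x.2
  · exact circ_stepDown β v x.1 x.2

theorem sameCycle_step (β : BraidWord n) (v : Resolution β) (b : Bool) (x : Node β) :
    (circlePerm β v).SameCycle x (step β v b x) := by
  cases b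
  · have : step β v false x = (circlePerm β v)⁻¹ x := rfl
    rw [this]
    exact ⟨-1, by simp⟩
  · exact (Equiv.Perm.sameCycle_apply_right (f := circlePerm β v)).2 (Equiv.Perm.SameCycle.refl _ _)

theorem sameCycle_stepUp (β : BraidWord n) (v : Resolution β) (x : Node β) :
    (circlePerm β v).SameCycle x (stepUp β v x.1 x.2) := by
  have := sameCycle_step β v (decide (Even x.1.val)) x
  simpa [step] using this

theorem sameCycle_of_arc {β : BraidWord n} {v : Resolution β} {x y : Node β} (h : Arc β v x y) :
    (circlePerm β v).SameCycle x y := by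
  have hdown : ∀ x : Node β, (circlePerm β v).SameCycle x (stepDown β v x.1 x.2) := fun x => by
    have := sameCycle_step β v (!decide (Even x.1.val)) x
    rw [step, if_neg (by simp)] at this
    exact this
  cases h with
  | closing p => simpa [stepUp] using sameCycle_stepUp β v (p, Fin.last _)
  | pass l p h h' =>
    have ht : turn β v l p = none := by unfold turn; split_ifs <;> rfl
    simpa [stepUp, ht] using sameCycle_stepUp β v (p, l.castSucc)
  | left l h =>
    have ht : turn β v l (leftPos (β.get l).1) = none := by unfold turn; rw [if_pos h]
    have := sameCycle_stepUp β v (leftPos (β.get l).1, l.castSucc)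
    rw [stepUp, Fin.lastCases_castSucc, ht] at this
    exact this
  | right l h =>
    have ht : turn β v l (rightPos (β.get l).1) = none := by unfold turn; rw [if_pos h]
    have := sameCycle_stepUp β v (rightPos (β.get l).1, l.castSucc)
    rw [stepUp, Fin.lastCases_castSucc, ht] at this
    exact this
  | lower l h =>
    have ht : turn β v l (leftPos (β.get l).1) = some (rightPos (β.get l).1) := by
      unfold turn; rw [if_neg h, if_pos rfl]
    have := sameCycle_stepUp β v (leftPos (β.get l).1, l.castSucc)
    rw [stepUp, Fin.lastCases_castSucc, ht] at this
    exact this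
  | upper l h =>
    have ht : turn β v l (leftPos (β.get l).1) = some (rightPos (β.get l).1) := by
      unfold turn; rw [if_neg h, if_pos rfl]
    have := hdown (leftPos (β.get l).1, l.succ)
    rw [stepDown, Fin.cases_succ, ht] at this
    exact this

/-- Every arc joins a node to its successor or to its predecessor under `circlePerm`, and every node
shares its circle with its successor. -/
theorem circ_eq_iff_sameCycle (β : BraidWord n) (v : Resolution β) (x y : Node β) :
    circ β v x = circ β v y ↔ (circlePerm β v).SameCycle x y := by
  constructor
  · intro h
    have := Quot.eqvGen_exact h
    clear h
    induction this with
    | rel x y h => exact sameCycle_of_arc h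
    | refl x => exact Equiv.Perm.SameCycle.refl _ _
    | symm x y _ ih => exact ih.symm
    | trans x y z _ _ ih1 ih2 => exact ih1.trans ih2
  · intro h
    obtain ⟨i, -, -, hi⟩ := h.exists_pow_eq''
    subst hi
    clear h
    induction i with
    | zero => rfl
    | succ i ih => rw [pow_succ', Equiv.Perm.mul_apply, circ_circlePerm, ← ih]

theorem circlePerm_apply (β : BraidWord n) (v : Resolution β) (x : Node β) :
    circlePerm β v x = step β v true x := rfl

theorem turn_congr {β : BraidWord n} {v v' : Resolution β} {k : Fin β.length} {p : Fin n}
    (h : v k = v' k) : turn β v k p = turn β v' k p := by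
  have e : Braidlike β v k ↔ Braidlike β v' k := by simp only [Braidlike, h]
  unfold turn
  by_cases hb : Braidlike β v k
  · rw [if_pos hb, if_pos (e.1 hb)]
  · rw [if_neg hb, if_neg (fun hb' => hb (e.2 hb'))]

theorem turn_of_ne {β : BraidWord n} {v : Resolution β} {k : Fin β.length} {p : Fin n}
    (h1 : p ≠ leftPos (β.get k).1) (h2 : p ≠ rightPos (β.get k).1) : turn β v k p = none := by
  rw [turn, if_neg h1, if_neg h2, ite_self]

/-- A saddle between two resolutions multiplies the permutation of the nodes by a transposition. -/
theorem circlePerm_eq_mul_swap {β : BraidWord n} {v v' : Resolution β} {l : Fin β.length}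
    (h : Braidlike β v l) (h' : ¬ Braidlike β v' l) (hne : ∀ k, k ≠ l → v k = v' k)
    {a b : Node β}
    (hab : (Even (leftPos (β.get l).1).val ∧ a = cornerA β l ∧ b = cornerB β l) ∨
      (¬ Even (leftPos (β.get l).1).val ∧ a = (rightPos (β.get l).1, l.castSucc) ∧
        b = (leftPos (β.get l).1, l.succ))) :
    circlePerm β v' = circlePerm β v * Equiv.swap a b := by
  set i := (β.get l).1 with hi
  have hpar : decide (Even (rightPos i).val) = !decide (Even (leftPos i).val)  :=
    decide_even_rightPos i
  have t1 : ∀ p, turn β v l p = none := fun p => by simp [turn, h]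
  have t2 : turn β v' l (leftPos i) = some (rightPos i) := by simp [turn, h', hi]
  have t3 : turn β v' l (rightPos i) = some (leftPos i) := by
    simp [turn, h', hi]
  -- The nodes `a` and `b` are those where the orientation by parity enters crossing `l`: from below
  -- in the even position, from above in the odd one. Only their successors depend on the resolution
  -- of `l`, and a saddle exchanges these.
  ext1 x
  rw [Equiv.Perm.mul_apply]
  simp only [circlePerm_apply]
  rcases hab with ⟨hev, ha, hb⟩ | ⟨hev, ha, hb⟩
  · have e1 : decide (Even (leftPos i).val) = true := by simpa using hev
    have e2 : decide (Even (rightPos i).val) = !true := by rw [hpar, e1]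
    by_cases hxa : x = a
    · rw [hxa, Equiv.swap_apply_left, ha, hb]
      unfold cornerA cornerB
      rw [← hi, step_eq_stepUp β v' e1, step_eq_stepDown β v e2, stepUp, stepDown,
        Fin.lastCases_castSucc, Fin.cases_succ, t1, t2]
    by_cases hxb : x = b
    · rw [hxb, Equiv.swap_apply_right, ha, hb]
      unfold cornerA cornerB
      rw [← hi, step_eq_stepUp β v e1, step_eq_stepDown β v' e2, stepUp, stepDown,
        Fin.lastCases_castSucc, Fin.cases_succ, t1, t3]
    rw [Equiv.swap_apply_of_ne_of_ne hxa hxb]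
    obtain ⟨p, k⟩ := x
    by_cases hp : decide (Even p.val) = true
    · rw [step_eq_stepUp β v' hp, step_eq_stepUp β v hp]
      have hpr : p ≠ rightPos i := by rintro rfl; rw [e2] at hp; simp at hp
      clear hxb
      revert hxa
      refine Fin.lastCases ?_ (fun k => ?_) k
      · intro _; simp [stepUp]
      · intro hxa
        rw [stepUp, stepUp, Fin.lastCases_castSucc, Fin.lastCases_castSucc]
        by_cases hk : k = l
        · subst hk
          have hpl : p ≠ leftPos i := by
            rintro rfl; exact hxa ha.symm
          rw [turn_of_ne hpl hpr, turn_of_ne hpl hpr]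
        · rw [turn_congr (hne k hk)]
    · have hp' : decide (Even p.val) = !true := by simpa using hp
      rw [step_eq_stepDown β v' hp', step_eq_stepDown β v hp']
      have hpl : p ≠ leftPos i := by rintro rfl; exact hp e1
      clear hxa
      revert hxb
      refine Fin.cases ?_ (fun k => ?_) k
      · intro _; simp [stepDown]
      · intro hxb
        rw [stepDown, stepDown, Fin.cases_succ, Fin.cases_succ]
        by_cases hk : k = l
        · subst hk
          have hpr : p ≠ rightPos i := by
            rintro rfl; exact hxb hb.symm
          rw [turn_of_ne hpl hpr, turn_of_ne hpl hpr]
        · rw [turn_congr (hne k hk)]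
  · have e1 : decide (Even (leftPos i).val) = !true := by simpa using hev
    have e2 : decide (Even (rightPos i).val) = true := by rw [hpar, e1]; rfl
    by_cases hxa : x = a
    · rw [hxa, Equiv.swap_apply_left, ha, hb, step_eq_stepUp β v' e2, step_eq_stepDown β v e1,
        stepUp, stepDown, Fin.lastCases_castSucc, Fin.cases_succ, t1, t3]
    by_cases hxb : x = b
    · rw [hxb, Equiv.swap_apply_right, ha, hb, step_eq_stepUp β v e2, step_eq_stepDown β v' e1,
        stepUp, stepDown, Fin.lastCases_castSucc, Fin.cases_succ, t1, t2]
    rw [Equiv.swap_apply_of_ne_of_ne hxa hxb]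
    obtain ⟨p, k⟩ := x
    by_cases hp : decide (Even p.val) = true
    · rw [step_eq_stepUp β v' hp, step_eq_stepUp β v hp]
      have hpl : p ≠ leftPos i := by rintro rfl; rw [e1] at hp; simp at hp
      clear hxb
      revert hxa
      refine Fin.lastCases ?_ (fun k => ?_) k
      · intro _; simp [stepUp]
      · intro hxa
        rw [stepUp, stepUp, Fin.lastCases_castSucc, Fin.lastCases_castSucc]
        by_cases hk : k = l
        · subst hk
          have hpr : p ≠ rightPos i := by
            rintro rfl; exact hxa ha.symm
          rw [turn_of_ne hpl hpr, turn_of_ne hpl hpr]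
        · rw [turn_congr (hne k hk)]
    · have hp' : decide (Even p.val) = !true := by simpa using hp
      rw [step_eq_stepDown β v' hp', step_eq_stepDown β v hp']
      have hpr : p ≠ rightPos i := by rintro rfl; exact hp e2
      clear hxa
      revert hxb
      refine Fin.cases ?_ (fun k => ?_) k
      · intro _; simp [stepDown]
      · intro hxb
        rw [stepDown, stepDown, Fin.cases_succ, Fin.cases_succ]
        by_cases hk : k = l
        · subst hk
          have hpl : p ≠ leftPos i := by
            rintro rfl; exact hxb hb.symm
          rw [turn_of_ne hpl hpr, turn_of_ne hpl hpr]
        · rw [turn_congr (hne k hk)]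

/-- Every saddle merges two circles or splits one circle. -/
theorem circ_corner_eq_iff {β : BraidWord n} {v v' : Resolution β} {l : Fin β.length}
    (h : Braidlike β v l) (h' : ¬ Braidlike β v' l) (hne : ∀ k, k ≠ l → v k = v' k) :
    circ β v (cornerA β l) = circ β v (cornerB β l) ↔
      circ β v' (cornerA β l) ≠ circ β v' (cornerB β l) := by
  have key : ∀ a b : Node β,
      ((Even (leftPos (β.get l).1).val ∧ a = cornerA β l ∧ b = cornerB β l) ∨
      (¬ Even (leftPos (β.get l).1).val ∧ a = (rightPos (β.get l).1, l.castSucc) ∧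
        b = (leftPos (β.get l).1, l.succ))) →
      (circ β v a = circ β v b ↔ circ β v' a ≠ circ β v' b) := by
    intro a b hab
    have hne' : a ≠ b := by
      have := leftPos_ne_rightPos (β.get l).1
      rcases hab with ⟨-, rfl, rfl⟩ | ⟨-, rfl, rfl⟩
      · intro e; exact this (congrArg Prod.fst e)
      · intro e; exact this (congrArg Prod.fst e).symm
    rw [Ne, circ_eq_iff_sameCycle, circ_eq_iff_sameCycle, circlePerm_eq_mul_swap h h' hne hab]
    exact sameCycle_iff_not_mul_swap _ hne'
  by_cases hev : Even (leftPos (β.get l).1).val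
  · exact key _ _ (Or.inl ⟨hev, rfl, rfl⟩)
  -- For an odd left position the transposed nodes are the other two corners. The arcs at `l` join
  -- them to `cornerA` and `cornerB`, in different pairings before and after the saddle.
  · have := key _ _ (Or.inr ⟨hev, rfl, rfl⟩)
    have a1 := Quot.sound (r := Arc β v) (Arc.left l h)
    have a2 := Quot.sound (r := Arc β v) (Arc.right l h)
    have a3 := Quot.sound (r := Arc β v') (Arc.lower l h')
    have a4 := Quot.sound (r := Arc β v') (Arc.upper l h')
    unfold circ at this ⊢
    rw [a2, ← a1, ← a3, a4] at this
    exact ⟨fun e => this.1 e.symm, fun e => (this.2 e).symm⟩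

/-! Paths and colourings of the circles. -/

/-- The resolution of a path: the entry `true` stands for a resolution that is not braidlike. -/
def shape (π : Path) : List Bool := π.map Option.isSome

@[simp] theorem shape_length (π : Path) : (shape π).length = π.length := by simp [shape]

@[simp] theorem shape_append (π ρ : Path) : shape (π ++ ρ) = shape π ++ shape ρ := by simp [shape]

@[simp] theorem shape_nil : shape [] = [] := rfl

@[simp] theorem shape_cons (o : Option Bool) (ρ : Path) :
    shape (o :: ρ) = o.isSome :: shape ρ := rfl

/-- The vertex of the cube of resolutions with a given shape. -/
def shapeRes (β : BraidWord n) (e : List Bool) : Resolution β :=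
  fun l => e.getD l.val false == (β.get l).2

theorem braidlike_shapeRes (β : BraidWord n) (e : List Bool) (l : Fin β.length) :
    Braidlike β (shapeRes β e) l ↔ e.getD l.val false = false := by
  unfold Braidlike shapeRes
  cases e.getD l.val false <;> cases (β.get l).2 <;> simp

theorem Valid.length_eq {β : BraidWord n} {r : Row n} {π : Path} (h : Valid β r π) :
    π.length = β.length := by
  induction β generalizing r π with
  | nil => rcases π with _ | ⟨o, π⟩ <;> simp [Valid] at h ⊢
  | cons a β ih =>
    rcases π with _ | ⟨_ | c, π⟩
    · simp [Valid] at h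
    · simp [ih (r := r) (π := π) h]
    · simp [ih h.2]

theorem Valid.rowAt_succ_of_none {β : BraidWord n} {r : Row n} {π : Path} (h : Valid β r π) {l : ℕ}
    (hl : π[l]? = some none) : rowAt β r π (l + 1) = rowAt β r π l := by
  induction β generalizing r π l with
  | nil => rcases π with _ | ⟨o, π⟩ <;> simp [Valid] at h hl
  | cons a β ih =>
    rcases π with _ | ⟨_ | c, π⟩
    · simp [Valid] at h
    · cases l with
      | zero => simp [rowAt]
      | succ l => exact ih (r := r) h (by simpa using hl)
    · cases l with
      | zero => simp at hl
      | succ l => exact ih h.2 (by simpa using hl)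

theorem Valid.rowAt_succ_of_some {β : BraidWord n} {r : Row n} {π : Path} (h : Valid β r π) {l : ℕ}
    {c : Bool} (hlt : l < β.length) (hl : π[l]? = some (some c)) :
    IsFlat (β.get ⟨l, hlt⟩).1 (rowAt β r π l) ∧
      rowAt β r π (l + 1) = recolor (β.get ⟨l, hlt⟩).1 c (rowAt β r π l) := by
  induction β generalizing r π l with
  | nil => simp at hlt
  | cons a β ih =>
    rcases π with _ | ⟨_ | d, π⟩
    · simp [Valid] at h
    · cases l with
      | zero => simp at hl
      | succ l => exact ih (r := r) h (by simpa using hlt) (by simpa using hl)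
    · cases l with
      | zero =>
        simp at hl; subst hl
        exact ⟨by simpa using h.1, by simp [rowAt]⟩
      | succ l => exact ih h.2 (by simpa using hlt) (by simpa using hl)

theorem Valid.rowAt_length {β : BraidWord n} {r : Row n} {π : Path} (h : Valid β r π) :
    rowAt β r π β.length = finalRow β r π := by
  induction β generalizing r π with
  | nil => rcases π with _ | ⟨o, π⟩ <;> simp [Valid] at h; simp [rowAt, finalRow]
  | cons a β ih =>
    rcases π with _ | ⟨_ | c, π⟩
    · simp [Valid] at h
    · exact ih (r := r) h
    · exact ih h.2

theorem valid_of_rows {β : BraidWord n} {π : Path} (hlen : π.length = β.length) (ρ : ℕ → Row n)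
    (h : ∀ l (hl : l < β.length), (π[l]? = some none ∧ ρ (l + 1) = ρ l) ∨
      ∃ c, π[l]? = some (some c) ∧ IsFlat (β.get ⟨l, hl⟩).1 (ρ l) ∧
        ρ (l + 1) = recolor (β.get ⟨l, hl⟩).1 c (ρ l)) :
    Valid β (ρ 0) π ∧ ∀ l ≤ β.length, rowAt β (ρ 0) π l = ρ l := by
  induction β generalizing π ρ with
  | nil =>
    rcases π with _ | ⟨o, π⟩
    · simp [Valid]
    · simp at hlen
  | cons a β ih =>
    rcases π with _ | ⟨o, π⟩
    · simp at hlen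
    · have ih' := ih (π := π) (by simpa using hlen) (fun l => ρ (l + 1)) (fun l hl => by
        simpa using h (l + 1) (by simpa using hl))
      rcases h 0 (by simp) with ⟨h1, h2⟩ | ⟨c, h1, h2, h3⟩
      · simp at h1; subst h1
        simp only [zero_add] at h2 ih'
        rw [h2] at ih'
        refine ⟨ih'.1, fun l hl => ?_⟩
        cases l with
        | zero => simp
        | succ l => exact ih'.2 l (by simpa using hl)
      · simp at h1; subst h1
        simp only [zero_add] at h3 ih'
        rw [h3] at ih'
        refine ⟨⟨h2, ih'.1⟩, fun l hl => ?_⟩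
        cases l with
        | zero => simp
        | succ l => exact ih'.2 l (by simpa using hl)

/-- The path closes up to a colouring of the resolution of the closed braid. -/
def IsClosedPath (β : BraidWord n) (r : Row n) (π : Path) : Prop :=
  Valid β r π ∧ finalRow β r π = r

/-- The colouring of the nodes. -/
def nodeColor (β : BraidWord n) (r : Row n) (π : Path) (x : Node β) : Bool :=
  rowAt β r π x.2.val x.1

theorem shape_getD_eq_false {π : Path} {l : ℕ} (hl : l < π.length)
    (h : (shape π).getD l false = false) : π[l]? = some none := by
  simp only [shape, List.getD_eq_getElem?_getD, List.getElem?_map] at h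
  rw [List.getElem?_eq_getElem hl] at h ⊢
  simpa using h

theorem shape_getD_ne_false {π : Path} {l : ℕ}
    (h : ¬ (shape π).getD l false = false) : ∃ c, π[l]? = some (some c) := by
  simp only [shape, List.getD_eq_getElem?_getD, List.getElem?_map] at h
  rcases hπ : π[l]? with _ | _ | c
  · simp [hπ] at h
  · simp [hπ] at h
  · exact ⟨c, rfl⟩

theorem IsClosedPath.nodeColor_eq_of_arc {β : BraidWord n} {r : Row n} {π : Path}
    (h : IsClosedPath β r π) {x y : Node β} (hxy : Arc β (shapeRes β (shape π)) x y) :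
    nodeColor β r π x = nodeColor β r π y := by
  obtain ⟨hv, hc⟩ := h
  have hlen := hv.length_eq
  have hN : ∀ l : Fin β.length, Braidlike β (shapeRes β (shape π)) l →
      rowAt β r π (l.val + 1) = rowAt β r π l.val := fun l hl =>
    hv.rowAt_succ_of_none
      (shape_getD_eq_false (by rw [hlen]; exact l.2) ((braidlike_shapeRes _ _ _).1 hl))
  have hS : ∀ l : Fin β.length, ¬ Braidlike β (shapeRes β (shape π)) l →
      ∃ c, IsFlat (β.get l).1 (rowAt β r π l.val) ∧
        rowAt β r π (l.val + 1) = recolor (β.get l).1 c (rowAt β r π l.val) := fun l hl => by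
    rw [braidlike_shapeRes] at hl
    obtain ⟨c, hc⟩ := shape_getD_ne_false hl
    exact ⟨c, hv.rowAt_succ_of_some l.2 hc⟩
  cases hxy with
  | closing p =>
    simp only [nodeColor, Fin.val_last, Fin.val_zero, rowAt_zero]
    rw [hv.rowAt_length, hc]
  | pass l p h1 h2 =>
    simp only [nodeColor, Fin.val_castSucc, Fin.val_succ]
    by_cases hl : Braidlike β (shapeRes β (shape π)) l
    · rw [hN l hl]
    · obtain ⟨c, -, h3⟩ := hS l hl
      rw [h3, recolor, if_neg (by tauto)]
  | left l h => simp only [nodeColor, Fin.val_castSucc, Fin.val_succ]; rw [hN l h]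
  | right l h => simp only [nodeColor, Fin.val_castSucc, Fin.val_succ]; rw [hN l h]
  | lower l h =>
    obtain ⟨c, h2, -⟩ := hS l h
    simp only [nodeColor, Fin.val_castSucc]
    exact h2
  | upper l h =>
    obtain ⟨c, -, h3⟩ := hS l h
    simp only [nodeColor, Fin.val_succ]
    rw [h3, recolor_left, recolor_right]

/-- The colouring of the circles. -/
def circColor {β : BraidWord n} {r : Row n} {π : Path} (h : IsClosedPath β r π) :
    StateCircle β (shapeRes β (shape π)) → Bool :=
  Quot.lift (nodeColor β r π) (fun _ _ hxy => h.nodeColor_eq_of_arc hxy)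

/-- The initial row of a colouring of the circles. -/
def rowOf {β : BraidWord n} {v : Resolution β} (ψ : StateCircle β v → Bool) : Row n :=
  fun p => ψ (circ β v (p, 0))

/-- The path of a colouring of the circles. -/
def pathOf {β : BraidWord n} {v : Resolution β} (ψ : StateCircle β v → Bool) : Path :=
  List.ofFn fun l : Fin β.length =>
    if Braidlike β v l then none else some (ψ (circ β v (leftPos (β.get l).1, l.succ)))

/-- Being constant along the arcs at a crossing means that the row above is the row below, or a
recolouring of it at a flat place. Being constant along the closing arcs means that the path closes
up. -/
theorem pathOf_spec {β : BraidWord n} {v : Resolution β} (ψ : StateCircle β v → Bool) :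
    IsClosedPath β (rowOf ψ) (pathOf ψ) ∧
      ∀ x, nodeColor β (rowOf ψ) (pathOf ψ) x = ψ (circ β v x) := by
  -- The default `true` above the last level is never read.
  set ρ : ℕ → Row n := fun l p => if h : l < β.length + 1 then ψ (circ β v (p, ⟨l, h⟩)) else true
  have hρ : ∀ (l : Fin (β.length + 1)) p, ρ l.val p = ψ (circ β v (p, l)) := fun l p => by
    simp only [ρ]; rw [dif_pos l.2]
  have h0 : ρ 0 = rowOf ψ := by
    funext p; exact hρ 0 p
  have hlen : (pathOf ψ).length = β.length := by simp [pathOf]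
  have key := valid_of_rows hlen ρ (fun l hl => by
    have hget : (pathOf ψ)[l]? = some (if Braidlike β v ⟨l, hl⟩ then none else
        some (ψ (circ β v (leftPos (β.get ⟨l, hl⟩).1, (⟨l, hl⟩ : Fin β.length).succ)))) := by
      rw [List.getElem?_eq_getElem (by rw [hlen]; exact hl)]
      simp [pathOf]
    have e0 : ∀ p, ρ l p = ψ (circ β v (p, (⟨l, hl⟩ : Fin β.length).castSucc)) :=
      fun p => hρ (⟨l, hl⟩ : Fin β.length).castSucc p
    have e1 : ∀ p, ρ (l + 1) p = ψ (circ β v (p, (⟨l, hl⟩ : Fin β.length).succ)) :=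
      fun p => hρ (⟨l, hl⟩ : Fin β.length).succ p
    by_cases hb : Braidlike β v ⟨l, hl⟩
    · left
      rw [if_pos hb] at hget
      refine ⟨hget, funext fun p => ?_⟩
      rw [e0, e1]
      have : turn β v ⟨l, hl⟩ p = none := by unfold turn; rw [if_pos hb]
      exact congrArg ψ (Quot.sound (arc_of_turn_eq_none this)).symm
    · right
      rw [if_neg hb] at hget
      refine ⟨_, hget, ?_, funext fun p => ?_⟩
      · unfold IsFlat
        rw [e0, e0]
        exact congrArg ψ (Quot.sound (Arc.lower _ hb))
      · by_cases h1 : p = leftPos (β.get ⟨l, hl⟩).1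
        · rw [h1, recolor_left, e1]
        · by_cases h2 : p = rightPos (β.get ⟨l, hl⟩).1
          · rw [h2, recolor_right, e1]
            exact congrArg ψ (Quot.sound (Arc.upper _ hb)).symm
          · rw [recolor, if_neg (by tauto), e0, e1]
            exact congrArg ψ (Quot.sound (Arc.pass _ p h1 h2)).symm)
  rw [h0] at key
  refine ⟨⟨key.1, ?_⟩, fun x => ?_⟩
  · rw [← key.1.rowAt_length, key.2 _ le_rfl]
    funext p
    rw [← Fin.val_last β.length, hρ]
    exact congrArg ψ (Quot.sound (Arc.closing p))
  · rw [nodeColor, key.2 _ (Nat.lt_succ_iff.1 x.2.2), hρ]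

theorem shapeRes_pathOf {β : BraidWord n} {v : Resolution β} (ψ : StateCircle β v → Bool) :
    shapeRes β (shape (pathOf ψ)) = v := by
  funext l
  have hlen : (pathOf ψ).length = β.length := by simp [pathOf]
  have hget : (pathOf ψ)[l.val]? = some (if Braidlike β v l then none else
        some (ψ (circ β v (leftPos (β.get l).1, l.succ)))) := by
      rw [List.getElem?_eq_getElem (by rw [hlen]; exact l.2)]
      simp [pathOf]
  unfold shapeRes
  simp only [shape, List.getD_eq_getElem?_getD, List.getElem?_map, hget]
  by_cases hb : Braidlike β v l
  · rw [if_pos hb]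
    unfold Braidlike at hb
    rw [hb]
    cases (β.get l).2 <;> simp
  · rw [if_neg hb]
    unfold Braidlike at hb
    revert hb
    cases (β.get l).2 <;> simp

/-! The number of circles as a count of colourings. -/

/-- The number of paths from `s` to `s'` of the shape of `π`, the colours of which are at most
those of `π`. -/
def subCount : BraidWord n → Path → Row n → Row n → ℕ
  | _ :: β, none :: π, s, s' => subCount β π s s'
  | a :: β, some c :: π, s, s' =>
      if IsFlat a.1 s then subCount β π (recolor a.1 false s) s' +
        (if c then subCount β π (recolor a.1 true s) s' else 0) else 0
  | [], _, s, s' => if s = s' then 1 else 0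
  | _ :: _, [], s, s' => if s = s' then 1 else 0

instance (s r : Row n) : Decidable (s ≤ r) := inferInstanceAs (Decidable (∀ p, s p ≤ r p))

/-- The number of closed paths of the shape of `π`, the colours of which are at most those of
`π`. -/
def closedCount (β : BraidWord n) (r : Row n) (π : Path) : ℕ :=
  ∑ s : Row n, if s ≤ r then subCount β π s s else 0

/-- The colours of the first path are at most those of the second one, which has the same shape. -/
def PathLE (ρ π : Path) : Prop :=
  List.Forall₂ (fun o o' => o.isSome = o'.isSome ∧ (o = some true → o' = some true)) ρ π

theorem PathLE.shape_eq {ρ π : Path} (h : PathLE ρ π) : shape ρ = shape π := by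
  induction h with
  | nil => rfl
  | cons h _ ih => simp [h.1, ih]

theorem finite_pathLE (π : Path) : {ρ | PathLE ρ π}.Finite :=
  (List.finite_length_eq (Option Bool) π.length).subset fun _ h => h.length_eq

theorem subCount_eq_ncard {β : BraidWord n} {π : Path} (h : π.length = β.length) (s s' : Row n) :
    subCount β π s s' = {ρ | PathLE ρ π ∧ Valid β s ρ ∧ finalRow β s ρ = s'}.ncard := by
  induction β generalizing π s with
  | nil =>
    have : π = [] := by simpa using h
    subst this
    by_cases hs : s = s'
    · have : {ρ | PathLE ρ [] ∧ Valid [] s ρ ∧ finalRow [] s ρ = s'} = {[]} := by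
        ext ρ
        simp only [Set.mem_setOf_eq, Set.mem_singleton_iff]
        constructor
        · rintro ⟨h1, -⟩; exact List.forall₂_nil_right_iff.1 h1
        · rintro rfl; exact ⟨List.Forall₂.nil, trivial, hs⟩
      rw [this]; simp [subCount, hs]
    · have : {ρ | PathLE ρ [] ∧ Valid [] s ρ ∧ finalRow [] s ρ = s'} = ∅ := by
        ext ρ
        simp only [Set.mem_setOf_eq, Set.mem_empty_iff_false, iff_false]
        rintro ⟨-, -, h3⟩; exact hs h3
      rw [this]; simp [subCount, hs]
  | cons a β ih =>
    rcases π with _ | ⟨_ | c, π⟩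
    · simp at h
    · have hl : π.length = β.length := by simpa using h
      have : {ρ | PathLE ρ (none :: π) ∧ Valid (a :: β) s ρ ∧ finalRow (a :: β) s ρ = s'} =
          (fun ρ => none :: ρ) '' {ρ | PathLE ρ π ∧ Valid β s ρ ∧ finalRow β s ρ = s'} := by
        ext ρ
        rcases ρ with _ | ⟨_ | d, ρ⟩ <;> simp [PathLE, Valid, finalRow]
      rw [this, Set.ncard_image_of_injective _ (List.cons_injective), ← ih hl]
      rfl
    · have hl : π.length = β.length := by simpa using h
      by_cases hf : IsFlat a.1 s
      · have hu : {ρ | PathLE ρ (some c :: π) ∧ Valid (a :: β) s ρ ∧ finalRow (a :: β) s ρ = s'} =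
            (fun ρ => some false :: ρ) '' {ρ | PathLE ρ π ∧ Valid β (recolor a.1 false s) ρ ∧
              finalRow β (recolor a.1 false s) ρ = s'} ∪
            (if c then (fun ρ => some true :: ρ) '' {ρ | PathLE ρ π ∧
              Valid β (recolor a.1 true s) ρ ∧ finalRow β (recolor a.1 true s) ρ = s'} else ∅) := by
          ext ρ
          rcases ρ with _ | ⟨_ | _ | _, ρ⟩ <;> cases c <;> simp [PathLE, Valid, finalRow, hf]
        have hfin : ∀ t : Row n, {ρ | PathLE ρ π ∧ Valid β t ρ ∧ finalRow β t ρ = s'}.Finite :=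
          fun t => (finite_pathLE π).subset fun _ h => h.1
        rw [hu, Set.ncard_union_eq ?_ ?_ ?_,
          Set.ncard_image_of_injective _ (List.cons_injective), ← ih hl]
        · simp only [subCount, if_pos hf]
          cases c
          · simp
          · simp [Set.ncard_image_of_injective _ (List.cons_injective), ← ih hl]
        · rw [Set.disjoint_left]
          rintro _ ⟨ρ, -, rfl⟩ h2
          cases c <;> simp at h2
        · exact (hfin _).image _
        · cases c
          · simp
          · exact (hfin _).image _
      · have : {ρ | PathLE ρ (some c :: π) ∧ Valid (a :: β) s ρ ∧
            finalRow (a :: β) s ρ = s'} = ∅ := by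
          ext ρ
          rcases ρ with _ | ⟨_ | d, ρ⟩ <;> simp [PathLE, Valid, finalRow, hf]
        rw [this]; simp [subCount, hf]

theorem rowAt_mono {β : BraidWord n} {s r : Row n} {ρ π : Path} (h : PathLE ρ π) (hs : s ≤ r)
    (l : ℕ) : rowAt β s ρ l ≤ rowAt β r π l := by
  induction β generalizing s r ρ π l with
  | nil => simpa [rowAt] using hs
  | cons a β ih =>
    rcases h with _ | ⟨hd, tl⟩
    · simpa [rowAt] using hs
    · rename_i o o' ρ π
      cases l with
      | zero => simpa using hs
      | succ l =>
        rcases o with _ | d <;> rcases o' with _ | c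
        · exact ih tl hs l
        · simp at hd
        · simp at hd
        · refine ih tl (recolor_mono hs ?_) l
          cases d
          · exact Bool.false_le _
          · have := hd.2 rfl
            simp at this; subst this; exact le_rfl

theorem pathLE_of_get {ρ π : Path} (hlen : ρ.length = π.length)
    (h : ∀ l, l < π.length → ∀ o o', ρ[l]? = some o → π[l]? = some o' →
      o.isSome = o'.isSome ∧ (o = some true → o' = some true)) : PathLE ρ π := by
  induction ρ generalizing π with
  | nil =>
    have : π = [] := by simpa using hlen.symm
    subst this; exact List.Forall₂.nil
  | cons o ρ ih =>
    rcases π with _ | ⟨o', π⟩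
    · simp at hlen
    · refine List.Forall₂.cons (h 0 (by simp) o o' (by simp) (by simp))
        (ih (by simpa using hlen) ?_)
      intro l hl p p' hp hp'
      exact h (l + 1) (by simpa using hl) p p' (by simpa using hp) (by simpa using hp')

theorem IsClosedPath.pathLE_pathOf {β : BraidWord n} {r : Row n} {π : Path}
    (h : IsClosedPath β r π) (ψ : StateCircle β (shapeRes β (shape π)) → Bool)
    (hψ : ∀ c, ψ c = true → circColor h c = true) : PathLE (pathOf ψ) π := by
  have hlen : (pathOf ψ).length = β.length := by simp [pathOf]
  have hlen' := h.1.length_eq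
  refine pathLE_of_get (by omega) fun l hl o o' ho ho' => ?_
  have hlt : l < β.length := by omega
  have hget : (pathOf ψ)[l]? = some (if Braidlike β (shapeRes β (shape π)) ⟨l, hlt⟩ then none else
      some (ψ (circ β _ (leftPos (β.get ⟨l, hlt⟩).1, (⟨l, hlt⟩ : Fin β.length).succ)))) := by
    rw [List.getElem?_eq_getElem (by rw [hlen]; exact hlt)]
    simp [pathOf]
  rw [ho] at hget
  by_cases hb : Braidlike β (shapeRes β (shape π)) ⟨l, hlt⟩
  · rw [if_pos hb] at hget
    rw [shape_getD_eq_false hl ((braidlike_shapeRes _ _ _).1 hb)] at ho'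
    simp at hget ho'
    subst hget ho'
    simp
  · rw [if_neg hb] at hget
    rw [braidlike_shapeRes] at hb
    obtain ⟨c, hc⟩ := shape_getD_ne_false hb
    rw [hc] at ho'
    simp only [Option.some.injEq] at hget ho'
    subst hget ho'
    refine ⟨rfl, fun h1 => ?_⟩
    have := hψ _ (Option.some.inj h1)
    rw [circColor] at this
    change nodeColor β r π _ = true at this
    rw [nodeColor] at this
    simp only [Fin.val_succ] at this
    rw [(h.1.rowAt_succ_of_some hlt hc).2, recolor_left] at this
    rw [this]

theorem shape_eq_rows {β : BraidWord n} {r : Row n} {π π' : Path} (h : Valid β r π)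
    (h' : Valid β r π') (hs : shape π = shape π')
    (hrow : ∀ l ≤ β.length, rowAt β r π l = rowAt β r π' l) : π = π' := by
  have hl := h.length_eq
  have hl' := h'.length_eq
  refine List.ext_getElem? fun l => ?_
  by_cases hlt : l < β.length
  · by_cases hb : (shape π).getD l false = false
    · rw [shape_getD_eq_false (by omega) hb, shape_getD_eq_false (by omega) (hs ▸ hb)]
    · obtain ⟨c, hc⟩ := shape_getD_ne_false hb
      rw [hs] at hb
      obtain ⟨d, hd⟩ := shape_getD_ne_false hb
      have e1 := (h.rowAt_succ_of_some hlt hc).2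
      have e2 := (h'.rowAt_succ_of_some hlt hd).2
      have := hrow (l + 1) hlt
      rw [e1, e2] at this
      have := congrFun this (leftPos (β.get ⟨l, hlt⟩).1)
      rw [recolor_left, recolor_left] at this
      rw [hc, hd, this]
  · rw [List.getElem?_eq_none (by omega), List.getElem?_eq_none (by omega)]

theorem shapeRes_injective {β : BraidWord n} {e e' : List Bool} (h : e.length = β.length)
    (h' : e'.length = β.length) (he : shapeRes β e = shapeRes β e') : e = e' := by
  refine List.ext_getElem (by omega) fun l h1 h2 => ?_
  have := congrFun he ⟨l, by omega⟩
  unfold shapeRes at this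
  simp only [List.getD_eq_getElem?_getD] at this
  rw [List.getElem?_eq_getElem h1, List.getElem?_eq_getElem h2] at this
  simp only [Option.getD_some] at this
  revert this
  cases e[l] <;> cases e'[l] <;> cases (β.get ⟨l, by omega⟩).2 <;> simp

/-- Closed paths of a fixed shape are the same as colourings of the circles of that resolution,
through `pathOf` and `nodeColor`, and the order on paths and initial rows is the pointwise order on
colourings. -/
theorem closedCount_eq_card {β : BraidWord n} {r : Row n} {π : Path} (h : IsClosedPath β r π) :
    closedCount β r π = Nat.card {ψ : StateCircle β (shapeRes β (shape π)) → Bool //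
      ∀ c, ψ c = true → circColor h c = true} := by
  have hsum : closedCount β r π =
      Nat.card {x : Row n × Path // x.1 ≤ r ∧ PathLE x.2 π ∧ IsClosedPath β x.1 x.2} := by
    have hfin : ∀ s : Row n, Finite {ρ : Path // s ≤ r ∧ PathLE ρ π ∧ IsClosedPath β s ρ} :=
      fun s =>
      Set.Finite.to_subtype ((finite_pathLE π).subset fun _ h => h.2.1)
    rw [Nat.card_congr (Equiv.subtypeProdEquivSigmaSubtype
      (fun (s : Row n) (ρ : Path) => s ≤ r ∧ PathLE ρ π ∧ IsClosedPath β s ρ)), Nat.card_sigma]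
    refine Finset.sum_congr rfl fun s _ => ?_
    by_cases hs : s ≤ r
    · rw [if_pos hs, subCount_eq_ncard h.1.length_eq, ← Nat.card_coe_set_eq]
      refine Nat.card_congr (Equiv.subtypeEquivRight fun ρ => ?_)
      simp [hs, IsClosedPath]
    · rw [if_neg hs]
      have : IsEmpty {ρ : Path // s ≤ r ∧ PathLE ρ π ∧ IsClosedPath β s ρ} := ⟨fun x => hs x.2.1⟩
      simp
  rw [hsum]
  symm
  refine Nat.card_congr
    (Equiv.ofBijective (fun ψ => ⟨(rowOf ψ.1, pathOf ψ.1), ?_, ?_, ?_⟩) ⟨?_, ?_⟩)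
  · intro p
    change ψ.1 _ ≤ r p
    have := ψ.2 (circ β _ (p, 0))
    change ψ.1 _ = true → nodeColor β r π (p, 0) = true at this
    rw [nodeColor] at this
    simp only [Fin.val_zero, rowAt_zero] at this
    exact this
  · exact h.pathLE_pathOf _ ψ.2
  · exact (pathOf_spec ψ.1).1
  · rintro ⟨ψ, hψ⟩ ⟨ψ', hψ'⟩ he
    simp only [Subtype.mk.injEq, Prod.mk.injEq] at he
    refine Subtype.ext (funext fun c => ?_)
    induction c using Quot.ind with
    | mk x =>
      change ψ (circ β _ x) = ψ' (circ β _ x)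
      rw [← (pathOf_spec ψ).2 x, ← (pathOf_spec ψ').2 x, he.1, he.2]
  · rintro ⟨⟨s, ρ⟩, hs, hle, hcl⟩
    simp only at hs hle hcl
    have hshape := hle.shape_eq
    have harc : ∀ x y, Arc β (shapeRes β (shape π)) x y → nodeColor β s ρ x = nodeColor β s ρ y :=
      fun x y hxy => hcl.nodeColor_eq_of_arc (by rw [hshape]; exact hxy)
    refine ⟨⟨Quot.lift (nodeColor β s ρ) harc, fun c => ?_⟩, ?_⟩
    · induction c using Quot.ind with
      | mk x =>
        change nodeColor β s ρ x = true → nodeColor β r π x = true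
        exact rowAt_mono hle hs x.2.val x.1
    · set ψ : StateCircle β (shapeRes β (shape π)) → Bool := Quot.lift (nodeColor β s ρ) harc
      have hrow : rowOf ψ = s := by
        funext p
        change nodeColor β s ρ (p, 0) = s p
        simp [nodeColor]
      have hspec := pathOf_spec ψ
      rw [hrow] at hspec
      simp only [Subtype.mk.injEq, Prod.mk.injEq]
      refine ⟨hrow, shape_eq_rows hspec.1.1 hcl.1 ?_ fun l hl => funext fun p => ?_⟩
      · rw [hshape]
        exact shapeRes_injective (by rw [shape_length, hspec.1.1.length_eq])
          (by rw [shape_length, h.1.length_eq]) (shapeRes_pathOf ψ)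
      · exact hspec.2 (p, ⟨l, Nat.lt_succ_of_le hl⟩)

/-- A smaller colouring is free on the circles of colour `true` and forced on the others. As the
left side is a recursion along the word, numbers of circles can be compared for different words
without a bijection between their quotients. -/
theorem closedCount_eq_two_pow {β : BraidWord n} {r : Row n} {π : Path} (h : IsClosedPath β r π) :
    closedCount β r π =
      2 ^ (Finset.univ.filter fun c => circColor h c = true).card := by
  classical
  rw [closedCount_eq_card h]
  have : ∀ ψ : StateCircle β (shapeRes β (shape π)) → Bool,
      (∀ c, ψ c = true → circColor h c = true) ↔ ψ ∈ Fintype.piFinset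
        (fun c => if circColor h c = true then Finset.univ else ({false} : Finset Bool)) := by
    intro ψ
    rw [Fintype.mem_piFinset]
    refine forall_congr' fun c => ?_
    split_ifs with hc <;> simp [hc]
  simp_rw [this]
  rw [Nat.card_eq_fintype_card, Fintype.card_coe, Fintype.card_piFinset]
  rw [Finset.prod_congr rfl (g := fun c => if circColor h c = true then 2 else 1)
    (fun c _ => by split_ifs <;> simp)]
  rw [Finset.prod_ite]
  simp

/-! The saddle between two resolutions. -/

/-- The stated alternative is reflexive, symmetric and transitive, so it passes from the generating
relation `R'` to the equivalence that it generates: nothing but the classes of `a` and `b` can be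
glued. -/
theorem quot_merge_exact {α : Type*} {R R' : α → α → Prop} {a b x y : α}
    (h4 : ∀ x y, R' x y → Quot.mk R x = Quot.mk R y ∨
      ((Quot.mk R x = Quot.mk R a ∨ Quot.mk R x = Quot.mk R b) ∧
        (Quot.mk R y = Quot.mk R a ∨ Quot.mk R y = Quot.mk R b)))
    (h : Quot.mk R' x = Quot.mk R' y) : Quot.mk R x = Quot.mk R y ∨
      ((Quot.mk R x = Quot.mk R a ∨ Quot.mk R x = Quot.mk R b) ∧
        (Quot.mk R y = Quot.mk R a ∨ Quot.mk R y = Quot.mk R b)) := by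
  have := Quot.eqvGen_exact h
  clear h
  induction this with
  | rel x y h => exact h4 x y h
  | refl x => exact Or.inl rfl
  | symm x y _ ih =>
    rcases ih with ih | ih
    · exact Or.inl ih.symm
    · exact Or.inr ⟨ih.2, ih.1⟩
  | trans x y z _ _ ih1 ih2 =>
    rcases ih1 with ih1 | ih1
    · rw [ih1]; exact ih2
    · rcases ih2 with ih2 | ih2
      · rw [← ih2]; exact Or.inr ih1
      · exact Or.inr ⟨ih1.1, ih2.2⟩

/-- Once the class of `b` is removed, the map of quotients is a bijection; the removed class
contributes the extra factor. The form with products serves for counting circles as well as for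
weights and values of marks. -/
theorem prod_quot_merge {α M : Type*} [CommMonoid M] {R R' : α → α → Prop} [Fintype (Quot R)]
    [Fintype (Quot R')] {a b : α} (h1 : Quot.mk R a ≠ Quot.mk R b)
    (h2 : Quot.mk R' a = Quot.mk R' b) (h3 : ∀ x y, R x y → Quot.mk R' x = Quot.mk R' y)
    (h4 : ∀ x y, R' x y → Quot.mk R x = Quot.mk R y ∨
      ((Quot.mk R x = Quot.mk R a ∨ Quot.mk R x = Quot.mk R b) ∧
        (Quot.mk R y = Quot.mk R a ∨ Quot.mk R y = Quot.mk R b)))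
    (f : Quot R' → M) :
    ∏ c : Quot R, f (Quot.lift (Quot.mk R') h3 c) = f (Quot.mk R' a) * ∏ c : Quot R', f c := by
  classical
  set p : Quot R → Quot R' := Quot.lift (Quot.mk R') h3 with hp
  rw [← Finset.mul_prod_erase Finset.univ (fun c => f (p c)) (Finset.mem_univ (Quot.mk R b))]
  have e : p (Quot.mk R b) = Quot.mk R' a := h2.symm
  rw [e]
  congr 1
  have key := fun x y => quot_merge_exact (x := x) (y := y) h4
  refine Finset.prod_bij (fun c _ => p c) (fun _ _ => Finset.mem_univ _) ?_ ?_ (fun _ _ => rfl)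
  · intro c hc d hd h
    induction c using Quot.ind with
    | mk x =>
    induction d using Quot.ind with
    | mk y =>
      rcases key x y h with h | ⟨hx, hy⟩
      · exact h
      · rcases hx with hx | hx
        · rcases hy with hy | hy
          · rw [hx, hy]
          · exact absurd hy (Finset.ne_of_mem_erase hd)
        · exact absurd hx (Finset.ne_of_mem_erase hc)
  · intro c _
    induction c using Quot.ind with
    | mk x =>
      by_cases hx : Quot.mk R x = Quot.mk R b
      · refine ⟨Quot.mk R a, Finset.mem_erase.2 ⟨h1, Finset.mem_univ _⟩, ?_⟩
        have : p (Quot.mk R x) = p (Quot.mk R b) := by rw [hx]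
        exact h2.trans this.symm
      · exact ⟨Quot.mk R x, Finset.mem_erase.2 ⟨hx, Finset.mem_univ _⟩, rfl⟩

/-- The arcs away from crossing `l` are common to both resolutions. The others end at the four
corners of `l`, and in every resolution `w` these lie on the circles through `cornerA` and
`cornerB`. -/
theorem arc_transfer {β : BraidWord n} {v v' : Resolution β} {l : Fin β.length}
    (hne : ∀ k, k ≠ l → v k = v' k) {x y : Node β} (h : Arc β v x y) (w : Resolution β) :
    Arc β v' x y ∨ ((circ β w x = circ β w (cornerA β l) ∨ circ β w x = circ β w (cornerB β l)) ∧
      (circ β w y = circ β w (cornerA β l) ∨ circ β w y = circ β w (cornerB β l))) := by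
  have hiff : ∀ k, k ≠ l → (Braidlike β v k ↔ Braidlike β v' k) := fun k hk => by
    simp only [Braidlike, hne k hk]
  have hcorner : ∀ p, p = leftPos (β.get l).1 ∨ p = rightPos (β.get l).1 →
      (circ β w (p, l.castSucc) = circ β w (cornerA β l) ∨
        circ β w (p, l.castSucc) = circ β w (cornerB β l)) ∧
      (circ β w (p, l.succ) = circ β w (cornerA β l) ∨
        circ β w (p, l.succ) = circ β w (cornerB β l)) := by
    intro p hp
    by_cases hb : Braidlike β w l
    · rcases hp with rfl | rfl
      · exact ⟨Or.inl rfl, Or.inl (Quot.sound (Arc.left l hb)).symm⟩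
      · exact ⟨Or.inr (Quot.sound (Arc.right l hb)), Or.inr rfl⟩
    · rcases hp with rfl | rfl
      · exact ⟨Or.inl rfl, Or.inr (Quot.sound (Arc.upper l hb))⟩
      · exact ⟨Or.inl (Quot.sound (Arc.lower l hb)).symm, Or.inr rfl⟩
  cases h with
  | closing p => exact Or.inl (Arc.closing p)
  | pass k p h1 h2 => exact Or.inl (Arc.pass k p h1 h2)
  | left k h =>
    by_cases hk : k = l
    · subst hk; exact Or.inr ⟨(hcorner _ (Or.inl rfl)).1, (hcorner _ (Or.inl rfl)).2⟩
    · exact Or.inl (Arc.left k ((hiff k hk).1 h))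
  | right k h =>
    by_cases hk : k = l
    · subst hk; exact Or.inr ⟨(hcorner _ (Or.inr rfl)).1, (hcorner _ (Or.inr rfl)).2⟩
    · exact Or.inl (Arc.right k ((hiff k hk).1 h))
  | lower k h =>
    by_cases hk : k = l
    · subst hk; exact Or.inr ⟨(hcorner _ (Or.inl rfl)).1, (hcorner _ (Or.inr rfl)).1⟩
    · exact Or.inl (Arc.lower k (fun hb => h ((hiff k hk).2 hb)))
  | upper k h =>
    by_cases hk : k = l
    · subst hk; exact Or.inr ⟨(hcorner _ (Or.inl rfl)).2, (hcorner _ (Or.inr rfl)).2⟩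
    · exact Or.inl (Arc.upper k (fun hb => h ((hiff k hk).2 hb)))

theorem circ_eq_of_arc {β : BraidWord n} {v v' : Resolution β} {l : Fin β.length}
    (hne : ∀ k, k ≠ l → v k = v' k)
    (h' : circ β v' (cornerA β l) = circ β v' (cornerB β l)) (x y : Node β) (hxy : Arc β v x y) :
    circ β v' x = circ β v' y := by
  rcases arc_transfer hne hxy v' with h | ⟨h1, h2⟩
  · exact Quot.sound h
  · rw [h'] at h1 h2
    rw [or_self_iff] at h1 h2
    rw [h1, h2]

theorem circ_merge_exact {β : BraidWord n} {v v' : Resolution β} {l : Fin β.length}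
    (hne : ∀ k, k ≠ l → v k = v' k) {x y : Node β} (h : circ β v' x = circ β v' y) :
    circ β v x = circ β v y ∨
      ((circ β v x = circ β v (cornerA β l) ∨ circ β v x = circ β v (cornerB β l)) ∧
        (circ β v y = circ β v (cornerA β l) ∨ circ β v y = circ β v (cornerB β l))) :=
  quot_merge_exact (fun x y hxy => by
    rcases arc_transfer (fun k hk => (hne k hk).symm) hxy v with h | h
    · exact Or.inl (Quot.sound h)
    · exact Or.inr h) h

/-- The map from the circles before a merge to those after it. -/
def mergeMap {β : BraidWord n} {v v' : Resolution β} {l : Fin β.length}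
    (hne : ∀ k, k ≠ l → v k = v' k)
    (h' : circ β v' (cornerA β l) = circ β v' (cornerB β l)) :
    StateCircle β v → StateCircle β v' :=
  Quot.lift (circ β v') (circ_eq_of_arc hne h')

/-- Circles in a merge. -/
theorem prod_circles_merge {M : Type*} [CommMonoid M] {β : BraidWord n} {v v' : Resolution β}
    {l : Fin β.length} (hne : ∀ k, k ≠ l → v k = v' k)
    (h : circ β v (cornerA β l) ≠ circ β v (cornerB β l))
    (h' : circ β v' (cornerA β l) = circ β v' (cornerB β l)) (f : StateCircle β v' → M) :
    ∏ c : StateCircle β v, f (mergeMap hne h' c) =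
      f (circ β v' (cornerA β l)) * ∏ c : StateCircle β v', f c :=
  prod_quot_merge h h' (circ_eq_of_arc hne h')
    (fun x y hxy => by
      rcases arc_transfer (fun k hk => (hne k hk).symm) hxy v with h | h
      · exact Or.inl (Quot.sound h)
      · exact Or.inr h) f

theorem card_circles_merge {β : BraidWord n} {v v' : Resolution β}
    {l : Fin β.length} (hne : ∀ k, k ≠ l → v k = v' k)
    (h : circ β v (cornerA β l) ≠ circ β v (cornerB β l))
    (h' : circ β v' (cornerA β l) = circ β v' (cornerB β l)) :
    Fintype.card (StateCircle β v) = Fintype.card (StateCircle β v') + 1 := by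
  -- Counting is the product of the constant function with value the generator of `Multiplicative
  -- ℕ`.
  have := prod_circles_merge (M := Multiplicative ℕ) hne h h' (fun _ => Multiplicative.ofAdd 1)
  simp only [Finset.prod_const, Finset.card_univ, ← ofAdd_nsmul, smul_eq_mul, mul_one,
    ← ofAdd_add] at this
  have := Multiplicative.ofAdd.injective this
  omega

/-! Weights. -/

/-- The path of a given shape with all colours `true`. -/
def topPath (e : List Bool) : Path := e.map fun b => if b then some true else none

@[simp] theorem shape_topPath (e : List Bool) : shape (topPath e) = e := by
  induction e with
  | nil => rfl
  | cons b e ih => cases b <;> simpa [topPath] using ih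

theorem isClosedPath_topPath {β : BraidWord n} {e : List Bool} (h : e.length = β.length) :
    IsClosedPath β ⊤ (topPath e) := by
  induction β generalizing e with
  | nil => simp at h; subst h; exact ⟨trivial, rfl⟩
  | cons a β ih =>
    rcases e with _ | ⟨b, e⟩
    · simp at h
    · have ih' := ih (e := e) (by simpa using h)
      have hr : recolor a.1 true (⊤ : Row n) = ⊤ := by funext p; simp [recolor]
      cases b
      · exact ih'
      · refine ⟨⟨rfl, ?_⟩, ?_⟩
        · change Valid β (recolor a.1 true ⊤) _; rw [hr]; exact ih'.1
        · change finalRow β (recolor a.1 true ⊤) _ = _; rw [hr]; exact ih'.2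

/-- The number of circles of a resolution of a given shape. -/
def numCircles (β : BraidWord n) (e : List Bool) : ℕ := Nat.log 2 (closedCount β ⊤ (topPath e))

/-- The number of circles of colour `true`. -/
def numTrue (β : BraidWord n) (r : Row n) (π : Path) : ℕ := Nat.log 2 (closedCount β r π)

theorem numTrue_eq {β : BraidWord n} {r : Row n} {π : Path} (h : IsClosedPath β r π) :
    numTrue β r π = (Finset.univ.filter fun c => circColor h c = true).card := by
  rw [numTrue, closedCount_eq_two_pow h, Nat.log_pow (by norm_num)]

theorem nodeColor_topPath {β : BraidWord n} {e : List Bool} (h : e.length = β.length) (x : Node β) :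
    nodeColor β ⊤ (topPath e) x = true := by
  have : ∀ (β : BraidWord n) (e : List Bool) (l : ℕ), rowAt β ⊤ (topPath e) l = ⊤ := by
    intro β
    induction β with
    | nil => intro e l; simp [rowAt]
    | cons a β ih =>
      intro e l
      have hr : recolor a.1 true (⊤ : Row n) = ⊤ := by funext p; simp [recolor]
      rcases e with _ | ⟨_ | _, e⟩ <;> rcases l with _ | l <;> simp [topPath, rowAt]
      · exact ih e l
      · rw [hr]; exact ih e l
  rw [nodeColor, this]; rfl

theorem numCircles_eq {β : BraidWord n} {e : List Bool} (h : e.length = β.length) :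
    numCircles β e = Fintype.card (StateCircle β (shapeRes β e)) := by
  have hc := isClosedPath_topPath h
  have : numCircles β e = numTrue β ⊤ (topPath e) := rfl
  rw [this, numTrue_eq hc, Finset.filter_true_of_mem]
  · rw [Finset.card_univ]
    simp only [shape_topPath]
  · intro c _
    induction c using Quot.ind with
    | mk x => exact nodeColor_topPath h x

/-- The normalization factor of a basis element in the basis of colourings: the product of the
inverses of the numbers `rt` of the colours of the circles. -/
noncomputable def weight (β : BraidWord n) (r : Row n) (π : Path) : ℂ :=
  (rt true)⁻¹ ^ numTrue β r π * (rt false)⁻¹ ^ (numCircles β (shape π) - numTrue β r π)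

/-- The definition of `weight` by two counts is suited to local moves, this product over the circles
to saddles, which add or remove one factor. -/
theorem weight_eq {β : BraidWord n} {r : Row n} {π : Path} (h : IsClosedPath β r π) :
    weight β r π = ∏ c, (rt (circColor h c))⁻¹ := by
  have hlen : (shape π).length = β.length := by rw [shape_length, h.1.length_eq]
  have e1 : (Finset.univ.filter fun c => ¬ circColor h c = true).card =
      numCircles β (shape π) - numTrue β r π := by
    have := Finset.card_filter_add_card_filter_not (s := Finset.univ)
      (fun c => circColor h c = true)
    rw [Finset.card_univ] at this
    rw [numTrue_eq h, numCircles_eq hlen]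
    omega
  rw [weight, ← e1, numTrue_eq h, ← Finset.prod_const, ← Finset.prod_const,
    ← Finset.prod_filter_mul_prod_filter_not Finset.univ (fun c => circColor h c = true)]
  congr 1
  · refine Finset.prod_congr rfl fun c hc => ?_
    rw [(Finset.mem_filter.1 hc).2]
  · refine Finset.prod_congr rfl fun c hc => ?_
    have := (Finset.mem_filter.1 hc).2
    rw [Bool.not_eq_true] at this
    rw [this]

theorem weight_ne_zero (β : BraidWord n) (r : Row n) (π : Path) : weight β r π ≠ 0 := by
  unfold weight
  exact mul_ne_zero (pow_ne_zero _ (inv_ne_zero (rt_ne_zero _)))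
    (pow_ne_zero _ (inv_ne_zero (rt_ne_zero _)))

/-! ### Paths in a concatenated word. -/

theorem valid_append {α γ : BraidWord n} {r : Row n} {πα πγ : Path}
    (h : πα.length = α.length) :
    Valid (α ++ γ) r (πα ++ πγ) ↔ Valid α r πα ∧ Valid γ (finalRow α r πα) πγ := by
  induction α generalizing r πα with
  | nil => simp at h; subst h; simp [Valid, finalRow]
  | cons a α ih =>
    rcases πα with _ | ⟨_ | c, πα⟩
    · simp at h
    · simpa [Valid, finalRow] using ih (by simpa using h)
    · simp only [List.cons_append, Valid, finalRow, ih (by simpa using h), and_assoc]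

theorem finalRow_append {α γ : BraidWord n} {r : Row n} {πα πγ : Path}
    (h : πα.length = α.length) :
    finalRow (α ++ γ) r (πα ++ πγ) = finalRow γ (finalRow α r πα) πγ := by
  induction α generalizing r πα with
  | nil => simp at h; subst h; simp [finalRow]
  | cons a α ih =>
    rcases πα with _ | ⟨_ | c, πα⟩
    · simp at h
    · simpa [finalRow] using ih (by simpa using h)
    · simpa [finalRow] using ih (by simpa using h)

theorem rowAt_append_left {α γ : BraidWord n} {r : Row n} {πα πγ : Path}
    (h : πα.length = α.length) {l : ℕ} (hl : l ≤ α.length) :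
    rowAt (α ++ γ) r (πα ++ πγ) l = rowAt α r πα l := by
  induction α generalizing r πα l with
  | nil => simp at hl; subst hl; simp
  | cons a α ih =>
    rcases πα with _ | ⟨_ | c, πα⟩
    · simp at h
    all_goals
      cases l with
      | zero => simp
      | succ l => exact ih (by simpa using h) (by simpa using hl)

theorem rowAt_append_right {α γ : BraidWord n} {r : Row n} {πα πγ : Path}
    (h : πα.length = α.length) (l : ℕ) :
    rowAt (α ++ γ) r (πα ++ πγ) (α.length + l) = rowAt γ (finalRow α r πα) πγ l := by
  induction α generalizing r πα l with
  | nil => simp at h; subst h; simp [finalRow]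
  | cons a α ih =>
    rcases πα with _ | ⟨_ | c, πα⟩
    · simp at h
    · rw [List.length_cons, add_right_comm]; exact ih (by simpa using h) l
    · rw [List.length_cons, add_right_comm]; exact ih (by simpa using h) l

theorem weight_eq_prod {β : BraidWord n} {r : Row n} {π : Path} (h : IsClosedPath β r π)
    {v : Resolution β} (hv : shapeRes β (shape π) = v) (col : StateCircle β v → Bool)
    (hcol : ∀ x, col (circ β v x) = nodeColor β r π x) :
    weight β r π = ∏ c, (rt (col c))⁻¹ := by
  subst hv
  rw [weight_eq h]
  have : circColor h = col := by
    funext c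
    induction c using Quot.ind with
    | mk x => exact (hcol x).symm
  rw [this]

theorem IsClosedPath.exists_col {β : BraidWord n} {r : Row n} {π : Path} (h : IsClosedPath β r π)
    {v : Resolution β} (hv : shapeRes β (shape π) = v) :
    ∃ col : StateCircle β v → Bool, ∀ x, col (circ β v x) = nodeColor β r π x := by
  subst hv
  exact ⟨circColor h, fun _ => rfl⟩

/-! ### The two paths on the sides of a saddle. -/

theorem finalRow_saddle {a : Fin (n - 1) × Bool} {ρ : Row n} (hf : IsFlat a.1 ρ) (γ : BraidWord n)
    (πγ : Path) : finalRow (a :: γ) ρ (some (ρ (leftPos a.1)) :: πγ) =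
      finalRow (a :: γ) ρ (none :: πγ) := by
  simp only [finalRow, recolor_self hf]

section
variable {α γ : BraidWord n} {a : Fin (n - 1) × Bool} {r : Row n} {πα πγ : Path}

theorem isClosedPath_none_iff_some (hα : πα.length = α.length)
    (hf : IsFlat a.1 (finalRow α r πα)) :
    IsClosedPath (α ++ a :: γ) r (πα ++ some (finalRow α r πα (leftPos a.1)) :: πγ) ↔
      IsClosedPath (α ++ a :: γ) r (πα ++ none :: πγ) := by
  unfold IsClosedPath
  rw [valid_append hα, valid_append hα, finalRow_append hα, finalRow_append hα,
    finalRow_saddle hf]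
  simp only [Valid, recolor_self hf, hf, true_and]

theorem IsClosedPath.isFlat {c : Bool} (hα : πα.length = α.length)
    (h : IsClosedPath (α ++ a :: γ) r (πα ++ some c :: πγ)) : IsFlat a.1 (finalRow α r πα) :=
  ((valid_append hα).1 h.1).2.1

/-- Recolouring a flat place by its own colour changes nothing. Hence the two ends of a saddle have
the same colour at every node, and only their weights differ. -/
theorem rowAt_saddle (hα : πα.length = α.length) (hf : IsFlat a.1 (finalRow α r πα)) (l : ℕ) :
    rowAt (α ++ a :: γ) r (πα ++ some (finalRow α r πα (leftPos a.1)) :: πγ) l =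
      rowAt (α ++ a :: γ) r (πα ++ none :: πγ) l := by
  rcases le_or_gt l α.length with hl | hl
  · rw [rowAt_append_left hα hl, rowAt_append_left hα hl]
  · obtain ⟨m, rfl⟩ := Nat.exists_eq_add_of_lt hl
    rw [add_assoc, rowAt_append_right hα, rowAt_append_right hα]
    simp only [rowAt, recolor_self hf]

theorem rowAt_corner (hα : πα.length = α.length) (o : Option Bool) :
    rowAt (α ++ a :: γ) r (πα ++ o :: πγ) α.length = finalRow α r πα := by
  have := rowAt_append_right (γ := a :: γ) (r := r) (πγ := o :: πγ) hα 0
  simpa using this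

theorem rowAt_corner_none (hα : πα.length = α.length) :
    rowAt (α ++ a :: γ) r (πα ++ none :: πγ) (α.length + 1) = finalRow α r πα := by
  rw [rowAt_append_right hα]
  simp [rowAt]

theorem rowAt_corner_some (hα : πα.length = α.length) (c : Bool) :
    rowAt (α ++ a :: γ) r (πα ++ some c :: πγ) (α.length + 1) =
      recolor a.1 c (finalRow α r πα) := by
  rw [rowAt_append_right hα]
  simp [rowAt]

end

theorem shapeRes_none_some {α γ : BraidWord n} {a : Fin (n - 1) × Bool} {eα eγ : List Bool}
    (hα : eα.length = α.length) (l : Fin (α ++ a :: γ).length) (hl : l.val = α.length) :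
    (Braidlike _ (shapeRes (α ++ a :: γ) (eα ++ false :: eγ)) l ∧
      ¬ Braidlike _ (shapeRes (α ++ a :: γ) (eα ++ true :: eγ)) l) ∧
    ∀ k, k ≠ l → shapeRes (α ++ a :: γ) (eα ++ false :: eγ) k =
      shapeRes (α ++ a :: γ) (eα ++ true :: eγ) k := by
  refine ⟨⟨?_, ?_⟩, fun k hk => ?_⟩
  · rw [braidlike_shapeRes, hl, ← hα]; simp
  · rw [braidlike_shapeRes, hl, ← hα]; simp
  · have hk' : k.val ≠ α.length := fun h => hk (Fin.ext (h.trans hl.symm))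
    unfold shapeRes
    congr 1
    simp only [List.getD_eq_getElem?_getD]
    rcases lt_or_gt_of_ne hk' with h | h
    · rw [List.getElem?_append_left (by omega), List.getElem?_append_left (by omega)]
    · rw [List.getElem?_append_right (by omega), List.getElem?_append_right (by omega)]
      obtain ⟨m, hm⟩ : ∃ m, k.val - eα.length = m + 1 := ⟨k.val - eα.length - 1, by omega⟩
      rw [hm]; simp

/-- A saddle changes the number of circles by one, in either direction. -/
theorem saddle_dichotomy (α γ : BraidWord n) (a : Fin (n - 1) × Bool) {eα eγ : List Bool}
    (hα : eα.length = α.length) (hγ : eγ.length = γ.length) :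
    (numCircles (α ++ a :: γ) (eα ++ false :: eγ) =
        numCircles (α ++ a :: γ) (eα ++ true :: eγ) + 1 ∧
      ∀ r πα c πγ, shape πα = eα → shape πγ = eγ →
        IsClosedPath (α ++ a :: γ) r (πα ++ some c :: πγ) →
        c = finalRow α r πα (leftPos a.1) ∧ weight (α ++ a :: γ) r (πα ++ some c :: πγ) =
          rt c * weight (α ++ a :: γ) r (πα ++ none :: πγ)) ∨
    (numCircles (α ++ a :: γ) (eα ++ true :: eγ) =
        numCircles (α ++ a :: γ) (eα ++ false :: eγ) + 1 ∧
      ∀ r πα πγ, shape πα = eα → shape πγ = eγ →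
        IsClosedPath (α ++ a :: γ) r (πα ++ none :: πγ) →
        IsFlat a.1 (finalRow α r πα) ∧ weight (α ++ a :: γ) r (πα ++ none :: πγ) =
          rt (finalRow α r πα (leftPos a.1)) *
          weight (α ++ a :: γ) r (πα ++ some (finalRow α r πα (leftPos a.1)) :: πγ)) := by
  set β := α ++ a :: γ with hβ
  let l : Fin β.length := ⟨α.length, by simp [hβ]⟩
  obtain ⟨⟨hb, hb'⟩, hne⟩ := shapeRes_none_some (a := a) (γ := γ) (eγ := eγ) hα l rfl
  have hiff := circ_corner_eq_iff hb hb' hne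
  have hget : (β.get l).1 = a.1 := by simp [l, hβ]
  rw [numCircles_eq (by simp [hβ, hα, hγ]), numCircles_eq (by simp [hβ, hα, hγ])]
  -- If both corners lie on one circle of the braidlike resolution, the saddle to the other
  -- resolution is a split, and every colouring of the braidlike one is flat at the crossing.
  -- Otherwise it is a merge, and the colours above and below must agree.
  by_cases hA : circ β (shapeRes β (eα ++ false :: eγ)) (cornerA β l) =
      circ β (shapeRes β (eα ++ false :: eγ)) (cornerB β l)
  · right
    have hA' := hiff.1 hA
    have hne' : ∀ k, k ≠ l → shapeRes β (eα ++ true :: eγ) k = shapeRes β (eα ++ false :: eγ) k :=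
      fun k hk => (hne k hk).symm
    refine ⟨card_circles_merge hne' hA' hA, ?_⟩
    intro r πα πγ h1 h2 hcl
    have hl : πα.length = α.length := by rw [← hα, ← h1, shape_length]
    have hv : shapeRes β (shape (πα ++ none :: πγ)) = shapeRes β (eα ++ false :: eγ) := by
      rw [shape_append, h1, shape_cons, h2]; rfl
    obtain ⟨col, hcol⟩ := hcl.exists_col hv
    have hcA : col (circ β _ (cornerA β l)) = finalRow α r πα (leftPos a.1) := by
      rw [hcol, nodeColor, cornerA, hget]
      exact congrFun (rowAt_corner hl none) _
    have hcB : col (circ β _ (cornerB β l)) = finalRow α r πα (rightPos a.1) := by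
      rw [hcol, nodeColor, cornerB, hget]
      exact congrFun (rowAt_corner_none hl) _
    have hf : IsFlat a.1 (finalRow α r πα) := by
      unfold IsFlat; rw [← hcA, ← hcB, hA]
    refine ⟨hf, ?_⟩
    have hcl' := (isClosedPath_none_iff_some (γ := γ) (πγ := πγ) hl hf).2 hcl
    have hv' : shapeRes β (shape (πα ++ some (finalRow α r πα (leftPos a.1)) :: πγ)) =
        shapeRes β (eα ++ true :: eγ) := by
      rw [shape_append, h1, shape_cons, h2]; rfl
    have e1 := weight_eq_prod hcl hv col hcol
    have e2 := weight_eq_prod hcl' hv' (fun c => col (mergeMap hne' hA c)) (fun x => by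
      change col (circ β _ x) = _
      rw [hcol, nodeColor, nodeColor, rowAt_saddle hl hf])
    have e3 := prod_circles_merge hne' hA' hA (fun c => (rt (col c))⁻¹)
    rw [e1, e2, e3, hcA, mul_inv_cancel_left₀ (rt_ne_zero _)]
  · left
    have hA' : circ β (shapeRes β (eα ++ true :: eγ)) (cornerA β l) =
      circ β (shapeRes β (eα ++ true :: eγ)) (cornerB β l) := by
      by_contra h; exact hA (hiff.2 h)
    refine ⟨card_circles_merge hne hA hA', ?_⟩
    intro r πα c πγ h1 h2 hcl
    have hl : πα.length = α.length := by rw [← hα, ← h1, shape_length]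
    have hv : shapeRes β (shape (πα ++ some c :: πγ)) = shapeRes β (eα ++ true :: eγ) := by
      rw [shape_append, h1, shape_cons, h2]; rfl
    obtain ⟨col, hcol⟩ := hcl.exists_col hv
    have hcA : col (circ β _ (cornerA β l)) = finalRow α r πα (leftPos a.1) := by
      rw [hcol, nodeColor, cornerA, hget]
      exact congrFun (rowAt_corner hl _) _
    have hcB : col (circ β _ (cornerB β l)) = c := by
      rw [hcol, nodeColor, cornerB, hget]
      have := congrFun (rowAt_corner_some (a := a) (γ := γ) (r := r) (πγ := πγ) hl c) (rightPos a.1)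
      rwa [recolor_right] at this
    have hf : IsFlat a.1 (finalRow α r πα) := hcl.isFlat hl
    have hc : c = finalRow α r πα (leftPos a.1) := by rw [← hcB, ← hcA, hA']
    refine ⟨hc, ?_⟩
    have hcl' : IsClosedPath β r (πα ++ none :: πγ) :=
      (isClosedPath_none_iff_some (γ := γ) (πγ := πγ) hl hf).1 (by rw [← hc]; exact hcl)
    have hv' : shapeRes β (shape (πα ++ none :: πγ)) = shapeRes β (eα ++ false :: eγ) := by
      rw [shape_append, h1, shape_cons, h2]; rfl
    have e1 := weight_eq_prod hcl hv col hcol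
    have e2 := weight_eq_prod hcl' hv' (fun c => col (mergeMap hne hA' c)) (fun x => by
      change col (circ β _ x) = _
      rw [hcol, nodeColor, nodeColor, hc, rowAt_saddle hl hf])
    have e3 := prod_circles_merge hne hA hA' (fun c => (rt (col c))⁻¹)
    rw [e1, e2, e3, hcA, ← hc, mul_inv_cancel_left₀ (rt_ne_zero _)]

/-! The circles under local moves. -/

/-- The recursion removes letters from the front, so an identity between two suffixes persists
behind every common prefix. -/
theorem subCount_append {τ τ' : BraidWord n} {ρ ρ' : Path} {k : ℕ}
    (h : ∀ s s', subCount τ ρ s s' = k * subCount τ' ρ' s s') {α : BraidWord n} {πα : Path}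
    (hα : πα.length = α.length) (s s' : Row n) :
    subCount (α ++ τ) (πα ++ ρ) s s' = k * subCount (α ++ τ') (πα ++ ρ') s s' := by
  induction α generalizing πα s with
  | nil => simp at hα; subst hα; exact h s s'
  | cons a α ih =>
    rcases πα with _ | ⟨_ | c, πα⟩
    · simp at hα
    · exact ih (by simpa using hα) s
    · simp only [List.cons_append, subCount, ih (πα := πα) (by simpa using hα)]
      split_ifs <;> ring

theorem closedCount_append {τ τ' : BraidWord n} {ρ ρ' : Path} {k : ℕ}
    (h : ∀ s s', subCount τ ρ s s' = k * subCount τ' ρ' s s') {α : BraidWord n} {πα : Path}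
    (hα : πα.length = α.length) (r : Row n) :
    closedCount (α ++ τ) r (πα ++ ρ) = k * closedCount (α ++ τ') r (πα ++ ρ') := by
  unfold closedCount
  rw [Finset.mul_sum]
  refine Finset.sum_congr rfl fun s _ => ?_
  rw [subCount_append h hα]
  split_ifs <;> simp

theorem topPath_append (e e' : List Bool) : topPath (e ++ e') = topPath e ++ topPath e' := by
  simp [topPath]

@[simp] theorem topPath_length (e : List Bool) : (topPath e).length = e.length := by
  simp [topPath]

theorem topPath_false (e : List Bool) : topPath (false :: e) = none :: topPath e := rfl

theorem topPath_true (e : List Bool) : topPath (true :: e) = some true :: topPath e := rfl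

theorem numCircles_append {τ τ' : BraidWord n} {e e' : List Bool}
    (h : ∀ s s', subCount τ (topPath e) s s' = subCount τ' (topPath e') s s') {α : BraidWord n}
    {eα : List Bool} (hα : eα.length = α.length) :
    numCircles (α ++ τ) (eα ++ e) = numCircles (α ++ τ') (eα ++ e') := by
  unfold numCircles
  rw [topPath_append, topPath_append, closedCount_append (k := 1) (by simpa using h) (by simpa),
    one_mul]

/-- A weight depends on two counts, that below the given path and that below the path of its shape
with all colours `true`. Each needs its own local identity. -/
theorem weight_append {τ τ' : BraidWord n} {ρ ρ' : Path}
    (h : ∀ s s', subCount τ ρ s s' = subCount τ' ρ' s s')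
    (h' : ∀ s s', subCount τ (topPath (shape ρ)) s s' = subCount τ' (topPath (shape ρ')) s s')
    {α : BraidWord n} {πα : Path} (hα : πα.length = α.length) (r : Row n) :
    weight (α ++ τ) r (πα ++ ρ) = weight (α ++ τ') r (πα ++ ρ') := by
  unfold weight numTrue
  rw [closedCount_append (k := 1) (by simpa using h) hα, one_mul, shape_append, shape_append,
    numCircles_append h' (by simpa)]

theorem IsClosedPath.closedCount_ne_zero {β : BraidWord n} {r : Row n} {π : Path}
    (h : IsClosedPath β r π) : closedCount β r π ≠ 0 := by
  rw [closedCount_eq_two_pow h]; positivity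

theorem IsClosedPath.numTrue_le {β : BraidWord n} {r : Row n} {π : Path}
    (h : IsClosedPath β r π) : numTrue β r π ≤ numCircles β (shape π) := by
  rw [numTrue_eq h, numCircles_eq (by rw [shape_length, h.1.length_eq])]
  exact Finset.card_le_univ _

section
variable {α γ : BraidWord n} {a b : Fin (n - 1) × Bool}

theorem numCircles_none {eα eγ : List Bool} (hα : eα.length = α.length) :
    numCircles (α ++ a :: γ) (eα ++ false :: eγ) = numCircles (α ++ γ) (eα ++ eγ) :=
  numCircles_append (τ := a :: γ) (τ' := γ) (e := false :: eγ) (e' := eγ) (fun _ _ => rfl) hα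

theorem weight_none {r : Row n} {πα πγ : Path} (hα : πα.length = α.length) :
    weight (α ++ a :: γ) r (πα ++ none :: πγ) = weight (α ++ γ) r (πα ++ πγ) :=
  weight_append (τ := a :: γ) (τ' := γ) (ρ := none :: πγ) (ρ' := πγ) (fun _ _ => rfl)
    (fun _ _ => rfl) hα r

theorem isClosedPath_none {r : Row n} {πα πγ : Path} (hα : πα.length = α.length) :
    IsClosedPath (α ++ a :: γ) r (πα ++ none :: πγ) ↔ IsClosedPath (α ++ γ) r (πα ++ πγ) := by
  unfold IsClosedPath
  rw [valid_append hα, valid_append hα, finalRow_append hα, finalRow_append hα]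
  rfl

theorem subCount_swap (h : Far a.1 b.1) (c d : Bool) (πγ : Path) (s s' : Row n) :
    subCount (a :: b :: γ) (some c :: some d :: πγ) s s' =
      subCount (b :: a :: γ) (some d :: some c :: πγ) s s' := by
  simp only [subCount, IsFlat, recolor_far_left h, recolor_far_right h, recolor_far_left h.symm,
    recolor_far_right h.symm, recolor_comm h]
  split_ifs <;> ring

theorem numCircles_swap (h : Far a.1 b.1) {eα eγ : List Bool} (hα : eα.length = α.length) :
    numCircles (α ++ a :: b :: γ) (eα ++ true :: true :: eγ) =
      numCircles (α ++ b :: a :: γ) (eα ++ true :: true :: eγ) :=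
  numCircles_append (fun _ _ => subCount_swap h _ _ _ _ _) hα

theorem weight_swap (h : Far a.1 b.1) {c d : Bool} {r : Row n} {πα πγ : Path}
    (hα : πα.length = α.length) :
    weight (α ++ a :: b :: γ) r (πα ++ some c :: some d :: πγ) =
      weight (α ++ b :: a :: γ) r (πα ++ some d :: some c :: πγ) :=
  weight_append (fun _ _ => subCount_swap h _ _ _ _ _) (fun _ _ => subCount_swap h _ _ _ _ _) hα r

theorem isClosedPath_swap (h : Far a.1 b.1) {c d : Bool} {r : Row n} {πα πγ : Path}
    (hα : πα.length = α.length) :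
    IsClosedPath (α ++ a :: b :: γ) r (πα ++ some c :: some d :: πγ) ↔
      IsClosedPath (α ++ b :: a :: γ) r (πα ++ some d :: some c :: πγ) := by
  unfold IsClosedPath
  rw [valid_append hα, valid_append hα, finalRow_append hα, finalRow_append hα]
  simp only [Valid, finalRow, IsFlat, recolor_far_left h, recolor_far_right h,
    recolor_far_left h.symm, recolor_far_right h.symm, recolor_comm h]
  tauto

/-- Two consecutive turns in the same positions enclose a small circle. It has two admissible
colours if it is coloured `true` in the given path and one otherwise. -/
theorem subCount_pair (h : a.1 = b.1) (c d : Bool) (πγ : Path) (s s' : Row n) :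
    subCount (a :: b :: γ) (some c :: some d :: πγ) s s' =
      (if c then 2 else 1) * subCount (b :: γ) (some d :: πγ) s s' := by
  simp only [subCount, IsFlat, h, recolor_left, recolor_right, recolor_recolor, if_true]
  cases c <;> by_cases hs : s (leftPos b.1) = s (rightPos b.1) <;> simp [hs, two_mul]

theorem numCircles_pair (h : a.1 = b.1) {eα eγ : List Bool} (hα : eα.length = α.length)
    (hγ : eγ.length = γ.length) :
    numCircles (α ++ a :: b :: γ) (eα ++ true :: true :: eγ) =
      numCircles (α ++ b :: γ) (eα ++ true :: eγ) + 1 := by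
  have hcl : IsClosedPath (α ++ b :: γ) ⊤ (topPath (eα ++ true :: eγ)) :=
    isClosedPath_topPath (by simp [hα, hγ])
  have h0 := hcl.closedCount_ne_zero
  unfold numCircles
  rw [topPath_append, topPath_true] at h0 ⊢
  rw [topPath_append, topPath_true,
    closedCount_append (fun s s' => subCount_pair h _ _ _ s s') (by simpa), if_pos rfl, mul_comm,
    Nat.log_mul_base (by norm_num) h0]

theorem isClosedPath_pair (h : a.1 = b.1) {c d : Bool} {r : Row n} {πα πγ : Path}
    (hα : πα.length = α.length) :
    IsClosedPath (α ++ a :: b :: γ) r (πα ++ some c :: some d :: πγ) ↔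
      IsClosedPath (α ++ b :: γ) r (πα ++ some d :: πγ) := by
  unfold IsClosedPath
  rw [valid_append hα, valid_append hα, finalRow_append hα, finalRow_append hα]
  simp [Valid, finalRow, IsFlat, h]

theorem weight_pair (h : a.1 = b.1) {c d : Bool} {r : Row n} {πα πγ : Path}
    (hα : πα.length = α.length)
    (hcl : IsClosedPath (α ++ b :: γ) r (πα ++ some d :: πγ)) :
    weight (α ++ a :: b :: γ) r (πα ++ some c :: some d :: πγ) =
      (rt c)⁻¹ * weight (α ++ b :: γ) r (πα ++ some d :: πγ) := by
  have hγ : πγ.length = γ.length := by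
    have := hcl.1.length_eq
    simp [hα] at this
    exact this
  have h0 := hcl.closedCount_ne_zero
  have hle := hcl.numTrue_le
  have hN : numCircles (α ++ a :: b :: γ) (shape (πα ++ some c :: some d :: πγ)) =
      numCircles (α ++ b :: γ) (shape (πα ++ some d :: πγ)) + 1 := by
    simpa using numCircles_pair (γ := γ) (eγ := shape πγ) h (by simpa) (by simpa)
  have hT : numTrue (α ++ a :: b :: γ) r (πα ++ some c :: some d :: πγ) =
      numTrue (α ++ b :: γ) r (πα ++ some d :: πγ) + if c then 1 else 0 := by
    unfold numTrue
    rw [closedCount_append (fun s s' => subCount_pair h _ _ _ s s') hα]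
    cases c
    · simp
    · rw [if_pos rfl, mul_comm, Nat.log_mul_base (by norm_num) h0]; rfl
  unfold weight
  rw [hN, hT]
  cases c
  · rw [if_neg (by simp), add_zero, Nat.sub_add_comm hle, pow_succ]; ring
  · rw [if_pos rfl, Nat.add_sub_add_right, pow_succ]; ring

end

/-! Polynomials in the colours of the rows. -/

/-- A monomial in the signs of the colours of the nodes. -/
noncomputable def mon (q : List (ℕ × Fin n)) (ρ : ℕ → Row n) : ℂ :=
  (q.map fun x => sg (ρ x.1 x.2)).prod

/-- The polynomials in the signs of the colours, the degree of which is at most half of `z`. -/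
noncomputable def polySpace (n : ℕ) (z : ℝ) : Submodule ℂ ((ℕ → Row n) → ℂ) :=
  Submodule.span ℂ (mon '' {q | 2 * (q.length : ℝ) ≤ z})

theorem mon_mem_polySpace {q : List (ℕ × Fin n)} {z : ℝ} (h : 2 * (q.length : ℝ) ≤ z) :
    mon q ∈ polySpace n z := Submodule.subset_span ⟨q, h, rfl⟩

theorem polySpace_mono {z z' : ℝ} (h : z ≤ z') : polySpace n z ≤ polySpace n z' :=
  Submodule.span_mono (Set.image_mono fun _ hq => le_trans hq h)

theorem map_mem_polySpace {z z' : ℝ} (T : ((ℕ → Row n) → ℂ) →ₗ[ℂ] ((ℕ → Row n) → ℂ))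
    (hT : ∀ q : List (ℕ × Fin n), 2 * (q.length : ℝ) ≤ z → T (mon q) ∈ polySpace n z')
    {f : (ℕ → Row n) → ℂ} (hf : f ∈ polySpace n z) : T f ∈ polySpace n z' := by
  have : polySpace n z ≤ (polySpace n z').comap T := by
    refine Submodule.span_le.2 ?_
    rintro _ ⟨q, hq, rfl⟩
    exact hT q hq
  exact this hf

theorem sg_mul_mem_polySpace {z : ℝ} {f : (ℕ → Row n) → ℂ} (hf : f ∈ polySpace n z)
    (l : ℕ) (p : Fin n) : (fun ρ => sg (ρ l p) * f ρ) ∈ polySpace n (z + 2) := by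
  refine map_mem_polySpace (LinearMap.mulLeft ℂ fun ρ : ℕ → Row n => sg (ρ l p)) ?_ hf
  intro q hq
  have : LinearMap.mulLeft ℂ (fun ρ : ℕ → Row n => sg (ρ l p)) (mon q) = mon ((l, p) :: q) := by
    funext ρ; simp [mon]
  rw [this]
  exact mon_mem_polySpace (by push_cast [List.length_cons]; linarith)

/-- Substitution of colours for the colours of the nodes. -/
def substRows (θ : ℕ × Fin n → Option (ℕ × Fin n)) (c : Bool) (ρ : ℕ → Row n) : ℕ → Row n :=
  fun l p => (θ (l, p)).elim c fun x => ρ x.1 x.2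

theorem mon_substRows (θ : ℕ × Fin n → Option (ℕ × Fin n)) (q : List (ℕ × Fin n)) :
    ∃ k q', k + q'.length = q.length ∧
      ∀ c ρ, mon q (substRows θ c ρ) = sg c ^ k * mon q' ρ := by
  induction q with
  | nil => exact ⟨0, [], rfl, fun c ρ => by simp [mon]⟩
  | cons x q ih =>
    obtain ⟨k, q', hl, h⟩ := ih
    rcases hx : θ x with _ | y
    · refine ⟨k + 1, q', by simp; omega, fun c ρ => ?_⟩
      have := h c ρ
      simp only [mon, List.map_cons, List.prod_cons] at this ⊢
      rw [this, pow_succ]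
      simp only [substRows, hx, Option.elim_none]
      ring
    · refine ⟨k, y :: q', by simp; omega, fun c ρ => ?_⟩
      have := h c ρ
      simp only [mon, List.map_cons, List.prod_cons] at this ⊢
      rw [this]
      simp only [substRows, hx, Option.elim_some]
      ring

theorem reindex_mem_polySpace {z : ℝ} {f : (ℕ → Row n) → ℂ} (hf : f ∈ polySpace n z)
    (g : ℕ × Fin n → ℕ × Fin n) :
    (fun ρ => f fun l p => ρ (g (l, p)).1 (g (l, p)).2) ∈ polySpace n z := by
  refine map_mem_polySpace (LinearMap.funLeft ℂ ℂ
    fun (ρ : ℕ → Row n) l p => ρ (g (l, p)).1 (g (l, p)).2) ?_ hf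
  intro q hq
  have : LinearMap.funLeft ℂ ℂ (fun (ρ : ℕ → Row n) l p => ρ (g (l, p)).1 (g (l, p)).2) (mon q) =
      mon (q.map g) := by
    funext ρ; simp [mon, LinearMap.funLeft, Function.comp_def]
  rw [this]
  exact mon_mem_polySpace (by simpa)

/-- A monomial with `k` factors at the substituted places is multiplied by `(1 - (-1) ^ k) / 2`.
This is zero for `k = 0`; in all other cases at least one factor is lost, so the degree drops. -/
theorem average_mem_polySpace {z : ℝ} {f : (ℕ → Row n) → ℂ} (hf : f ∈ polySpace n z)
    (θ : ℕ × Fin n → Option (ℕ × Fin n)) :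
    (fun ρ => 2⁻¹ * (f (substRows θ true ρ) - f (substRows θ false ρ))) ∈
      polySpace n (z - 2) := by
  refine map_mem_polySpace ((2⁻¹ : ℂ) • (LinearMap.funLeft ℂ ℂ (substRows θ true) -
    LinearMap.funLeft ℂ ℂ (substRows θ false))) ?_ hf
  intro q hq
  obtain ⟨k, q', hl, h⟩ := mon_substRows θ q
  have e : ((2⁻¹ : ℂ) • (LinearMap.funLeft ℂ ℂ (substRows θ true) -
      LinearMap.funLeft ℂ ℂ (substRows θ false))) (mon q) =
      (2⁻¹ * (1 - (-1) ^ k) : ℂ) • mon q' := by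
    funext ρ
    simp only [LinearMap.smul_apply, LinearMap.sub_apply, Pi.smul_apply, Pi.sub_apply,
      LinearMap.funLeft_apply, h, smul_eq_mul]
    simp [sg]
    ring
  rw [e]
  rcases k with _ | k
  · simp
  · refine Submodule.smul_mem _ _ (mon_mem_polySpace ?_)
    have : ((k : ℝ) + 1) + q'.length = q.length := by exact_mod_cast hl
    have : (0 : ℝ) ≤ k := Nat.cast_nonneg k
    linarith

/-! Filtered functions on the paths of one shape. -/

/-- On the closed paths of shape `e`, the function has degree at least `-b`, where the degree is
normalized such that merge and split maps lower it by one. -/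
def FiltAt (β : BraidWord n) (e : List Bool) (b : ℝ) (Y : Row n → Path → ℂ) : Prop :=
  ∃ f ∈ polySpace n (numCircles β e + b), ∀ r π, shape π = e → IsClosedPath β r π →
    Y r π = weight β r π * f (rowAt β r π)

section

variable {β β' : BraidWord n} {e e' : List Bool} {b b' : ℝ} {Y Z : Row n → Path → ℂ}

theorem FiltAt.congr (h : FiltAt β e b Y)
    (hZ : ∀ r π, shape π = e → IsClosedPath β r π → Z r π = Y r π) : FiltAt β e b Z := by
  obtain ⟨f, hf, h⟩ := h
  exact ⟨f, hf, fun r π h1 h2 => (hZ r π h1 h2).trans (h r π h1 h2)⟩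

theorem FiltAt.mono (h : FiltAt β e b Y) (hb : b ≤ b') : FiltAt β e b' Y := by
  obtain ⟨f, hf, h⟩ := h
  exact ⟨f, polySpace_mono (by linarith) hf, h⟩

theorem filtAt_zero (β : BraidWord n) (e : List Bool) (b : ℝ) : FiltAt β e b fun _ _ => 0 :=
  ⟨0, Submodule.zero_mem _, by simp⟩

theorem FiltAt.add (h : FiltAt β e b Y) (h' : FiltAt β e b Z) :
    FiltAt β e b fun r π => Y r π + Z r π := by
  obtain ⟨f, hf, h⟩ := h
  obtain ⟨g, hg, h'⟩ := h'
  exact ⟨f + g, Submodule.add_mem _ hf hg, fun r π h1 h2 => by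
    simp only [h r π h1 h2, h' r π h1 h2, Pi.add_apply]; ring⟩

theorem FiltAt.mul (h : FiltAt β e b Y) (k : ℂ) : FiltAt β e b fun r π => k * Y r π := by
  obtain ⟨f, hf, h⟩ := h
  exact ⟨k • f, Submodule.smul_mem _ _ hf, fun r π h1 h2 => by
    simp only [h r π h1 h2, Pi.smul_apply, smul_eq_mul]; ring⟩

theorem FiltAt.sub (h : FiltAt β e b Y) (h' : FiltAt β e b Z) :
    FiltAt β e b fun r π => Y r π - Z r π :=
  (h.add (h'.mul (-1))).congr fun r π _ _ => by ring

/-- The polynomial is the same up to renaming its variables, so the degree only changes by the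
difference of the numbers of circles. -/
theorem FiltAt.reindex (h : FiltAt β e b Y) (g : ℕ × Fin n → ℕ × Fin n)
    (hN : numCircles β e + b = numCircles β' e' + b')
    (hZ : ∀ r π', shape π' = e' → IsClosedPath β' r π' → ∃ π, shape π = e ∧ IsClosedPath β r π ∧
      (∀ l p, rowAt β r π l p = rowAt β' r π' (g (l, p)).1 (g (l, p)).2) ∧
      Z r π' * weight β r π = weight β' r π' * Y r π) : FiltAt β' e' b' Z := by
  obtain ⟨f, hf, h⟩ := h
  refine ⟨_, hN ▸ reindex_mem_polySpace hf g, fun r π' h1 h2 => ?_⟩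
  obtain ⟨π, h3, h4, h5, h6⟩ := hZ r π' h1 h2
  rw [h r π h3 h4, ← mul_assoc, mul_right_comm] at h6
  have := mul_right_cancel₀ (weight_ne_zero β r π) h6
  rw [this]
  congr 2
  funext l p
  exact h5 l p

theorem shape_eq_append {π : Path} {e e' : List Bool} (h : shape π = e ++ e') :
    ∃ ρ ρ', π = ρ ++ ρ' ∧ shape ρ = e ∧ shape ρ' = e' := List.map_eq_append_iff.1 h

theorem shape_eq_false {π : Path} {e : List Bool} (h : shape π = false :: e) :
    ∃ ρ, π = none :: ρ ∧ shape ρ = e := by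
  rcases π with _ | ⟨_ | c, π⟩
  · simp at h
  · exact ⟨π, rfl, by simpa using h⟩
  · simp at h

theorem shape_eq_true {π : Path} {e : List Bool} (h : shape π = true :: e) :
    ∃ c ρ, π = some c :: ρ ∧ shape ρ = e := by
  rcases π with _ | ⟨_ | c, π⟩
  · simp at h
  · simp at h
  · exact ⟨c, π, rfl, by simpa using h⟩

/-- The length of the prefix determines where a path has to be cut, so a formula in the two pieces
defines a function of the path. -/
theorem exists_localized {α : BraidWord n} (G : Row n → Path → Path → ℂ) :
    ∃ Z : Row n → Path → ℂ, ∀ r πα πγ, πα.length = α.length → Z r (πα ++ πγ) = G r πα πγ :=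
  ⟨fun r π => G r (π.take α.length) (π.drop α.length), fun r πα πγ h => by
    simp only [List.take_left' h, List.drop_left' h]⟩

/-! ### Elementary local moves and their degrees. -/

section
variable {α γ : BraidWord n} {a a' : Fin (n - 1) × Bool} {eα eγ : List Bool}

theorem rowAt_none_eq {r : Row n} {πα πγ : Path} (hα : πα.length = α.length) (l : ℕ) :
    rowAt (α ++ γ) r (πα ++ πγ) l =
      rowAt (α ++ a :: γ) r (πα ++ none :: πγ) (if l ≤ α.length then l else l + 1) ∧
    rowAt (α ++ a :: γ) r (πα ++ none :: πγ) l =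
      rowAt (α ++ γ) r (πα ++ πγ) (if l ≤ α.length then l else l - 1) := by
  split_ifs with hl
  · rw [rowAt_append_left hα hl, rowAt_append_left hα hl]; exact ⟨rfl, rfl⟩
  · obtain ⟨m, rfl⟩ := Nat.exists_eq_add_of_lt (not_le.1 hl)
    constructor
    · rw [add_assoc, add_assoc, rowAt_append_right hα, rowAt_append_right hα]
      rfl
    · rw [add_assoc, rowAt_append_right hα, ← add_assoc, Nat.add_sub_cancel, rowAt_append_right hα]
      rfl

/-- A braidlike crossing is invisible to the circles; deleting it only renumbers the levels above.
-/
theorem FiltAt.dropNone (hα : eα.length = α.length)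
    (h : FiltAt (α ++ a :: γ) (eα ++ false :: eγ) b Y) :
    ∃ Z, FiltAt (α ++ γ) (eα ++ eγ) b Z ∧
      ∀ r πα πγ, πα.length = α.length → Z r (πα ++ πγ) = Y r (πα ++ none :: πγ) := by
  obtain ⟨Z, hZ⟩ := exists_localized (α := α) fun r πα πγ => Y r (πα ++ none :: πγ)
  refine ⟨Z, h.reindex (fun x => (if x.1 ≤ α.length then x.1 else x.1 - 1, x.2)) ?_ ?_, hZ⟩
  · rw [numCircles_none hα]
  · intro r π' h1 h2
    obtain ⟨πα, πγ, rfl, h3, k1⟩ := shape_eq_append h1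
    have hl : πα.length = α.length := by rw [← hα, ← h3, shape_length]
    refine ⟨πα ++ none :: πγ, by simp [h3, k1], (isClosedPath_none hl).2 h2, fun l p => ?_, ?_⟩
    · exact congrFun (rowAt_none_eq hl l).2 p
    · rw [hZ _ _ _ hl, weight_none hl, mul_comm]

theorem FiltAt.addNone (hα : eα.length = α.length) (a : Fin (n - 1) × Bool)
    (h : FiltAt (α ++ γ) (eα ++ eγ) b Y) :
    ∃ Z, FiltAt (α ++ a :: γ) (eα ++ false :: eγ) b Z ∧
      ∀ r πα πγ, πα.length = α.length → Z r (πα ++ none :: πγ) = Y r (πα ++ πγ) := by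
  obtain ⟨Z, hZ⟩ := exists_localized (α := α) fun r πα πγ => Y r (πα ++ πγ.tail)
  refine ⟨Z, h.reindex (fun x => (if x.1 ≤ α.length then x.1 else x.1 + 1, x.2)) ?_ ?_,
    fun r πα πγ hl => hZ _ _ _ hl⟩
  · rw [numCircles_none hα]
  · intro r π' h1 h2
    obtain ⟨πα, πγ', rfl, h3, k1⟩ := shape_eq_append h1
    obtain ⟨πγ, rfl, k2⟩ := shape_eq_false k1
    have hl : πα.length = α.length := by rw [← hα, ← h3, shape_length]
    refine ⟨πα ++ πγ, by simp [h3, k2], (isClosedPath_none hl).1 h2, fun l p => ?_, ?_⟩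
    · exact congrFun (rowAt_none_eq hl l).1 p
    · rw [hZ _ _ _ hl, weight_none hl, mul_comm]; rfl

theorem FiltAt.swapSome (hα : eα.length = α.length) (hf : Far a.1 a'.1)
    (h : FiltAt (α ++ a :: a' :: γ) (eα ++ true :: true :: eγ) b Y) :
    ∃ Z, FiltAt (α ++ a' :: a :: γ) (eα ++ true :: true :: eγ) b Z ∧
      ∀ r πα c d πγ, πα.length = α.length →
        Z r (πα ++ some d :: some c :: πγ) = Y r (πα ++ some c :: some d :: πγ) := by
  obtain ⟨Z, hZ⟩ := exists_localized (α := α) fun r πα πγ =>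
    Y r (πα ++ πγ.tail.headD none :: πγ.headD none :: πγ.tail.tail)
  -- Only the level between the two crossings changes its row. Its colours in the positions of `a`
  -- occur above both crossings of the new word, and its other colours below both.
  refine ⟨Z, h.reindex (fun x => (if x.1 = α.length + 1 then
    if x.2 = leftPos a.1 ∨ x.2 = rightPos a.1 then α.length + 2 else α.length else x.1, x.2)) ?_ ?_,
    fun r πα c d πγ hl => hZ _ _ _ hl⟩
  · rw [numCircles_swap hf hα]
  · intro r π' h1 h2
    obtain ⟨πα, πγ', rfl, h3, k1⟩ := shape_eq_append h1
    obtain ⟨d, πγ', rfl, k2⟩ := shape_eq_true k1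
    obtain ⟨c, πγ, rfl, k3⟩ := shape_eq_true k2
    have hl : πα.length = α.length := by rw [← hα, ← h3, shape_length]
    refine ⟨πα ++ some c :: some d :: πγ, by simp [h3, k3], (isClosedPath_swap hf hl).2 h2,
      fun l p => ?_, ?_⟩
    · dsimp only
      rcases le_or_gt l α.length with hle | hlt
      · rw [if_neg (by omega), rowAt_append_left hl hle, rowAt_append_left hl hle]
      · obtain ⟨m, rfl⟩ := Nat.exists_eq_add_of_lt hlt
        rw [add_assoc]
        rcases m with _ | m
        · rw [if_pos rfl, rowAt_append_right hl]
          simp only [rowAt]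
          split_ifs with hp
          · rw [rowAt_append_right hl]
            simp only [rowAt, rowAt_zero, recolor, if_pos hp]
          · have := rowAt_append_right (r := r) (γ := a' :: a :: γ)
              (πγ := some d :: some c :: πγ) hl 0
            rw [add_zero] at this
            rw [this]
            simp only [rowAt, recolor, if_neg hp]
        · rw [if_neg (by omega), rowAt_append_right hl, rowAt_append_right hl]
          simp only [rowAt, recolor_comm hf]
    · rw [hZ _ _ _ hl, ← weight_swap hf hl, mul_comm]; rfl

/-- This is the birth of a small circle marked `v₊`: the polynomial does not involve the new colour,
and one more circle raises the degree by one. -/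
theorem FiltAt.addSome (hα : eα.length = α.length) (hγ : eγ.length = γ.length) (ha : a.1 = a'.1)
    (h : FiltAt (α ++ a' :: γ) (eα ++ true :: eγ) b Y) :
    ∃ Z, FiltAt (α ++ a :: a' :: γ) (eα ++ true :: true :: eγ) (b - 1) Z ∧
      ∀ r πα c d πγ, πα.length = α.length →
        Z r (πα ++ some c :: some d :: πγ) = (rt c)⁻¹ * Y r (πα ++ some d :: πγ) := by
  obtain ⟨Z, hZ⟩ := exists_localized (α := α) fun r πα πγ =>
    (rt ((πγ.headD none).getD true))⁻¹ * Y r (πα ++ πγ.tail)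
  refine ⟨Z, h.reindex (fun x => (if x.1 ≤ α.length then x.1 else x.1 + 1, x.2)) ?_ ?_,
    fun r πα c d πγ hl => hZ _ _ _ hl⟩
  · rw [numCircles_pair ha hα hγ]; push_cast; ring
  · intro r π' h1 h2
    obtain ⟨πα, πγ', rfl, h3, k1⟩ := shape_eq_append h1
    obtain ⟨c, πγ', rfl, k2⟩ := shape_eq_true k1
    obtain ⟨d, πγ, rfl, k3⟩ := shape_eq_true k2
    have hl : πα.length = α.length := by rw [← hα, ← h3, shape_length]
    have hcl := (isClosedPath_pair ha hl).1 h2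
    refine ⟨πα ++ some d :: πγ, by simp [h3, k3], hcl, fun l p => ?_, ?_⟩
    · dsimp only
      split_ifs with hle
      · rw [rowAt_append_left hl hle, rowAt_append_left hl hle]
      · obtain ⟨m, rfl⟩ := Nat.exists_eq_add_of_lt (not_le.1 hle)
        rw [add_assoc, add_assoc, rowAt_append_right hl, rowAt_append_right hl]
        simp only [rowAt, ha, recolor_recolor]
    · rw [hZ _ _ _ hl, weight_pair ha hl hcl]
      simp only [List.headD_cons, Option.getD_some, List.tail_cons]
      ring

/-- This is the death of a small circle by the counit. One circle is lost, but averaging lowers the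
polynomial degree by one, which counts twice. -/
theorem FiltAt.sumSome (hα : eα.length = α.length) (hγ : eγ.length = γ.length) (ha : a.1 = a'.1)
    (h : FiltAt (α ++ a :: a' :: γ) (eα ++ true :: true :: eγ) b Y) :
    ∃ Z, FiltAt (α ++ a' :: γ) (eα ++ true :: eγ) (b - 1) Z ∧
      ∀ r πα d πγ, πα.length = α.length → Z r (πα ++ some d :: πγ) =
        circleSum fun c => Y r (πα ++ some c :: some d :: πγ) := by
  obtain ⟨Z, hZ⟩ := exists_localized (α := α) fun r πα πγ =>
    circleSum fun c => Y r (πα ++ some c :: πγ)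
  obtain ⟨f, hf, h⟩ := h
  -- The level `α.length + 1` runs through the small circle, the colour of which is the variable `c`
  -- (`none`). Its other positions keep the colours below, and the higher levels move down by one.
  let θ : ℕ × Fin n → Option (ℕ × Fin n) := fun x =>
    if x.1 ≤ α.length then some x else if x.1 = α.length + 1 then
      if x.2 = leftPos a.1 ∨ x.2 = rightPos a.1 then none else some (α.length, x.2)
    else some (x.1 - 1, x.2)
  refine ⟨Z, ⟨_, polySpace_mono ?_ (average_mem_polySpace hf θ), ?_⟩,
    fun r πα d πγ hl => hZ _ _ _ hl⟩
  · rw [numCircles_pair ha hα hγ]; push_cast; linarith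
  · intro r π' h1 h2
    obtain ⟨πα, πγ', rfl, h3, k1⟩ := shape_eq_append h1
    obtain ⟨d, πγ, rfl, k2⟩ := shape_eq_true k1
    have hl : πα.length = α.length := by rw [← hα, ← h3, shape_length]
    rw [hZ _ _ _ hl]
    have key : ∀ c, Y r (πα ++ some c :: some d :: πγ) =
        (rt c)⁻¹ * (weight (α ++ a' :: γ) r (πα ++ some d :: πγ) *
          f (substRows θ c (rowAt (α ++ a' :: γ) r (πα ++ some d :: πγ)))) := by
      intro c
      rw [h r _ (by simp [h3, k2]) ((isClosedPath_pair ha hl).2 h2), weight_pair ha hl h2,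
        mul_assoc]
      congr 3
      funext l p
      simp only [substRows, θ]
      split_ifs with hle h1 hp
      · rw [Option.elim_some, rowAt_append_left hl hle, rowAt_append_left hl hle]
      · subst h1
        rw [Option.elim_none, rowAt_append_right hl]
        simp only [rowAt, recolor, if_pos hp]
      · subst h1
        rw [Option.elim_some, rowAt_append_right hl]
        have := rowAt_append_right (r := r) (γ := a' :: γ) (πγ := some d :: πγ) hl 0
        rw [add_zero] at this
        rw [this]
        simp only [rowAt, recolor, if_neg hp]
      · obtain ⟨m, rfl⟩ := Nat.exists_eq_add_of_lt (not_le.1 hle)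
        rw [Option.elim_some]
        rcases m with _ | m
        · omega
        · rw [add_assoc, add_assoc, rowAt_append_right hl, ← add_assoc, ← add_assoc,
            Nat.add_sub_cancel, add_assoc, rowAt_append_right hl]
          simp only [rowAt, ha, recolor_recolor]
    simp only [circleSum, key]
    rw [mul_inv_cancel_left₀ (rt_ne_zero _), mul_inv_cancel_left₀ (rt_ne_zero _)]
    ring

theorem rowAt_saddle_eq {r : Row n} {πα πγ : Path} (hα : πα.length = α.length)
    (hf : IsFlat a.1 (finalRow α r πα)) :
    rowAt (α ++ a :: γ) r (πα ++ some (finalRow α r πα (leftPos a.1)) :: πγ) =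
      rowAt (α ++ a :: γ) r (πα ++ none :: πγ) :=
  funext fun l => rowAt_saddle hα hf l

/-- The left side is the coproduct `v₊ ⊗ v₋ + v₋ ⊗ v₊` of the unit, evaluated at the colours `c` and
`d`. -/
theorem sg_add_sg (c d : Bool) : sg c + sg d = if c = d then rt c * rt c else 0 := by
  rw [rt_mul_self]
  cases c <;> cases d <;> simp [sg] <;> norm_num

/-- In a split the polynomial is multiplied by the sum of the two signs at the crossing, which also
vanishes on the colourings that are not flat there. In a merge it stays the same. Together with the
change of the number of circles both cases cost one. -/
theorem FiltAt.saddleNone (hα : eα.length = α.length) (hγ : eγ.length = γ.length)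
    (h : FiltAt (α ++ a :: γ) (eα ++ true :: eγ) b Y) :
    ∃ Z, FiltAt (α ++ a :: γ) (eα ++ false :: eγ) (b + 1) Z ∧
      ∀ r πα πγ, πα.length = α.length → Z r (πα ++ none :: πγ) =
        if IsFlat a.1 (finalRow α r πα) then rt (finalRow α r πα (leftPos a.1)) *
          Y r (πα ++ some (finalRow α r πα (leftPos a.1)) :: πγ) else 0 := by
  obtain ⟨Z, hZ⟩ := exists_localized (α := α) fun r πα πγ =>
    if IsFlat a.1 (finalRow α r πα) then rt (finalRow α r πα (leftPos a.1)) *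
          Y r (πα ++ some (finalRow α r πα (leftPos a.1)) :: πγ.tail) else 0
  obtain ⟨f, hf, h⟩ := h
  rcases saddle_dichotomy α γ a hα hγ with ⟨hN, hw⟩ | ⟨hN, hw⟩
  · refine ⟨Z, ⟨_, polySpace_mono ?_ (Submodule.add_mem _
      (sg_mul_mem_polySpace hf α.length (leftPos a.1))
      (sg_mul_mem_polySpace hf α.length (rightPos a.1))), ?_⟩, fun r πα πγ hl => hZ _ _ _ hl⟩
    · rw [hN]; push_cast; linarith
    · intro r π' h1 h2
      obtain ⟨πα, πγ', rfl, h3, k1⟩ := shape_eq_append h1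
      obtain ⟨πγ, rfl, k2⟩ := shape_eq_false k1
      have hl : πα.length = α.length := by rw [← hα, ← h3, shape_length]
      rw [hZ _ _ _ hl, Pi.add_apply, ← add_mul, sg_add_sg, rowAt_corner hl, List.tail_cons]
      by_cases hf : IsFlat a.1 (finalRow α r πα)
      · have hcl := (isClosedPath_none_iff_some hl hf).2 h2
        rw [if_pos hf, if_pos (show _ = _ from hf), h r _ (by simp [h3, k2]) hcl,
          (hw _ _ _ _ h3 k2 hcl).2, rowAt_saddle_eq hl hf]
        ring
      · rw [if_neg hf, if_neg (show ¬ _ = _ from hf), zero_mul, mul_zero]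
  · refine ⟨Z, ⟨f, polySpace_mono ?_ hf, ?_⟩, fun r πα πγ hl => hZ _ _ _ hl⟩
    · rw [hN]; push_cast; linarith
    · intro r π' h1 h2
      obtain ⟨πα, πγ', rfl, h3, k1⟩ := shape_eq_append h1
      obtain ⟨πγ, rfl, k2⟩ := shape_eq_false k1
      have hl : πα.length = α.length := by rw [← hα, ← h3, shape_length]
      obtain ⟨hf, hw⟩ := hw _ _ _ h3 k2 h2
      have hcl := (isClosedPath_none_iff_some hl hf).2 h2
      rw [hZ _ _ _ hl, List.tail_cons, if_pos hf, h r _ (by simp [h3, k2]) hcl, hw,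
        rowAt_saddle_eq hl hf]
      ring

theorem FiltAt.saddleSome (hα : eα.length = α.length) (hγ : eγ.length = γ.length)
    (h : FiltAt (α ++ a :: γ) (eα ++ false :: eγ) b Y) :
    ∃ Z, FiltAt (α ++ a :: γ) (eα ++ true :: eγ) (b + 1) Z ∧
      ∀ r πα c πγ, πα.length = α.length → Z r (πα ++ some c :: πγ) =
        if c = finalRow α r πα (leftPos a.1) then rt c * Y r (πα ++ none :: πγ) else 0 := by
  obtain ⟨Z, hZ⟩ := exists_localized (α := α) fun r πα πγ =>
    if (πγ.headD none).getD true = finalRow α r πα (leftPos a.1) then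
      rt ((πγ.headD none).getD true) * Y r (πα ++ none :: πγ.tail) else 0
  have hZ' : ∀ r πα c πγ, πα.length = α.length → Z r (πα ++ some c :: πγ) =
      if c = finalRow α r πα (leftPos a.1) then rt c * Y r (πα ++ none :: πγ) else 0 :=
    fun r πα c πγ hl => hZ _ _ _ hl
  obtain ⟨f, hf, h⟩ := h
  rcases saddle_dichotomy α γ a hα hγ with ⟨hN, hw⟩ | ⟨hN, hw⟩
  · refine ⟨Z, ⟨f, polySpace_mono ?_ hf, ?_⟩, hZ'⟩
    · rw [hN]; push_cast; linarith
    · intro r π' h1 h2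
      obtain ⟨πα, πγ', rfl, h3, k1⟩ := shape_eq_append h1
      obtain ⟨c, πγ, rfl, k2⟩ := shape_eq_true k1
      have hl : πα.length = α.length := by rw [← hα, ← h3, shape_length]
      obtain ⟨hc, hw⟩ := hw _ _ _ _ h3 k2 h2
      have hf := h2.isFlat hl
      rw [hZ' _ _ _ _ hl, if_pos hc, hw]
      rw [hc] at h2 ⊢
      rw [h r _ (by simp [h3, k2]) ((isClosedPath_none_iff_some hl hf).1 h2), rowAt_saddle_eq hl hf]
      ring
  -- Here the lower and the upper arc lie on different circles, so the second sign is read one level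
  -- higher.
  · refine ⟨Z, ⟨_, polySpace_mono ?_ (Submodule.add_mem _
      (sg_mul_mem_polySpace hf α.length (leftPos a.1))
      (sg_mul_mem_polySpace hf (α.length + 1) (rightPos a.1))), ?_⟩, hZ'⟩
    · rw [hN]; push_cast; linarith
    · intro r π' h1 h2
      obtain ⟨πα, πγ', rfl, h3, k1⟩ := shape_eq_append h1
      obtain ⟨c, πγ, rfl, k2⟩ := shape_eq_true k1
      have hl : πα.length = α.length := by rw [← hα, ← h3, shape_length]
      have hf := h2.isFlat hl
      rw [hZ' _ _ _ _ hl, Pi.add_apply, ← add_mul, sg_add_sg, rowAt_corner hl,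
        rowAt_corner_some hl, recolor_right]
      by_cases hc : c = finalRow α r πα (leftPos a.1)
      · subst hc
        have hcl := (isClosedPath_none_iff_some hl hf).1 h2
        rw [if_pos rfl, if_pos rfl, h r _ (by simp [h3, k2]) hcl, (hw _ _ _ h3 k2 hcl).2,
          rowAt_saddle_eq hl hf]
        ring
      · rw [if_neg hc, if_neg (Ne.symm hc), zero_mul, mul_zero]

end

end

/-! ### The elementary moves behind one or two further crossings. -/

section
variable {α γ : BraidWord n} {a x y : Fin (n - 1) × Bool} {eα eγ : List Bool} {ex ey : Bool}
  {b : ℝ} {Y Z : Row n → Path → ℂ}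

theorem FiltAt.dropNone₂ (hα : eα.length = α.length)
    (h : FiltAt (α ++ x :: a :: γ) (eα ++ ex :: false :: eγ) b Y) :
    ∃ Z, FiltAt (α ++ x :: γ) (eα ++ ex :: eγ) b Z ∧ ∀ r πα o πγ, πα.length = α.length →
      Z r (πα ++ o :: πγ) = Y r (πα ++ o :: none :: πγ) := by
  obtain ⟨Z, h1, h2⟩ := FiltAt.dropNone (α := α ++ [x]) (eα := eα ++ [ex]) (γ := γ) (eγ := eγ)
    (a := a) (by simp [hα]) (by simpa using h)
  exact ⟨Z, by simpa using h1,
    fun r πα o πγ hl => by simpa using h2 r (πα ++ [o]) πγ (by simp [hl])⟩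

theorem FiltAt.addNone₂ (hα : eα.length = α.length) (a : Fin (n - 1) × Bool)
    (h : FiltAt (α ++ x :: γ) (eα ++ ex :: eγ) b Y) :
    ∃ Z, FiltAt (α ++ x :: a :: γ) (eα ++ ex :: false :: eγ) b Z ∧
      ∀ r πα o πγ, πα.length = α.length →
        Z r (πα ++ o :: none :: πγ) = Y r (πα ++ o :: πγ) := by
  obtain ⟨Z, h1, h2⟩ := FiltAt.addNone (α := α ++ [x]) (eα := eα ++ [ex]) (γ := γ) (eγ := eγ)
    (by simp [hα]) a (by simpa using h)
  exact ⟨Z, by simpa using h1,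
    fun r πα o πγ hl => by simpa using h2 r (πα ++ [o]) πγ (by simp [hl])⟩

theorem FiltAt.dropNone₃ (hα : eα.length = α.length)
    (h : FiltAt (α ++ x :: y :: a :: γ) (eα ++ ex :: ey :: false :: eγ) b Y) :
    ∃ Z, FiltAt (α ++ x :: y :: γ) (eα ++ ex :: ey :: eγ) b Z ∧
      ∀ r πα o o' πγ, πα.length = α.length →
        Z r (πα ++ o :: o' :: πγ) = Y r (πα ++ o :: o' :: none :: πγ) := by
  obtain ⟨Z, h1, h2⟩ := FiltAt.dropNone₂ (α := α ++ [x]) (eα := eα ++ [ex]) (γ := γ) (eγ := eγ)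
    (x := y) (ex := ey) (a := a) (by simp [hα]) (by simpa using h)
  exact ⟨Z, by simpa using h1,
    fun r πα o o' πγ hl => by simpa using h2 r (πα ++ [o]) o' πγ (by simp [hl])⟩

theorem FiltAt.addNone₃ (hα : eα.length = α.length) (a : Fin (n - 1) × Bool)
    (h : FiltAt (α ++ x :: y :: γ) (eα ++ ex :: ey :: eγ) b Y) :
    ∃ Z, FiltAt (α ++ x :: y :: a :: γ) (eα ++ ex :: ey :: false :: eγ) b Z ∧
      ∀ r πα o o' πγ, πα.length = α.length →
        Z r (πα ++ o :: o' :: none :: πγ) = Y r (πα ++ o :: o' :: πγ) := by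
  obtain ⟨Z, h1, h2⟩ := FiltAt.addNone₂ (α := α ++ [x]) (eα := eα ++ [ex]) (γ := γ) (eγ := eγ)
    (x := y) (ex := ey) (by simp [hα]) a (by simpa using h)
  exact ⟨Z, by simpa using h1,
    fun r πα o o' πγ hl => by simpa using h2 r (πα ++ [o]) o' πγ (by simp [hl])⟩

theorem FiltAt.saddleNone₂ (hα : eα.length = α.length) (hγ : eγ.length = γ.length)
    (h : FiltAt (α ++ x :: a :: γ) (eα ++ true :: true :: eγ) b Y) :
    ∃ Z, FiltAt (α ++ x :: a :: γ) (eα ++ true :: false :: eγ) (b + 1) Z ∧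
      ∀ r πα c πγ, πα.length = α.length → Z r (πα ++ some c :: none :: πγ) =
        if IsFlat a.1 (recolor x.1 c (finalRow α r πα)) then
          rt (recolor x.1 c (finalRow α r πα) (leftPos a.1)) *
          Y r (πα ++ some c :: some (recolor x.1 c (finalRow α r πα) (leftPos a.1)) :: πγ)
        else 0 := by
  obtain ⟨Z, h1, h2⟩ := FiltAt.saddleNone (α := α ++ [x]) (eα := eα ++ [true]) (γ := γ) (eγ := eγ)
    (a := a) (by simp [hα]) hγ (by simpa using h)
  refine ⟨Z, by simpa using h1, fun r πα c πγ hl => ?_⟩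
  have := h2 r (πα ++ [some c]) πγ (by simp [hl])
  rw [finalRow_append hl] at this
  simpa [finalRow] using this

end

/-! Filtered local operators. -/

/-- The shift of the quantum grading of a crossing with a given resolution. -/
noncomputable def letterShift (s x : Bool) : ℝ := (if s then 1 else -1) * if x then 2 else 1

/-- The shift of the quantum grading of a resolution. -/
noncomputable def shift : BraidWord n → List Bool → ℝ
  | a :: β, x :: e => letterShift a.2 x + shift β e
  | [], _ => 0
  | _ :: _, [] => 0

theorem shift_append {α γ : BraidWord n} {eα eγ : List Bool} (hα : eα.length = α.length) :
    shift (α ++ γ) (eα ++ eγ) = shift α eα + shift γ eγ := by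
  induction α generalizing eα with
  | nil => simp at hα; subst hα; simp [shift]
  | cons a α ih =>
    rcases eα with _ | ⟨x, eα⟩
    · simp at hα
    · simp only [List.cons_append, shift, ih (eα := eα) (by simpa using hα), add_assoc]

/-- The function has quantum grading at least `b`. -/
def Filt (β : BraidWord n) (b : ℝ) (Y : Row n → Path → ℂ) : Prop :=
  ∀ e : List Bool, e.length = β.length → FiltAt β e (shift β e - b) Y

theorem exists_append_of_length {α γ : BraidWord n} {e : List Bool}
    (h : e.length = (α ++ γ).length) :
    ∃ eα eγ, e = eα ++ eγ ∧ eα.length = α.length ∧ eγ.length = γ.length := by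
  rw [List.length_append] at h
  exact ⟨e.take α.length, e.drop α.length, (List.take_append_drop _ _).symm,
    by rw [List.length_take]; omega, by rw [List.length_drop]; omega⟩

theorem exists_cons_of_length {a : Fin (n - 1) × Bool} {γ : BraidWord n} {e : List Bool}
    (h : e.length = (a :: γ).length) : ∃ x eγ, e = x :: eγ ∧ eγ.length = γ.length := by
  rcases e with _ | ⟨x, e⟩
  · simp at h
  · exact ⟨x, e, rfl, by simpa using h⟩

theorem prefixSign_topPath (η : ℂ) (α : BraidWord n) (πα : Path) :
    prefixSign η α πα = prefixSign η α (topPath (shape πα)) := by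
  induction α generalizing πα with
  | nil => simp [prefixSign]
  | cons a α ih =>
    rcases πα with _ | ⟨_ | c, πα⟩
    · rfl
    · simp [prefixSign, topPath_false, ← ih]
    · simp [prefixSign, topPath_true, ← ih]

/-- The sign of the prefix depends on the shape only, so on each resolution it is a scalar. -/
theorem FiltAt.extend {α τ : BraidWord n} {eα e : List Bool} {b : ℝ} {Y Z : Row n → Path → ℂ}
    {F : LocalOp n} (η : ℂ) (hα : eα.length = α.length) (h : FiltAt (α ++ τ) (eα ++ e) b Z)
    (hZ : ∀ r πα ρ, πα.length = α.length → shape ρ = e →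
      Z r (πα ++ ρ) = F (finalRow α r πα) (fun ρ => Y r (πα ++ ρ)) ρ) :
    FiltAt (α ++ τ) (eα ++ e) b fun r π => extend η α F r (Y r) π := by
  refine (h.mul (prefixSign η α (topPath eα))).congr fun r π h1 _ => ?_
  obtain ⟨πα, ρ, rfl, rfl, h3⟩ := shape_eq_append h1
  have hl : πα.length = α.length := by rw [← hα, shape_length]
  rw [extend_append η α F r (Y r) πα ρ hl, hZ _ _ _ hl h3, prefixSign_topPath]

/-- The extensions of the local operator lower the quantum grading by at most `δ`. -/
def IsFiltOp (δ : ℝ) (τ τ' : BraidWord n) (F : LocalOp n) : Prop :=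
  ∀ η α b Y, Filt (α ++ τ) b Y → Filt (α ++ τ') (b - δ) fun r π => extend η α F r (Y r) π

/-- The loss of `1` is the grading shift of a positive crossing in its `0`-resolution. -/
theorem isFiltOp_deleteOp (i : Fin (n - 1)) (γ : BraidWord n) :
    IsFiltOp 1 ((i, true) :: γ) γ deleteOp := by
  intro η α b Y h e he
  obtain ⟨eα, eγ, rfl, hα, hγ⟩ := exists_append_of_length he
  obtain ⟨Z, h1, h2⟩ := (h (eα ++ false :: eγ) (by simp [hα, hγ])).dropNone hα
  refine FiltAt.extend η hα (h1.mono ?_) fun r πα ρ hl _ => h2 r πα ρ hl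
  rw [shift_append hα, shift_append hα]
  simp only [shift, letterShift]
  norm_num
  linarith

/-- The shifts of the two crossings cancel, both when they are braidlike and when they are not. In
the correction term the saddle costs one and the counit gains one. -/
theorem isFiltOp_cancelOp (i : Fin (n - 1)) (s : Bool) (γ : BraidWord n) :
    IsFiltOp 0 ((i, s) :: (i, !s) :: γ) γ (cancelOp i) := by
  intro η α b Y h e he
  obtain ⟨eα, eγ, rfl, hα, hγ⟩ := exists_append_of_length he
  obtain ⟨Z, h1, h2⟩ := (h (eα ++ false :: false :: eγ) (by simp [hα, hγ])).dropNone hα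
  obtain ⟨Z', h1', h2'⟩ := h1.dropNone hα
  obtain ⟨W, k1, k2⟩ := (h (eα ++ true :: true :: eγ) (by simp [hα, hγ])).sumSome (a := (i, s))
    (a' := (i, !s)) hα hγ rfl
  obtain ⟨W', k1', k2'⟩ := k1.saddleNone hα hγ
  obtain ⟨W'', k1'', k2''⟩ := k1'.dropNone hα
  refine FiltAt.extend η hα ((h1'.mono ?_).sub (k1''.mono ?_)) fun r πα ρ hl _ => ?_
  · rw [shift_append hα, shift_append hα]
    cases s <;> simp only [shift, letterShift] <;> norm_num
  · rw [shift_append hα, shift_append hα]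
    cases s <;> simp only [shift, letterShift] <;> norm_num
  · rw [h2' _ _ _ hl, h2 _ _ _ hl, k2'' _ _ _ hl, k2' _ _ _ hl]
    simp only [k2 _ _ _ _ hl, cancelOp]

/-- On the resolution with the small circle a saddle, which costs one, is followed by a birth, which
gains one. The mixed resolutions receive zero. -/
theorem isFiltOp_insertOp (i : Fin (n - 1)) (s : Bool) (γ : BraidWord n) :
    IsFiltOp 0 γ ((i, s) :: (i, !s) :: γ) (insertOp i) := by
  intro η α b Y h e he
  obtain ⟨eα, e, rfl, hα, he1⟩ := exists_append_of_length he
  obtain ⟨x, e, rfl, he2⟩ := exists_cons_of_length he1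
  obtain ⟨y, eγ, rfl, hγ⟩ := exists_cons_of_length he2
  have h := h (eα ++ eγ) (by simp [hα, hγ])
  obtain ⟨Z, h1, h2⟩ := h.addNone hα (i, !s)
  rcases x with _ | _ <;> rcases y with _ | _
  · obtain ⟨Z', h1', h2'⟩ := h1.addNone hα (i, s)
    refine FiltAt.extend η hα (h1'.mono ?_) fun r πα ρ hl hs => ?_
    · rw [shift_append hα, shift_append hα]
      cases s <;> simp only [shift, letterShift] <;> norm_num
    · obtain ⟨ρ, rfl, hs1⟩ := shape_eq_false hs
      obtain ⟨ρ, rfl, hs2⟩ := shape_eq_false hs1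
      rw [h2' _ _ _ hl, h2 _ _ _ hl]
      rfl
  · refine FiltAt.extend η hα (filtAt_zero _ _ _) fun r πα ρ hl hs => ?_
    obtain ⟨ρ, rfl, hs1⟩ := shape_eq_false hs
    obtain ⟨c, ρ, rfl, hs2⟩ := shape_eq_true hs1
    rfl
  · refine FiltAt.extend η hα (filtAt_zero _ _ _) fun r πα ρ hl hs => ?_
    obtain ⟨c, ρ, rfl, hs1⟩ := shape_eq_true hs
    obtain ⟨ρ, rfl, hs2⟩ := shape_eq_false hs1
    rfl
  · obtain ⟨W, k1, k2⟩ := h1.saddleSome hα hγ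
    obtain ⟨W', k1', k2'⟩ := k1.addSome (a := (i, s)) (a' := (i, !s)) hα hγ rfl
    refine FiltAt.extend η hα (k1'.mono ?_) fun r πα ρ hl hs => ?_
    · rw [shift_append hα, shift_append hα]
      cases s <;> simp only [shift, letterShift] <;> norm_num
    · obtain ⟨c, ρ, rfl, hs1⟩ := shape_eq_true hs
      obtain ⟨d, ρ, rfl, hs2⟩ := shape_eq_true hs1
      rw [k2' _ _ _ _ _ hl, k2 _ _ _ _ hl, h2 _ _ _ hl]
      simp only [insertOp, mul_ite, mul_zero]

theorem isFiltOp_commOp {i j : Fin (n - 1)} (h : Far i j) (γ : BraidWord n) :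
    IsFiltOp 0 ((i, true) :: (j, true) :: γ) ((j, true) :: (i, true) :: γ) commOp := by
  intro η α b Y hY e he
  obtain ⟨eα, e, rfl, hα, he1⟩ := exists_append_of_length he
  obtain ⟨x, e, rfl, he2⟩ := exists_cons_of_length he1
  obtain ⟨y, eγ, rfl, hγ⟩ := exists_cons_of_length he2
  have hY := hY (eα ++ y :: x :: eγ) (by simp [hα, hγ])
  have hs : shift (α ++ (i, true) :: (j, true) :: γ) (eα ++ y :: x :: eγ) - b ≤
      shift (α ++ (j, true) :: (i, true) :: γ) (eα ++ x :: y :: eγ) - (b - 0) := by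
    rw [shift_append hα, shift_append hα]
    simp only [shift]
    linarith
  have hY := hY.mono hs
  generalize shift (α ++ (j, true) :: (i, true) :: γ) (eα ++ x :: y :: eγ) - (b - 0) = z at hY ⊢
  rcases x with _ | _
  · obtain ⟨Z, h1, h2⟩ := hY.dropNone₂ hα
    obtain ⟨Z', h1', h2'⟩ := h1.addNone hα (j, true)
    refine FiltAt.extend η hα h1' fun r πα ρ hl hs => ?_
    obtain ⟨ρ, rfl, hs1⟩ := shape_eq_false hs
    rcases ρ with _ | ⟨_ | c, ρ⟩
    · simp at hs1
    · rw [h2' _ _ _ hl, h2 _ _ _ _ hl]; rfl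
    · rw [h2' _ _ _ hl, h2 _ _ _ _ hl]; rfl
  · rcases y with _ | _
    · obtain ⟨Z, h1, h2⟩ := hY.dropNone hα
      obtain ⟨Z', h1', h2'⟩ := h1.addNone₂ hα (i, true)
      refine FiltAt.extend η hα h1' fun r πα ρ hl hs => ?_
      obtain ⟨c, ρ, rfl, hs1⟩ := shape_eq_true hs
      obtain ⟨ρ, rfl, hs2⟩ := shape_eq_false hs1
      rw [h2' _ _ _ _ hl, h2 _ _ _ hl]; rfl
    · obtain ⟨Z, h1, h2⟩ := hY.swapSome hα h
      refine FiltAt.extend η hα (h1.mul (-1)) fun r πα ρ hl hs => ?_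
      obtain ⟨d, ρ, rfl, hs1⟩ := shape_eq_true hs
      obtain ⟨c, ρ, rfl, hs2⟩ := shape_eq_true hs1
      rw [h2 _ _ _ _ _ hl, neg_one_mul]; rfl

/-- Each component joins resolutions with equally many crossings that are not braidlike, so the
shifts agree. The saddles in it are as many as its births and deaths, hence the total degree is
zero. -/
theorem isFiltOp_triangleOp (i j : Fin (n - 1)) (γ : BraidWord n) :
    IsFiltOp 0 ((i, true) :: (j, true) :: (i, true) :: γ)
      ((j, true) :: (i, true) :: (j, true) :: γ) (triangleOp i j) := by
  intro η α b Y hY e he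
  obtain ⟨eα, e, rfl, hα, he1⟩ := exists_append_of_length he
  obtain ⟨x, e, rfl, he2⟩ := exists_cons_of_length he1
  obtain ⟨y, e, rfl, he3⟩ := exists_cons_of_length he2
  obtain ⟨z, eγ, rfl, hγ⟩ := exists_cons_of_length he3
  have hY : ∀ x y z, FiltAt (α ++ (i, true) :: (j, true) :: (i, true) :: γ)
      (eα ++ x :: y :: z :: eγ) (shift α eα + (letterShift true x + (letterShift true y +
        (letterShift true z + shift γ eγ))) - b) Y := by
    intro x y z
    have := hY (eα ++ x :: y :: z :: eγ) (by simp [hα, hγ])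
    rwa [shift_append hα] at this
  rw [shift_append hα]
  simp only [shift, sub_zero]
  rcases x with _ | _ <;> rcases y with _ | _ <;> rcases z with _ | _
  · obtain ⟨Z1, h1, k1⟩ := (hY false false false).dropNone hα
    obtain ⟨Z2, h2, k2⟩ := h1.dropNone hα
    obtain ⟨Z3, h3, k3⟩ := h2.dropNone hα
    obtain ⟨Z4, h4, k4⟩ := h3.addNone hα (j, true)
    obtain ⟨Z5, h5, k5⟩ := h4.addNone hα (i, true)
    obtain ⟨Z6, h6, k6⟩ := h5.addNone hα (j, true)
    refine FiltAt.extend η hα h6 fun r πα ρ hl hs => ?_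
    obtain ⟨ρ, rfl, hs1⟩ := shape_eq_false hs
    obtain ⟨ρ, rfl, hs2⟩ := shape_eq_false hs1
    obtain ⟨ρ, rfl, hs3⟩ := shape_eq_false hs2
    rw [k6 _ _ _ hl, k5 _ _ _ hl, k4 _ _ _ hl, k3 _ _ _ hl, k2 _ _ _ hl, k1 _ _ _ hl]
    rfl
  · obtain ⟨Z1, h1, k1⟩ := (hY false true false).dropNone hα
    obtain ⟨Z2, h2, k2⟩ := h1.dropNone₂ hα
    obtain ⟨Z3, h3, k3⟩ := h2.addNone hα (i, true)
    obtain ⟨Z4, h4, k4⟩ := h3.addNone hα (j, true)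
    refine FiltAt.extend η hα (h4.mono (by linarith)) fun r πα ρ hl hs => ?_
    obtain ⟨ρ, rfl, hs1⟩ := shape_eq_false hs
    obtain ⟨ρ, rfl, hs2⟩ := shape_eq_false hs1
    obtain ⟨c, ρ, rfl, hs3⟩ := shape_eq_true hs2
    rw [k4 _ _ _ hl, k3 _ _ _ hl, k2 _ _ _ _ hl, k1 _ _ _ hl]
    rfl
  · obtain ⟨Z1, h1, k1⟩ := (hY true false false).dropNone₂ hα
    obtain ⟨Z2, h2, k2⟩ := h1.dropNone₂ hα
    obtain ⟨Z3, h3, k3⟩ := h2.addNone₂ hα (j, true)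
    obtain ⟨Z4, h4, k4⟩ := h3.addNone hα (j, true)
    refine FiltAt.extend η hα (h4.mono (by linarith)) fun r πα ρ hl hs => ?_
    obtain ⟨ρ, rfl, hs1⟩ := shape_eq_false hs
    obtain ⟨c, ρ, rfl, hs2⟩ := shape_eq_true hs1
    obtain ⟨ρ, rfl, hs3⟩ := shape_eq_false hs2
    rw [k4 _ _ _ hl, k3 _ _ _ _ hl, k2 _ _ _ _ hl, k1 _ _ _ _ hl]
    rfl
  · obtain ⟨Z1, h1, k1⟩ := (hY true true false).dropNone₃ hα
    obtain ⟨Z2, h2, k2⟩ := h1.addNone hα (j, true)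
    refine FiltAt.extend η hα (h2.mono (by linarith)) fun r πα ρ hl hs => ?_
    obtain ⟨ρ, rfl, hs1⟩ := shape_eq_false hs
    obtain ⟨c, ρ, rfl, hs2⟩ := shape_eq_true hs1
    obtain ⟨d, ρ, rfl, hs3⟩ := shape_eq_true hs2
    rw [k2 _ _ _ hl, k1 _ _ _ _ _ hl]
    rfl
  · obtain ⟨Z1, h1, k1⟩ := (hY false true false).dropNone hα
    obtain ⟨Z2, h2, k2⟩ := h1.dropNone₂ hα
    obtain ⟨Z3, h3, k3⟩ := h2.addNone₂ hα (j, true)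
    obtain ⟨Z4, h4, k4⟩ := h3.addNone₂ hα (i, true)
    refine FiltAt.extend η hα (h4.mono (by linarith)) fun r πα ρ hl hs => ?_
    obtain ⟨c, ρ, rfl, hs1⟩ := shape_eq_true hs
    obtain ⟨ρ, rfl, hs2⟩ := shape_eq_false hs1
    obtain ⟨ρ, rfl, hs3⟩ := shape_eq_false hs2
    rw [k4 _ _ _ _ hl, k3 _ _ _ _ hl, k2 _ _ _ _ hl, k1 _ _ _ hl]
    rfl
  · obtain ⟨Z1, h1, k1⟩ := (hY true true false).dropNone₃ hα
    obtain ⟨Z2, h2, k2⟩ := h1.saddleNone hα (by simp [hγ])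
    obtain ⟨Z3, h3, k3⟩ := h2.dropNone hα
    obtain ⟨V1, p1, q1⟩ := (hY false true true).dropNone hα
    obtain ⟨V2, p2, q2⟩ := p1.saddleNone₂ hα hγ
    obtain ⟨V3, p3, q3⟩ := p2.dropNone₂ hα
    obtain ⟨W1, l1, m1⟩ := (hY true false true).dropNone₂ hα
    obtain ⟨W2, l2, m2⟩ := l1.sumSome hα hγ rfl
    obtain ⟨W3, l3, m3⟩ := l2.saddleNone hα hγ
    obtain ⟨W4, l4, m4⟩ := l3.dropNone hα
    obtain ⟨W5, l5, m5⟩ := l4.addNone hα (j, true)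
    obtain ⟨W6, l6, m6⟩ := l5.saddleSome hα hγ
    simp only [letterShift, if_true, Bool.false_eq_true, if_false] at h3 p3 l6 ⊢
    norm_num at h3 p3 l6 ⊢
    obtain ⟨U1, s1, t1⟩ := (h3.add ((p3.mono (by linarith)).sub
      (l6.mono (by linarith)))).addSome (a := (j, true)) hα hγ rfl
    obtain ⟨U2, s2, t2⟩ := s1.addNone₂ hα (i, true)
    refine FiltAt.extend η hα (s2.mono (by linarith)) fun r πα ρ hl hs => ?_
    obtain ⟨c, ρ, rfl, hs1⟩ := shape_eq_true hs
    obtain ⟨ρ, rfl, hs2⟩ := shape_eq_false hs1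
    obtain ⟨d, ρ, rfl, hs3⟩ := shape_eq_true hs2
    rw [t2 _ _ _ _ hl, t1 _ _ _ _ _ hl, k3 _ _ _ hl, k2 _ _ _ hl, k1 _ _ _ _ _ hl,
      q3 _ _ _ _ hl, q2 _ _ _ _ hl, q1 _ _ _ hl, m6 _ _ _ _ hl, m5 _ _ _ hl, m4 _ _ _ hl,
      m3 _ _ _ hl, m2 _ _ _ _ hl]
    simp only [m1 _ _ _ _ hl, triangleOp]
    congr 3
    by_cases hd : d = finalRow α r πα (leftPos j)
    · subst hd
      simp only [and_true, if_true]
      split_ifs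
      · ring
      · ring
    · simp only [hd, and_false, if_false]
  · obtain ⟨Z1, h1, k1⟩ := (hY false true true).dropNone hα
    obtain ⟨Z2, h2, k2⟩ := h1.addNone₃ hα (j, true)
    obtain ⟨W1, l1, m1⟩ := (hY true false true).dropNone₂ hα
    obtain ⟨W2, l2, m2⟩ := l1.sumSome hα hγ rfl
    obtain ⟨W3, l3, m3⟩ := l2.addNone hα (j, true)
    obtain ⟨W4, l4, m4⟩ := l3.saddleSome hα (by simp [hγ])
    obtain ⟨W5, l5, m5⟩ := l4.addNone₃ hα (j, true)
    refine FiltAt.extend η hα ((h2.mono ?_).sub (l5.mono ?_)) fun r πα ρ hl hs => ?_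
    · linarith
    · linarith
    obtain ⟨c, ρ, rfl, hs1⟩ := shape_eq_true hs
    obtain ⟨d, ρ, rfl, hs2⟩ := shape_eq_true hs1
    obtain ⟨ρ, rfl, hs3⟩ := shape_eq_false hs2
    rw [k2 _ _ _ _ _ hl, k1 _ _ _ hl, m5 _ _ _ _ _ hl, m4 _ _ _ _ hl, m3 _ _ _ hl, m2 _ _ _ _ hl]
    simp only [m1 _ _ _ _ hl, triangleOp]
    congr 1
    split_ifs with hc
    · rw [hc]
    · rfl
  · refine FiltAt.extend η hα (filtAt_zero _ _ _) fun r πα ρ hl hs => ?_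
    obtain ⟨c, ρ, rfl, hs1⟩ := shape_eq_true hs
    obtain ⟨d, ρ, rfl, hs2⟩ := shape_eq_true hs1
    obtain ⟨d', ρ, rfl, hs3⟩ := shape_eq_true hs2
    rfl

/-! The upper bound for the grading of the class of the canonical generator. -/

/-- The row of the alternating colouring, the outermost colour of which is `false`. -/
def altRow (n : ℕ) : Row n := fun p => !decide (Even (n - 1 - p.val))

/-- Saddles need equal colours at the crossing. So the alternating row admits none, and the
canonical generator sits on an isolated vertex of the complex of colourings. -/
theorem not_isFlat_altRow (i : Fin (n - 1)) : ¬ IsFlat i (altRow n) := by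
  have h : n - 1 - i.val = (n - 1 - (i.val + 1)) + 1 := by omega
  simp only [IsFlat, altRow, leftPos, rightPos, h, Nat.even_add_one]
  by_cases h : Even (n - 1 - (i.val + 1)) <;> simp [h]

theorem valid_altRow {β : BraidWord n} {π : Path} (h : Valid β (altRow n) π) :
    π = List.replicate β.length none := by
  induction β generalizing π with
  | nil =>
    rcases π with _ | ⟨o, π⟩
    · rfl
    · simp [Valid] at h
  | cons a β ih =>
    rcases π with _ | ⟨_ | c, π⟩
    · simp [Valid] at h
    · rw [ih (π := π) h]; rfl
    · exact absurd h.1 (not_isFlat_altRow _)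

/-- The canonical generator up to normalization: the alternating colouring of the oriented
resolution. -/
noncomputable def altState (r : Row n) (π : Path) : ℂ :=
  if r = altRow n ∧ ∀ o ∈ π, o = none then 1 else 0

theorem altState_append (r : Row n) (πα ρ : Path) :
    altState r (πα ++ ρ) =
      if r = altRow n ∧ ∀ o ∈ πα, o = none then altState (altRow n) ρ else 0 := by
  simp only [altState, List.mem_append, or_imp, forall_and]
  split_ifs <;> tauto

theorem altState_valid {β : BraidWord n} {π : Path} (h : Valid β (altRow n) π) :
    altState (altRow n) π = 1 := by
  rw [valid_altRow h, altState, if_pos ⟨rfl, fun o ho => List.eq_of_mem_replicate ho⟩]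

theorem finalRow_of_forall_none {α : BraidWord n} {r : Row n} {π : Path}
    (h : ∀ o ∈ π, o = none) : finalRow α r π = r := by
  induction α generalizing π with
  | nil => simp [finalRow]
  | cons a α ih =>
    rcases π with _ | ⟨_ | c, π⟩
    · simp [finalRow]
    · exact ih fun o ho => h o (List.mem_cons_of_mem _ ho)
    · simp at h

theorem prefixSign_ne_zero {η : ℂ} (hη : η ≠ 0) (α : BraidWord n) (π : Path) :
    prefixSign η α π ≠ 0 := by
  induction α generalizing π with
  | nil => simp [prefixSign]
  | cons a α ih =>
    rcases π with _ | ⟨_ | c, π⟩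
    · simp [prefixSign]
    · simp only [prefixSign]
      refine mul_ne_zero ?_ (ih π)
      split_ifs <;> simp [hη]
    · simp only [prefixSign]
      refine mul_ne_zero ?_ (ih π)
      split_ifs <;> simp [hη]

/-- On other rows, or behind a prefix that is not braidlike, the restriction of `altState` is zero
and linearity suffices. Hence `F` has to be known only at the alternating row of the suffix. -/
theorem extend_altState {η : ℂ} {τ : BraidWord n} {F : LocalOp n} (hF : IsLinearOp F)
    (hS : ∀ π, Valid τ (altRow n) π → F (altRow n) (altState (altRow n)) π = 1)
    {α : BraidWord n} {r : Row n} {π : Path} (hπ : Valid (α ++ τ) r π) :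
    extend η α F r (altState r) π =
      prefixSign η α (List.replicate α.length none) * altState r π := by
  obtain ⟨πα, ρ, rfl, hα, -⟩ : ∃ πα ρ, π = πα ++ ρ ∧ πα.length = α.length ∧
      ρ.length = τ.length := by
    have := hπ.length_eq
    rw [List.length_append] at this
    exact ⟨π.take α.length, π.drop α.length, (List.take_append_drop _ _).symm,
      by rw [List.length_take]; omega, by rw [List.length_drop]; omega⟩
  rw [extend_append η α F r (altState r) πα ρ hα, altState_append]
  simp only [altState_append]
  by_cases h : r = altRow n ∧ ∀ o ∈ πα, o = none
  · simp only [if_pos h]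
    have hv := ((valid_append hα).1 hπ).2
    rw [finalRow_of_forall_none h.2, h.1] at hv ⊢
    rw [altState_valid hv, hS ρ hv, ← hα, ← List.eq_replicate_of_mem h.2]
  · simp only [if_neg h]
    rw [hF.zero, mul_zero, mul_zero]

/-! ### Transport of the upper bound along local operators. -/

/-- The quantum grading of a chain in the class of the canonical generator is at most `c - n`. -/
def UpperBound (β : BraidWord n) (c : ℝ) : Prop :=
  ∀ (Y : Row n → Path → ℂ) (k : ℂ) (b : ℝ), k ≠ 0 →
    Filt β b (fun r π => k * altState r π + colD β r (Y r) π) → b ≤ c - n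

/-- The operator takes a representative of a multiple of the class for `α ++ τ` to one for `α ++ τ'`
and loses at most `δ`. The bound for the target then limits the grading of the source. -/
theorem UpperBound.of_op {η : ℂ} {δ c : ℝ} {τ τ' : BraidWord n} {F : LocalOp n}
    (hF : IsLinearOp F) (hC : IsChainOp η τ τ' F) (hδ : IsFiltOp δ τ τ' F) (hη : η ≠ 0)
    (hS : ∀ π, Valid τ' (altRow n) π → F (altRow n) (altState (altRow n)) π = 1)
    (α : BraidWord n) (h : UpperBound (α ++ τ') c) : UpperBound (α ++ τ) (c + δ) := by
  intro Y k b hk hf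
  have := h (fun r π => η * extend η α F r (Y r) π)
    (k * prefixSign η α (List.replicate α.length none)) (b - δ)
    (mul_ne_zero hk (prefixSign_ne_zero hη _ _)) fun e he =>
      (hδ η α b _ hf e he).congr fun r π _ hcl => ?_
  · linarith
  · have hL := hF.extend η α
    have hC' := hC.extend hF α r (Y r) π hcl.1
    rw [hL.add, hL.mul, extend_altState hF hS hcl.1, hC', colD_mul]
    ring

theorem upperBound_delete (i : Fin (n - 1)) (α γ : BraidWord n) {c : ℝ}
    (h : UpperBound (α ++ γ) c) : UpperBound (α ++ (i, true) :: γ) (c + 1) :=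
  UpperBound.of_op isLinearOp_deleteOp (isChainOp_deleteOp i γ) (isFiltOp_deleteOp i γ) one_ne_zero
    (fun π hπ => altState_valid (β := (i, true) :: γ) (π := none :: π) hπ) α h

theorem upperBound_cancel (i : Fin (n - 1)) (s : Bool) (α γ : BraidWord n) (c : ℝ) :
    UpperBound (α ++ (i, s) :: (i, !s) :: γ) c ↔ UpperBound (α ++ γ) c := by
  constructor
  · intro h
    rw [← add_zero c]
    refine UpperBound.of_op (isLinearOp_insertOp i) (isChainOp_insertOp i s γ)
      (isFiltOp_insertOp i s γ) (by norm_num) (fun π hπ => ?_) α h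
    rw [valid_altRow hπ]
    simp [insertOp, altState, List.replicate_succ]
  · intro h
    rw [← add_zero c]
    refine UpperBound.of_op (isLinearOp_cancelOp i) (isChainOp_cancelOp i s γ)
      (isFiltOp_cancelOp i s γ) (by norm_num) (fun π hπ => ?_) α h
    rw [cancelOp, if_neg (not_isFlat_altRow i), sub_zero]
    exact altState_valid (β := (i, s) :: (i, !s) :: γ) (π := none :: none :: π) hπ

theorem upperBound_comm {i j : Fin (n - 1)} (hf : Far i j) (α γ : BraidWord n) {c : ℝ}
    (h : UpperBound (α ++ (j, true) :: (i, true) :: γ) c) :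
    UpperBound (α ++ (i, true) :: (j, true) :: γ) c := by
  rw [← add_zero c]
  refine UpperBound.of_op isLinearOp_commOp (isChainOp_commOp hf γ)
    (isFiltOp_commOp hf γ) one_ne_zero (fun π hπ => ?_) α h
  rw [valid_altRow hπ]
  simp [commOp, altState, List.replicate_succ]

theorem upperBound_triangle {i j : Fin (n - 1)} (ha : Adjacent i j) (α γ : BraidWord n) {c : ℝ}
    (h : UpperBound (α ++ (j, true) :: (i, true) :: (j, true) :: γ) c) :
    UpperBound (α ++ (i, true) :: (j, true) :: (i, true) :: γ) c := by
  rw [← add_zero c]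
  refine UpperBound.of_op (isLinearOp_triangleOp i j) (isChainOp_triangleOp ha γ)
    (isFiltOp_triangleOp i j γ) one_ne_zero (fun π hπ => ?_) α h
  rw [valid_altRow hπ]
  simp [triangleOp, altState, List.replicate_succ]

/-! ### The upper bound for the trivial braid. -/

/-- The coefficient of the monomial of top degree of a function of the constant families of rows. -/
noncomputable def topCoeff (n : ℕ) : ((ℕ → Row n) → ℂ) →ₗ[ℂ] ℂ :=
  ∑ r : Row n, (∏ p, sg (r p)) • LinearMap.proj fun _ => r

theorem topCoeff_apply (f : (ℕ → Row n) → ℂ) :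
    topCoeff n f = ∑ r : Row n, (∏ p, sg (r p)) * f fun _ => r := by
  simp [topCoeff]

theorem sg_not (b : Bool) : sg (!b) = -sg b := by cases b <;> simp [sg]

/-- Fewer than `n` factors miss some position. Flipping the colour there is an involution on rows
that keeps the monomial and changes the sign of the product. -/
theorem topCoeff_mon {q : List (ℕ × Fin n)} (h : q.length < n) : topCoeff n (mon q) = 0 := by
  obtain ⟨p, hp⟩ : ∃ p, p ∉ q.map Prod.snd := by
    by_contra! hall
    have h1 : (q.map Prod.snd).toFinset = Finset.univ := by
      ext p; simpa using hall p
    have h2 := List.toFinset_card_le (q.map Prod.snd)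
    rw [h1, Finset.card_univ, Fintype.card_fin, List.length_map] at h2
    omega
  rw [topCoeff_apply]
  refine Finset.sum_involution (fun r _ => Function.update r p (!r p)) (fun r _ => ?_)
    (fun r _ _ => ?_) (fun _ _ => Finset.mem_univ _) (fun r _ => by simp)
  · have h1 : mon q (fun _ => Function.update r p (!r p)) = mon q fun _ => r := by
      unfold mon
      congr 1
      refine List.map_congr_left fun x hx => ?_
      dsimp only
      rw [Function.update_of_ne]
      rintro rfl
      exact hp (List.mem_map_of_mem hx)
    have h2 : ∏ p', sg (Function.update r p (!r p) p') = -∏ p', sg (r p') := by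
      rw [← Finset.mul_prod_erase _ _ (Finset.mem_univ p),
        ← Finset.mul_prod_erase _ (fun p' => sg (r p')) (Finset.mem_univ p),
        Function.update_self, sg_not, neg_mul]
      congr 2
      refine Finset.prod_congr rfl fun p' hp' => ?_
      rw [Function.update_of_ne (Finset.ne_of_mem_erase hp')]
    rw [h1, h2]; ring
  · intro h
    have := congrFun h p
    simp at this

theorem numCircles_nil : numCircles ([] : BraidWord n) [] = n := by
  have : closedCount ([] : BraidWord n) ⊤ (topPath []) = 2 ^ n := by
    have h : ∀ s : Row n, s ≤ ⊤ := fun s => le_top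
    simp [closedCount, subCount, h]
  rw [numCircles, this, Nat.log_pow (by norm_num)]

/-- Without crossings the differential is zero, so the polynomial is a nonzero multiple of the delta
function at the alternating row. Its top coefficient does not vanish, whereas a grading above `-n`
would force a degree below `n`. -/
theorem upperBound_nil : UpperBound ([] : BraidWord n) 0 := by
  intro Y k b hk hf
  obtain ⟨f, hf, h⟩ := hf [] rfl
  rw [numCircles_nil] at hf
  by_contra! hb
  have h0 : topCoeff n f = 0 := by
    have : polySpace n (n + (shift ([] : BraidWord n) [] - b)) ≤ LinearMap.ker (topCoeff n) := by
      refine Submodule.span_le.2 ?_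
      rintro _ ⟨q, hq, rfl⟩
      refine topCoeff_mon ?_
      simp only [Set.mem_setOf_eq, shift] at hq
      have : (q.length : ℝ) < n := by linarith
      exact_mod_cast this
    exact this hf
  have hrow : ∀ r : Row n, rowAt ([] : BraidWord n) r [] = fun _ => r := fun r => by
    funext l; simp [rowAt]
  have h1 : ∀ r : Row n, f (fun _ => r) =
      (weight ([] : BraidWord n) r [])⁻¹ * (k * altState r []) := fun r => by
    have := h r [] rfl ⟨trivial, rfl⟩
    simp only [colD, add_zero, hrow] at this
    rw [this, inv_mul_cancel_left₀ (weight_ne_zero _ _ _)]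
  rw [topCoeff_apply, Finset.sum_eq_single (altRow n)] at h0
  · rw [h1] at h0
    have hs : ∏ p, sg (altRow n p) ≠ 0 := Finset.prod_ne_zero_iff.2 fun p _ h => by
      have := sg_mul_self (altRow n p)
      rw [h] at this
      simp at this
    simp [altState, hk, weight_ne_zero, hs] at h0
  · intro r _ hr
    rw [h1]
    simp [altState, hr]
  · simp

/-! Braid words for the same braid. -/

/-- Two words can be replaced by each other in all words, without a change of the upper bounds. -/
def wordCon (n : ℕ) : Con (FreeMonoid (Fin (n - 1) × Bool)) where
  r β β' := ∀ (α γ : BraidWord n) (c : ℝ),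
    UpperBound (α ++ (β.toList ++ γ)) c ↔ UpperBound (α ++ (β'.toList ++ γ)) c
  iseqv := ⟨fun _ _ _ _ => Iff.rfl, fun h α γ c => (h α γ c).symm,
    fun h h' α γ c => (h α γ c).trans (h' α γ c)⟩
  mul' {β β' δ δ'} h h' α γ c := by
    rw [FreeMonoid.toList_mul, FreeMonoid.toList_mul, List.append_assoc, List.append_assoc,
      h, ← List.append_assoc, h', List.append_assoc]

/-- The class of a word. -/
def wordClass (β : BraidWord n) : (wordCon n).Quotient := ((FreeMonoid.ofList β : FreeMonoid _) : _)

theorem wordClass_append (β β' : BraidWord n) :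
    wordClass (β ++ β') = wordClass β * wordClass β' := rfl

theorem wordClass_eq_iff {β β' : BraidWord n} : wordClass β = wordClass β' ↔
    ∀ (α γ : BraidWord n) (c : ℝ), UpperBound (α ++ (β ++ γ)) c ↔ UpperBound (α ++ (β' ++ γ)) c :=
  (wordCon n).eq

theorem wordClass_cancel (i : Fin (n - 1)) (s : Bool) :
    wordClass [(i, s)] * wordClass [(i, !s)] = 1 := by
  rw [← wordClass_append]
  exact wordClass_eq_iff.2 fun α γ c => upperBound_cancel i s α γ c

/-- The class of a generator. -/
def genClass (i : Fin (n - 1)) : (wordCon n).Quotientˣ :=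
  ⟨wordClass [(i, true)], wordClass [(i, false)], wordClass_cancel i true, wordClass_cancel i false⟩

/-- `Far` and `Adjacent` are symmetric conditions, so exchanging the two generators in one chain map
gives the converse implication. -/
theorem genClass_rel (r : FreeGroup (Fin (n - 1))) (hr : r ∈ braidRels n) :
    FreeGroup.lift genClass r = 1 := by
  rcases hr with ⟨i, j, h, rfl⟩ | ⟨i, j, h, rfl⟩
  · rw [map_mul, map_inv, mul_inv_eq_one]
    simp only [map_mul, FreeGroup.lift_apply_of]
    refine Units.ext (wordClass_eq_iff (β := [(i, true), (j, true)])
      (β' := [(j, true), (i, true)]).2 fun α γ c => ⟨?_, ?_⟩)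
    · exact upperBound_comm (Or.inr h) α γ
    · exact upperBound_comm (Or.inl h) α γ
  · rw [map_mul, map_inv, mul_inv_eq_one]
    simp only [map_mul, FreeGroup.lift_apply_of]
    refine Units.ext (wordClass_eq_iff (β := [(i, true), (j, true), (i, true)])
      (β' := [(j, true), (i, true), (j, true)]).2 fun α γ c => ⟨?_, ?_⟩)
    · exact upperBound_triangle (Or.inr h) α γ
    · exact upperBound_triangle (Or.inl h) α γ

/-- The class of the words for a braid. -/
def braidClass (n : ℕ) : BraidGroup n →* (wordCon n).Quotientˣ :=
  PresentedGroup.toGroup (f := genClass) genClass_rel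

theorem toBraid_cons (a : Fin (n - 1) × Bool) (β : BraidWord n) :
    toBraid (a :: β) = toBraid [a] * toBraid β := by
  simp only [toBraid, ← map_mul, FreeGroup.mul_mk, List.singleton_append]

theorem toBraid_append (α β : BraidWord n) :
    toBraid (α ++ β) = toBraid α * toBraid β := by
  simp only [toBraid, ← map_mul, FreeGroup.mul_mk]

theorem toBraid_nil : toBraid ([] : BraidWord n) = 1 := rfl

theorem toBraid_true (i : Fin (n - 1)) : toBraid [(i, true)] = artinGen i := rfl

theorem toBraid_false (i : Fin (n - 1)) : toBraid [(i, false)] = (artinGen i)⁻¹ := rfl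

theorem braidClass_toBraid (β : BraidWord n) :
    ((braidClass n (toBraid β) : (wordCon n).Quotientˣ) : (wordCon n).Quotient) = wordClass β := by
  have hg : ∀ i, braidClass n (artinGen i) = genClass i := fun i =>
    PresentedGroup.toGroup.of genClass_rel
  induction β with
  | nil => rw [toBraid_nil, map_one]; rfl
  | cons a β ih =>
    rw [toBraid_cons, map_mul, Units.val_mul, ih]
    refine Eq.trans ?_ (wordClass_append [a] β).symm
    congr 1
    obtain ⟨i, s⟩ := a
    cases s
    · rw [toBraid_false, map_inv, hg]; rfl
    · rw [toBraid_true, hg]; rfl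

/-- Replaceability of words is a congruence. Its quotient monoid makes the letters invertible and
satisfies the Artin relations, so the class of a word factors through the braid group. -/
theorem upperBound_congr {β β' : BraidWord n} (h : toBraid β = toBraid β') {c : ℝ} :
    UpperBound β c ↔ UpperBound β' c := by
  have := wordClass_eq_iff.1 ((braidClass_toBraid β).symm.trans
    ((congrArg (fun x => ((braidClass n x : (wordCon n).Quotientˣ) : (wordCon n).Quotient)) h).trans
      (braidClass_toBraid β'))) [] [] c
  simpa using this

theorem toBraid_surjective : Function.Surjective (toBraid (n := n)) := by
  intro σ
  obtain ⟨x, rfl⟩ := PresentedGroup.mk_surjective _ σ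
  exact ⟨x.toWord, by rw [toBraid, FreeGroup.mk_toWord]⟩

/-- In the word for `w σᵢ w⁻¹` times the rest, deleting `σᵢ` leaves a word for the rest, the bound
of which is known by induction. The deletion adds one. -/
theorem exists_word_of_quasipositive (L : List (BraidGroup n × Fin (n - 1))) :
    ∃ β : BraidWord n, toBraid β = (L.map fun b => b.1 * artinGen b.2 * b.1⁻¹).prod ∧
      UpperBound β L.length := by
  induction L with
  | nil => exact ⟨[], rfl, by simpa using upperBound_nil⟩
  | cons b L ih =>
    obtain ⟨β, h1, h2⟩ := ih
    obtain ⟨w, hw⟩ := toBraid_surjective b.1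
    obtain ⟨w', hw'⟩ := toBraid_surjective b.1⁻¹
    refine ⟨w ++ (b.2, true) :: (w' ++ β), ?_, ?_⟩
    · rw [toBraid_append, toBraid_cons, toBraid_append, toBraid_true, hw, hw', h1, List.map_cons,
        List.prod_cons]
      group
    · rw [List.length_cons, Nat.cast_add, Nat.cast_one]
      refine upperBound_delete _ _ _ ((upperBound_congr ?_).1 h2)
      rw [toBraid_append, toBraid_append, hw, hw', mul_inv_cancel_left]

theorem writhe_toBraid (β : BraidWord n) : writhe (toBraid β) = (nPos β : ℤ) - nNeg β := by
  have hg : ∀ i : Fin (n - 1), writheHom n (artinGen i) = Multiplicative.ofAdd 1 := fun i =>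
    PresentedGroup.toGroup.of _
  induction β with
  | nil => rw [toBraid_nil]; simp [writhe, nPos, nNeg]
  | cons a β ih =>
    rw [writhe] at ih
    rw [toBraid_cons, writhe, map_mul, toAdd_mul, ih]
    obtain ⟨i, s⟩ := a
    cases s
    · rw [toBraid_false, map_inv, hg]; simp [nPos, nNeg]; ring
    · rw [toBraid_true, hg]; simp [nPos, nNeg]; ring

theorem writhe_quasipositive (L : List (BraidGroup n × Fin (n - 1))) :
    writhe (L.map fun b => b.1 * artinGen b.2 * b.1⁻¹).prod = L.length := by
  have hg : ∀ i : Fin (n - 1), writheHom n (artinGen i) = Multiplicative.ofAdd 1 := fun i =>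
    PresentedGroup.toGroup.of _
  induction L with
  | nil => simp [writhe]
  | cons b L ih =>
    rw [writhe] at ih
    have hb : writheHom n (b.1 * artinGen b.2 * b.1⁻¹) = Multiplicative.ofAdd 1 := by
      rw [map_mul, map_mul, map_inv, hg, mul_right_comm, mul_inv_cancel, one_mul]
    rw [List.map_cons, List.prod_cons, writhe, map_mul, toAdd_mul, ih, hb]
    simp
    ring

/-- The upper bound for quasipositive braids. -/
theorem upperBound_writhe {β : BraidWord n} (h : IsQuasipositive (toBraid β)) :
    UpperBound β (writhe (toBraid β)) := by
  obtain ⟨L, hL⟩ := h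
  obtain ⟨β', h1, h2⟩ := exists_word_of_quasipositive L
  rw [upperBound_congr (hL.trans h1.symm), hL, writhe_quasipositive]
  exact_mod_cast h2

/-! The Lee complex in the basis of colourings. -/

noncomputable instance (β : BraidWord n) (v : Resolution β) : DecidableEq (StateCircle β v) :=
  Classical.decEq _

/-- The value of a mark on a circle of a given colour. -/
def markVal (m c : Bool) : ℂ := if m then 1 else sg c

theorem markVal_mul_self (m c : Bool) : markVal m c * markVal m c = 1 := by
  cases m <;> simp [markVal, sg_mul_self]

theorem sum_mergeCoeff (a a' s : Bool) :
    ∑ b, mergeCoeff a a' b * markVal b s = markVal a s * markVal a' s := by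
  cases a <;> cases a' <;> cases s <;> simp [mergeCoeff, markVal, sg]

/-- The coproduct of `a` is `a ⊗ 1` times the coproduct of the unit, and evaluation at colours is
multiplicative. -/
theorem sum_splitCoeff (a s t : Bool) :
    ∑ b, ∑ c, splitCoeff a b c * (markVal b s * markVal c t) =
      markVal a s * (sg s + sg t) := by
  cases a <;> cases s <;> cases t <;> simp [splitCoeff, markVal, sg]

theorem prod_mul_of_eq_off_two {ι : Type*} [Fintype ι] {a b : ι} (hab : a ≠ b) {f g : ι → ℂ}
    (h : ∀ c, c ≠ a → c ≠ b → f c = g c) :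
    (∏ c, f c) * (g a * g b) = (∏ c, g c) * (f a * f b) := by
  classical
  rw [← Finset.mul_prod_erase _ f (Finset.mem_univ a),
    ← Finset.mul_prod_erase _ g (Finset.mem_univ a),
    ← Finset.mul_prod_erase _ f (Finset.mem_erase.2 ⟨hab.symm, Finset.mem_univ b⟩),
    ← Finset.mul_prod_erase _ g (Finset.mem_erase.2 ⟨hab.symm, Finset.mem_univ b⟩),
    Finset.prod_congr rfl fun c hc => h c (Finset.ne_of_mem_erase (Finset.mem_of_mem_erase hc))
      (Finset.ne_of_mem_erase hc)]
  ring

section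
variable {β : BraidWord n} {v v' : Resolution β} {l : Fin β.length}

/-- The target markings with a nonzero entry are determined by the mark `b` of the merged circle.
The sum over `b` evaluates the Lee product, which is the product of the values. -/
theorem sum_saddleCoeff_merge (hne : ∀ k, k ≠ l → v k = v' k)
    (h : circ β v (cornerA β l) ≠ circ β v (cornerB β l))
    (h' : circ β v' (cornerA β l) = circ β v' (cornerB β l)) (m : StateCircle β v → Bool)
    (χ : StateCircle β v' → Bool) :
    ∑ m' : StateCircle β v' → Bool, saddleCoeff β l ⟨v, m⟩ ⟨v', m'⟩ * ∏ c, markVal (m' c) (χ c) =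
      ∏ c, markVal (m c) (χ (mergeMap hne h' c)) := by
  classical
  set A' := circ β v' (cornerA β l) with hA'
  -- `c.out` is some node on the circle `c`; off the merged circle the old mark does not depend on
  -- its choice.
  let M : Bool → StateCircle β v' → Bool := fun b c => if c = A' then b else m (circ β v c.out)
  have hMA : ∀ b, M b A' = b := fun b => if_pos rfl
  have hMx : ∀ b x, circ β v x ≠ circ β v (cornerA β l) → circ β v x ≠ circ β v (cornerB β l) →
      M b (circ β v' x) = m (circ β v x) := by
    intro b x h1 h2
    have hx : circ β v' x ≠ A' := by
      intro hx
      rcases circ_merge_exact hne hx with h3 | ⟨h3 | h3, -⟩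
      · exact h1 h3
      · exact h1 h3
      · exact h2 h3
    have hout : circ β v' (Quot.out (circ β v' x)) = circ β v' x := Quot.out_eq _
    change (if circ β v' x = A' then b else m (circ β v (circ β v' x).out)) = _
    rw [if_neg hx]
    congr 1
    rcases circ_merge_exact hne hout with h3 | ⟨-, h3 | h3⟩
    · exact h3
    · exact absurd h3 h1
    · exact absurd h3 h2
  have hcoeff : ∀ m', saddleCoeff β l ⟨v, m⟩ ⟨v', m'⟩ = ∑ b, if m' = M b then
      mergeCoeff (m (circ β v (cornerA β l))) (m (circ β v (cornerB β l))) b else 0 := by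
    intro m'
    unfold saddleCoeff
    split_ifs with h1 h2
    · have hm : m' = M (m' A') := by
        funext c
        induction c using Quot.ind with
        | mk x =>
          by_cases hx : circ β v x ≠ circ β v (cornerA β l) ∧
              circ β v x ≠ circ β v (cornerB β l)
          · exact (h1 x hx.1 hx.2).trans (hMx _ x hx.1 hx.2).symm
          · have : circ β v' x = A' := by
              rw [not_and_or, not_not, not_not] at hx
              rcases hx with hx | hx
              · exact congrArg (mergeMap hne h') hx
              · exact (congrArg (mergeMap hne h') hx).trans h'.symm
            change m' (circ β v' x) = M _ (circ β v' x)
            rw [this, hMA]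
      rw [Finset.sum_eq_single (m' A'), if_pos hm]
      · intro b _ hb
        rw [if_neg]
        intro hmb
        exact hb (by rw [hmb, hMA])
      · simp
    · rw [Finset.sum_eq_zero]
      intro b _
      rw [if_neg]
      rintro rfl
      exact h1 fun x hx hx' => hMx b x hx hx'
  simp only [hcoeff, Finset.sum_mul, ite_mul, zero_mul]
  rw [Finset.sum_comm]
  simp only [Finset.sum_ite_eq', Finset.mem_univ, if_true]
  -- The factors of the two merging circles are removed by multiplying with them once more, since
  -- values of marks square to one.
  have hprod : ∀ b, ∏ c, markVal (M b c) (χ c) = markVal b (χ A') *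
      ((markVal (m (circ β v (cornerA β l))) (χ A') * markVal (m (circ β v (cornerB β l))) (χ A')) *
        ∏ c, markVal (m c) (χ (mergeMap hne h' c))) := by
    intro b
    have e1 := prod_circles_merge hne h h' fun c => markVal (M b c) (χ c)
    have e2 := prod_mul_of_eq_off_two h (f := fun c => markVal (m c) (χ (mergeMap hne h' c)))
      (g := fun c => markVal (M b (mergeMap hne h' c)) (χ (mergeMap hne h' c))) (by
        intro c h1 h2
        induction c using Quot.ind with
        | mk x =>
          change _ = markVal (M b (circ β v' x)) _
          rw [hMx b x h1 h2])
    have eA : mergeMap hne h' (circ β v (cornerA β l)) = A' := rfl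
    have eB : mergeMap hne h' (circ β v (cornerB β l)) = A' := h'.symm
    simp only [eA, eB, ← hA', hMA] at e1 e2
    rw [e1, markVal_mul_self, mul_one] at e2
    have e3 := markVal_mul_self b (χ A')
    have e4 := markVal_mul_self (m (circ β v (cornerA β l))) (χ A')
    have e5 := markVal_mul_self (m (circ β v (cornerB β l))) (χ A')
    rw [e2]
    generalize ∏ c, markVal (M b c) (χ c) = P at *
    linear_combination (-P) * e3 + (-P) * markVal b (χ A') * markVal b (χ A') * e4 +
      (-P) * markVal b (χ A') * markVal b (χ A') *
        (markVal (m (circ β v (cornerA β l))) (χ A')) ^ 2 * e5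
  simp only [hprod, ← mul_assoc]
  rw [← Finset.sum_mul, ← Finset.sum_mul, ← Finset.sum_mul, sum_mergeCoeff]
  have e4 := markVal_mul_self (m (circ β v (cornerA β l))) (χ A')
  have e5 := markVal_mul_self (m (circ β v (cornerB β l))) (χ A')
  generalize ∏ c, markVal (m c) (χ (mergeMap hne h' c)) = P at *
  linear_combination P * e4 + P * markVal (m (circ β v (cornerA β l))) (χ A') ^ 2 * e5

/-- Here the target marking is free on the two new circles. The product on the right assigns the old
mark to both of them, and the extra `markVal` cancels one of the copies. -/
theorem sum_saddleCoeff_split (hne : ∀ k, k ≠ l → v' k = v k)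
    (h : circ β v (cornerA β l) = circ β v (cornerB β l))
    (h' : circ β v' (cornerA β l) ≠ circ β v' (cornerB β l)) (m : StateCircle β v → Bool)
    (χ : StateCircle β v' → Bool) :
    ∑ m' : StateCircle β v' → Bool, saddleCoeff β l ⟨v, m⟩ ⟨v', m'⟩ * ∏ c, markVal (m' c) (χ c) =
      (sg (χ (circ β v' (cornerA β l))) + sg (χ (circ β v' (cornerB β l)))) *
        (markVal (m (circ β v (cornerA β l))) (χ (circ β v' (cornerB β l))) *
          ∏ c, markVal (m (mergeMap hne h c)) (χ c)) := by
  classical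
  set A' := circ β v' (cornerA β l) with hA'
  set B' := circ β v' (cornerB β l) with hB'
  let M : Bool → Bool → StateCircle β v' → Bool := fun b d c =>
    if c = A' then b else if c = B' then d else m (mergeMap hne h c)
  have hMA : ∀ b d, M b d A' = b := fun b d => if_pos rfl
  have hMB : ∀ b d, M b d B' = d := fun b d => by
    change (if B' = A' then _ else if B' = B' then _ else _) = _
    rw [if_neg h'.symm, if_pos rfl]
  have hMx : ∀ b d c, c ≠ A' → c ≠ B' → M b d c = m (mergeMap hne h c) := fun b d c h1 h2 => by
    change (if c = A' then _ else if c = B' then _ else _) = _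
    rw [if_neg h1, if_neg h2]
  have hiff : ∀ x, (circ β v' x = A' ∨ circ β v' x = B') ↔
      circ β v x = circ β v (cornerA β l) := by
    intro x
    constructor
    · rintro (hx | hx)
      · exact congrArg (mergeMap hne h) hx
      · exact (congrArg (mergeMap hne h) hx).trans h.symm
    · intro hx
      rcases circ_merge_exact hne hx with h3 | ⟨h3, -⟩
      · exact Or.inl h3
      · exact h3
  have hcoeff : ∀ m', saddleCoeff β l ⟨v, m⟩ ⟨v', m'⟩ = ∑ b, ∑ d, if m' = M b d then
      splitCoeff (m (circ β v (cornerA β l))) b d else 0 := by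
    intro m'
    unfold saddleCoeff
    split_ifs with h1 h2
    · exact absurd h h2
    · have hm : m' = M (m' A') (m' B') := by
        funext c
        by_cases h3 : c = A'
        · rw [h3, hMA]
        by_cases h4 : c = B'
        · rw [h4, hMB]
        rw [hMx _ _ _ h3 h4]
        induction c using Quot.ind with
        | mk x =>
          have hx : circ β v x ≠ circ β v (cornerA β l) := fun hx => by
            rcases (hiff x).2 hx with h5 | h5
            · exact h3 h5
            · exact h4 h5
          exact h1 x hx (fun hx' => hx (hx'.trans h.symm))
      rw [Finset.sum_eq_single (m' A'), Finset.sum_eq_single (m' B'), if_pos hm]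
      · intro b _ hb
        rw [if_neg]
        intro hmb
        refine hb ?_
        rw [hmb, hMB]
      · simp
      · intro b _ hb
        refine Finset.sum_eq_zero fun d _ => ?_
        rw [if_neg]
        intro hmb
        refine hb ?_
        rw [hmb, hMA]
      · simp
    · rw [Finset.sum_eq_zero]
      intro b _
      refine Finset.sum_eq_zero fun d _ => ?_
      rw [if_neg]
      rintro rfl
      refine h1 fun x hx _ => hMx b d _ (fun h3 => hx ((hiff x).1 (Or.inl h3)))
        (fun h3 => hx ((hiff x).1 (Or.inr h3)))
  simp only [hcoeff, Finset.sum_mul, ite_mul, zero_mul]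
  rw [Finset.sum_comm]
  have hswap : ∀ b, ∑ m' : StateCircle β v' → Bool, ∑ d, (if m' = M b d then
      splitCoeff (m (circ β v (cornerA β l))) b d * ∏ c, markVal (m' c) (χ c) else 0) =
      ∑ d, splitCoeff (m (circ β v (cornerA β l))) b d * ∏ c, markVal (M b d c) (χ c) := by
    intro b
    rw [Finset.sum_comm]
    simp only [Finset.sum_ite_eq', Finset.mem_univ, if_true]
  simp only [hswap]
  set mA := m (circ β v (cornerA β l)) with hmA
  set P := ∏ c, markVal (m (mergeMap hne h c)) (χ c) with hP
  have e4 := markVal_mul_self mA (χ A')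
  have e5 := markVal_mul_self mA (χ B')
  have hprod : ∀ b d, ∏ c, markVal (M b d c) (χ c) = (markVal b (χ A') * markVal d (χ B')) *
      ((markVal mA (χ A') * markVal mA (χ B')) * P) := by
    intro b d
    have e2 := prod_mul_of_eq_off_two h' (f := fun c => markVal (M b d c) (χ c))
      (g := fun c => markVal (m (mergeMap hne h c)) (χ c)) (by
        intro c h1 h2
        rw [hMx b d c h1 h2])
    have eA : mergeMap hne h A' = circ β v (cornerA β l) := rfl
    have eB : mergeMap hne h B' = circ β v (cornerA β l) := h.symm
    simp only [eA, eB, hMA, hMB, ← hmA, ← hP] at e2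
    generalize ∏ c, markVal (M b d c) (χ c) = Q at *
    linear_combination (markVal mA (χ A') * markVal mA (χ B')) * e2 - Q * e4 -
      Q * markVal mA (χ A') ^ 2 * e5
  simp only [hprod, ← mul_assoc]
  simp only [← Finset.sum_mul]
  have := sum_splitCoeff mA (χ A') (χ B')
  simp only [← mul_assoc] at this
  rw [this]
  linear_combination (markVal mA (χ B') * P * (sg (χ A') + sg (χ B'))) * e4

end

/-! ### Values of the Lee differential at colourings. -/

section
variable {β : BraidWord n} {v v' : Resolution β} {l : Fin β.length}

/-- The value of a chain at a colouring of a resolution. -/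
noncomputable def eval (x : Chain β) (v : Resolution β) (χ : StateCircle β v → Bool) : ℂ :=
  ∑ m : StateCircle β v → Bool, x ⟨v, m⟩ * ∏ c, markVal (m c) (χ c)

/-- The value at a colouring of the image of a chain under the merge or split map to `v'`. -/
noncomputable def saddleEval (x : Chain β) (v v' : Resolution β) (l : Fin β.length)
    (χ : StateCircle β v' → Bool) : ℂ :=
  ∑ m : StateCircle β v → Bool, x ⟨v, m⟩ *
    ∑ m' : StateCircle β v' → Bool, saddleCoeff β l ⟨v, m⟩ ⟨v', m'⟩ * ∏ c, markVal (m' c) (χ c)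

theorem corner_eq_iff (hl : v l ≠ v' l) (hne : ∀ k, k ≠ l → v k = v' k) :
    circ β v (cornerA β l) = circ β v (cornerB β l) ↔
      circ β v' (cornerA β l) ≠ circ β v' (cornerB β l) := by
  by_cases h : Braidlike β v l
  · refine circ_corner_eq_iff h (fun h' => hl ?_) hne
    exact h.trans h'.symm
  · have h' : Braidlike β v' l := by
      unfold Braidlike at h ⊢
      revert h hl
      cases v l <;> cases v' l <;> cases (β.get l).2 <;> simp
    have := circ_corner_eq_iff h' h fun k hk => (hne k hk).symm
    rw [Ne, this, not_not]

/-- A merge keeps the value and removes one inverse factor `rt` from the normalization. A split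
multiplies the value by `2 * sg = rt * rt` and adds one such factor. In both cases one factor `rt`
remains. -/
theorem saddleEval_eq (hl : v l ≠ v' l) (hne : ∀ k, k ≠ l → v k = v' k) (x : Chain β)
    {χ : StateCircle β v → Bool} {χ' : StateCircle β v' → Bool}
    (h : ∀ y, χ (circ β v y) = χ' (circ β v' y)) :
    (∏ c, (rt (χ' c))⁻¹) * saddleEval x v v' l χ' =
      rt (χ' (circ β v' (cornerA β l))) * ((∏ c, (rt (χ c))⁻¹) * eval x v χ) := by
  by_cases hA : circ β v (cornerA β l) = circ β v (cornerB β l)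
  · have hA' := (corner_eq_iff hl hne).1 hA
    have hne' : ∀ k, k ≠ l → v' k = v k := fun k hk => (hne k hk).symm
    have hχ : ∀ c, χ' c = χ (mergeMap hne' hA c) := fun c => by
      induction c using Quot.ind with
      | mk y => exact (h y).symm
    have hE : saddleEval x v v' l χ' = 2 * sg (χ' (circ β v' (cornerA β l))) * eval x v χ := by
      rw [saddleEval, eval, Finset.mul_sum]
      refine Finset.sum_congr rfl fun m _ => ?_
      rw [sum_saddleCoeff_split hne' hA hA']
      simp only [hχ]
      rw [prod_circles_merge hne' hA' hA fun c => markVal (m c) (χ c)]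
      have e1 : mergeMap hne' hA (circ β v' (cornerA β l)) = circ β v (cornerA β l) := rfl
      have e2 : mergeMap hne' hA (circ β v' (cornerB β l)) = circ β v (cornerA β l) := hA.symm
      rw [e1, e2]
      have := markVal_mul_self (m (circ β v (cornerA β l))) (χ (circ β v (cornerA β l)))
      linear_combination (2 * sg (χ (circ β v (cornerA β l))) * x ⟨v, m⟩ *
        ∏ c, markVal (m c) (χ c)) * this
    have hW : ∏ c, (rt (χ' c))⁻¹ =
        (rt (χ' (circ β v' (cornerA β l))))⁻¹ * ∏ c, (rt (χ c))⁻¹ := by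
      rw [← h, ← prod_circles_merge hne' hA' hA fun c => (rt (χ c))⁻¹]
      exact Finset.prod_congr rfl fun c _ => by rw [hχ]
    rw [hE, hW, ← rt_mul_self]
    field_simp [rt_ne_zero]
  · have hA' : circ β v' (cornerA β l) = circ β v' (cornerB β l) := by
      by_contra hc
      exact hA ((corner_eq_iff hl hne).2 hc)
    have hχ : ∀ c, χ c = χ' (mergeMap hne hA' c) := fun c => by
      induction c using Quot.ind with
      | mk y => exact h y
    have hE : saddleEval x v v' l χ' = eval x v χ := by
      rw [saddleEval, eval]
      refine Finset.sum_congr rfl fun m _ => ?_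
      rw [sum_saddleCoeff_merge hne hA hA']
      simp only [hχ]
    have hW := prod_circles_merge hne hA hA' fun c => (rt (χ' c))⁻¹
    simp only [← hχ] at hW
    rw [hE, hW, ← mul_assoc, ← mul_assoc, mul_inv_cancel₀ (rt_ne_zero _), one_mul]

/-- Corners of different colours lie on different circles, so the saddle is a split, and the two
signs add up to zero. -/
theorem saddleEval_eq_zero (hl : v l ≠ v' l) (hne : ∀ k, k ≠ l → v k = v' k) (x : Chain β)
    {χ' : StateCircle β v' → Bool}
    (h : χ' (circ β v' (cornerA β l)) ≠ χ' (circ β v' (cornerB β l))) :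
    saddleEval x v v' l χ' = 0 := by
  have hA' : circ β v' (cornerA β l) ≠ circ β v' (cornerB β l) := fun hc => h (by rw [hc])
  have hA := (corner_eq_iff hl hne).2 hA'
  rw [saddleEval]
  refine Finset.sum_eq_zero fun m _ => ?_
  rw [sum_saddleCoeff_split (fun k hk => (hne k hk).symm) hA hA', sg_add_sg, if_neg h]
  simp

theorem leeD_apply (x : Chain β) (T : EnhancedState β) :
    leeD β x T = ∑ S, x S * leeCoeff β S T := by
  rw [leeD, Finsupp.linearCombination_apply, Finsupp.sum_fintype _ _ (by simp)]
  simp [Finsupp.finsetSum_apply]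

theorem edgeSign_update (v : Resolution β) (l : Fin β.length) (b : Bool) :
    edgeSign β (Function.update v l b) l = edgeSign β v l := by
  unfold edgeSign
  congr 2
  refine Finset.filter_congr fun k _ => and_congr_right fun hk => ?_
  rw [Function.update_of_ne hk.ne]

theorem eval_leeD (x : Chain β) (χ : StateCircle β v' → Bool) :
    eval (leeD β x) v' χ = ∑ l, if v' l = true then
      edgeSign β v' l * saddleEval x (Function.update v' l false) v' l χ else 0 := by
  have h1 : ∀ m', leeD β x ⟨v', m'⟩ = ∑ l, if v' l = true then edgeSign β v' l *
      ∑ m, x ⟨Function.update v' l false, m⟩ *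
        saddleCoeff β l ⟨Function.update v' l false, m⟩ ⟨v', m'⟩ else 0 := by
    intro m'
    rw [leeD_apply]
    simp only [leeCoeff, Finset.mul_sum]
    rw [Finset.sum_comm]
    refine Finset.sum_congr rfl fun l _ => ?_
    rw [Fintype.sum_sigma]
    split_ifs with hl
    · rw [Finset.sum_eq_single (Function.update v' l false)]
      · refine Finset.sum_congr rfl fun m _ => ?_
        rw [if_pos ⟨by simp, by rw [Function.update_idem, ← hl, Function.update_eq_self]⟩,
          edgeSign_update]
        ring
      · intro v _ hv
        refine Finset.sum_eq_zero fun m _ => ?_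
        rw [if_neg, mul_zero]
        rintro ⟨h1, h2⟩
        simp only at h1 h2
        rw [h2, Function.update_idem, ← h1, Function.update_eq_self] at hv
        exact hv rfl
      · simp
    · refine Finset.sum_eq_zero fun v _ => Finset.sum_eq_zero fun m _ => ?_
      rw [if_neg, mul_zero]
      rintro ⟨h1, h2⟩
      simp only at h1 h2
      exact hl (by rw [h2, Function.update_self])
  simp only [eval, h1, Finset.sum_mul]
  rw [Finset.sum_comm]
  refine Finset.sum_congr rfl fun l _ => ?_
  split_ifs with hl
  · simp only [saddleEval, Finset.mul_sum, Finset.sum_mul]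
    rw [Finset.sum_comm]
    refine Finset.sum_congr rfl fun m _ => Finset.sum_congr rfl fun m' _ => ?_
    ring
  · simp

end

/-! ### The differential along a path. -/

/-- The contribution of one crossing to the differential, without sign. -/
noncomputable def localD : BraidWord n → Row n → (Path → ℂ) → Path → ℕ → ℂ
  | a :: _, r, Y, none :: π, 0 =>
      if a.2 = false ∧ IsFlat a.1 r then rt (r (leftPos a.1)) * Y (some (r (leftPos a.1)) :: π)
        else 0
  | a :: _, r, Y, some c :: π, 0 =>
      if a.2 = true ∧ c = r (leftPos a.1) then rt c * Y (none :: π) else 0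
  | _ :: β, r, Y, none :: π, l + 1 => localD β r (fun ρ => Y (none :: ρ)) π l
  | a :: β, r, Y, some c :: π, l + 1 => localD β (recolor a.1 c r) (fun ρ => Y (some c :: ρ)) π l
  | [], _, _, _, _ => 0
  | _ :: _, _, _, [], _ => 0

theorem localD_append {α γ : BraidWord n} {a : Fin (n - 1) × Bool} {r : Row n} {Y : Path → ℂ}
    {πα πγ : Path} {o : Option Bool} (hα : πα.length = α.length) :
    localD (α ++ a :: γ) r Y (πα ++ o :: πγ) α.length =
      localD (a :: γ) (finalRow α r πα) (fun ρ => Y (πα ++ ρ)) (o :: πγ) 0 := by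
  induction α generalizing r Y πα with
  | nil => simp at hα; subst hα; simp [finalRow]
  | cons b α ih =>
    rcases πα with _ | ⟨_ | c, πα⟩
    · simp at hα
    · exact ih (by simpa using hα)
    · exact ih (by simpa using hα)

theorem edgeSign_eq_prod (β : BraidWord n) (v : Resolution β) (l : Fin β.length) :
    edgeSign β v l = ∏ k, if k < l ∧ v k = true then -1 else 1 := by
  rw [edgeSign, ← Finset.prod_const, Finset.prod_filter]

/-- The signs with which the recursion passes the earlier crossings multiply to the edge sign. -/
theorem colD_eq_sum {β : BraidWord n} {r : Row n} {Y : Path → ℂ} {π : Path}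
    (h : π.length = β.length) :
    colD β r Y π = ∑ l, edgeSign β (shapeRes β (shape π)) l * localD β r Y π l := by
  induction β generalizing r Y π with
  | nil => simp [colD]
  | cons a β ih =>
    rcases π with _ | ⟨o, π⟩
    · simp at h
    · have hlen : π.length = β.length := by simpa using h
      have hs : ∀ l : Fin β.length,
          edgeSign (a :: β) (shapeRes (a :: β) (shape (o :: π))) l.succ =
            passSign a.2 o * edgeSign β (shapeRes β (shape π)) l := by
        intro l
        rw [edgeSign_eq_prod, edgeSign_eq_prod]
        refine (Fin.prod_univ_succ (n := β.length) _).trans ?_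
        congr 1
        · simp [passSign, shapeRes]
        · refine Finset.prod_congr rfl fun k _ => ?_
          simp [shapeRes]
      have h0 : edgeSign (a :: β) (shapeRes (a :: β) (shape (o :: π)))
          (0 : Fin (β.length + 1)) = 1 := by
        rw [edgeSign_eq_prod]
        refine Finset.prod_eq_one fun k _ => ?_
        rw [if_neg]
        rintro ⟨hk, -⟩
        exact absurd hk (Fin.not_lt_zero _)
      have : ∑ l, edgeSign (a :: β) (shapeRes (a :: β) (shape (o :: π))) l *
          localD (a :: β) r Y (o :: π) l = localD (a :: β) r Y (o :: π) 0 +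
          ∑ l : Fin β.length, passSign a.2 o * (edgeSign β (shapeRes β (shape π)) l *
            localD (a :: β) r Y (o :: π) (l.val + 1)) := by
        refine (Fin.sum_univ_succ (n := β.length) _).trans ?_
        rw [h0, one_mul]
        congr 1
        refine Finset.sum_congr rfl fun l _ => ?_
        rw [hs, mul_assoc]
        rfl
      rw [this, ← Finset.mul_sum]
      rcases o with _ | c
      · simp only [colD, localD, ih hlen]
      · simp only [colD, localD, ih hlen]

open Classical in
/-- The function on the closed paths that a chain defines. -/
noncomputable def toFun {β : BraidWord n} (x : Chain β) (r : Row n) (π : Path) : ℂ :=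
  if h : IsClosedPath β r π then
    weight β r π * eval x (shapeRes β (shape π)) (circColor h) else 0

theorem toFun_eq {β : BraidWord n} (x : Chain β) {r : Row n} {π : Path} (h : IsClosedPath β r π)
    {v : Resolution β} (hv : shapeRes β (shape π) = v) {χ : StateCircle β v → Bool}
    (hχ : ∀ y, χ (circ β v y) = nodeColor β r π y) :
    toFun x r π = weight β r π * eval x v χ := by
  subst hv
  have : circColor h = χ := by
    funext c
    induction c using Quot.ind with
    | mk y => exact (hχ y).symm
  rw [toFun, dif_pos h, this]

theorem shapeRes_at {α γ : BraidWord n} {a : Fin (n - 1) × Bool} {eα eγ : List Bool} {x : Bool}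
    (hα : eα.length = α.length) (l : Fin (α ++ a :: γ).length) (hl : l.val = α.length) :
    shapeRes (α ++ a :: γ) (eα ++ x :: eγ) l = (x == a.2) := by
  unfold shapeRes
  simp [hl, ← hα]

theorem shapeRes_update {α γ : BraidWord n} {a : Fin (n - 1) × Bool} {eα eγ : List Bool}
    (x y : Bool)
    (hα : eα.length = α.length) (l : Fin (α ++ a :: γ).length) (hl : l.val = α.length) :
    shapeRes (α ++ a :: γ) (eα ++ y :: eγ) =
      Function.update (shapeRes (α ++ a :: γ) (eα ++ x :: eγ)) l (y == a.2) := by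
  funext k
  by_cases hk : k = l
  · subst hk
    rw [Function.update_self, shapeRes_at hα k hl]
  · rw [Function.update_of_ne hk]
    have := (shapeRes_none_some (a := a) (γ := γ) (eγ := eγ) hα l hl).2 k hk
    cases x <;> cases y
    · rfl
    · exact this.symm
    · exact this
    · rfl

theorem weight_mul_saddleEval {β : BraidWord n} (x : Chain β) {r : Row n} {π π' : Path}
    (h : IsClosedPath β r π) (h' : IsClosedPath β r π') (hrow : rowAt β r π = rowAt β r π')
    {v' : Resolution β} {l : Fin β.length} (hl : v' l = true) (hv' : shapeRes β (shape π') = v')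
    (hv : shapeRes β (shape π) = Function.update v' l false) {χ' : StateCircle β v' → Bool}
    (hχ' : ∀ y, χ' (circ β v' y) = nodeColor β r π' y) :
    weight β r π' * saddleEval x (Function.update v' l false) v' l χ' =
      rt (χ' (circ β v' (cornerA β l))) * toFun x r π := by
  obtain ⟨χ, hχ⟩ := h.exists_col hv
  rw [toFun_eq x h hv hχ, weight_eq_prod h hv χ hχ, weight_eq_prod h' hv' χ' hχ']
  refine saddleEval_eq ?_ (fun k hk => Function.update_of_ne hk _ _) x fun y => ?_
  · rw [Function.update_self, hl]; simp
  · rw [hχ, hχ', nodeColor, nodeColor, hrow]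

/-- Both sides are sums over the crossings with the same edge signs. At each crossing the normalized
saddle multiplies by `rt` of the common colour, or vanishes when the colours disagree. -/
theorem toFun_leeD {β : BraidWord n} (x : Chain β) {r : Row n} {π : Path}
    (h : IsClosedPath β r π) : toFun (leeD β x) r π = colD β r (toFun x r) π := by
  obtain ⟨v', hv'⟩ : ∃ v', shapeRes β (shape π) = v' := ⟨_, rfl⟩
  obtain ⟨χ', hχ'⟩ := h.exists_col hv'
  rw [toFun_eq _ h hv' hχ', eval_leeD, colD_eq_sum h.1.length_eq, Finset.mul_sum, hv']
  refine Finset.sum_congr rfl fun l _ => ?_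
  obtain ⟨α, a, γ, rfl, hl⟩ : ∃ α a γ, β = α ++ a :: γ ∧ l.val = α.length :=
    ⟨β.take l, β.get l, β.drop (l + 1), by simp, by simp⟩
  obtain ⟨πα, o, πγ, rfl, hα⟩ : ∃ πα o πγ, π = πα ++ o :: πγ ∧ πα.length = α.length := by
    have hlt : l.val < π.length := by rw [h.1.length_eq]; exact l.2
    exact ⟨π.take l, π.get ⟨l, hlt⟩, π.drop (l + 1), by simp, by rw [List.length_take]; omega⟩
  have hα' : (shape πα).length = α.length := by simpa
  have hget : (α ++ a :: γ).get l = a := by simp [hl]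
  have hA : χ' (circ _ _ (cornerA _ l)) = finalRow α r πα (leftPos a.1) := by
    rw [hχ', nodeColor, cornerA, hget]
    simp only [Fin.val_castSucc, hl]
    rw [rowAt_corner hα]
  rw [hl, localD_append hα]
  have hsh : ∀ o : Option Bool, shape (πα ++ o :: πγ) = shape πα ++ o.isSome :: shape πγ := by simp
  have hvl : v' l = (o.isSome == a.2) := by rw [← hv', hsh, shapeRes_at hα' l hl]
  have hupd : ∀ o' : Option Bool, shapeRes (α ++ a :: γ) (shape (πα ++ o' :: πγ)) =
      Function.update v' l (o'.isSome == a.2) := by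
    intro o'
    rw [← hv', hsh, hsh]
    exact shapeRes_update _ _ hα' l hl
  have hzero : v' l = true → χ' (circ _ _ (cornerA _ l)) ≠ χ' (circ _ _ (cornerB _ l)) →
      saddleEval x (Function.update v' l false) v' l χ' = 0 := by
    intro hvt hne
    refine saddleEval_eq_zero ?_ (fun k hk => Function.update_of_ne hk _ _) x hne
    rw [Function.update_self, hvt]; simp
  rcases o with _ | c
  · have hB : χ' (circ _ _ (cornerB _ l)) = finalRow α r πα (rightPos a.1) := by
      rw [hχ', nodeColor, cornerB, hget]
      simp only [Fin.val_succ, hl]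
      rw [rowAt_corner_none hα]
    rcases ha : a.2 with _ | _
    · have hvt : v' l = true := by rw [hvl, ha]; rfl
      rw [if_pos hvt, mul_left_comm]
      congr 1
      -- Equal colours at the crossing give the path on the other side of the saddle; unequal ones
      -- make both sides zero.
      by_cases hf : IsFlat a.1 (finalRow α r πα)
      · rw [localD, if_pos ⟨ha, hf⟩, weight_mul_saddleEval x
          ((isClosedPath_none_iff_some hα hf).2 h) h (rowAt_saddle_eq hα hf) hvt hv'
          (by rw [hupd, ha]; rfl) hχ', hA]
      · rw [localD, if_neg (fun hc => hf hc.2), hzero hvt (by rw [hA, hB]; exact hf), mul_zero]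
    · have hvt : v' l = false := by rw [hvl, ha]; rfl
      simp [localD, ha, hvt]
  · have hB : χ' (circ _ _ (cornerB _ l)) = c := by
      rw [hχ', nodeColor, cornerB, hget]
      simp only [Fin.val_succ, hl]
      rw [rowAt_corner_some hα, recolor_right]
    have hf := h.isFlat hα
    rcases ha : a.2 with _ | _
    · have hvt : v' l = false := by rw [hvl, ha]; rfl
      simp [localD, ha, hvt]
    · have hvt : v' l = true := by rw [hvl, ha]; rfl
      rw [if_pos hvt, mul_left_comm]
      congr 1
      by_cases hc : c = finalRow α r πα (leftPos a.1)
      · rw [localD, if_pos ⟨ha, hc⟩]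
        have hcl := h
        have hrow := rowAt_saddle_eq (γ := γ) (πγ := πγ) hα hf
        rw [← hc] at hrow
        rw [hc] at hcl
        rw [weight_mul_saddleEval x ((isClosedPath_none_iff_some hα hf).1 hcl) h hrow.symm hvt hv'
          (by rw [hupd, ha]; rfl) hχ', hA, ← hc]
      · rw [localD, if_neg (fun h => hc h.2), hzero hvt (by rw [hA, hB]; exact Ne.symm hc),
          mul_zero]

/-! ### A chain is determined by its values at colourings. -/

section
variable {β : BraidWord n} {v v' : Resolution β}

theorem eval_add (x y : Chain β) (χ : StateCircle β v → Bool) :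
    eval (x + y) v χ = eval x v χ + eval y v χ := by
  simp [eval, add_mul, Finset.sum_add_distrib]

theorem eval_smul (k : ℂ) (x : Chain β) (χ : StateCircle β v → Bool) :
    eval (k • x) v χ = k * eval x v χ := by
  simp [eval, Finset.mul_sum, mul_assoc]

theorem toFun_add (x y : Chain β) (r : Row n) (π : Path) :
    toFun (x + y) r π = toFun x r π + toFun y r π := by
  unfold toFun
  split_ifs
  · rw [eval_add]; ring
  · simp

theorem toFun_smul (k : ℂ) (x : Chain β) (r : Row n) (π : Path) :
    toFun (k • x) r π = k * toFun x r π := by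
  unfold toFun
  split_ifs
  · rw [eval_smul]; ring
  · simp

theorem toFun_zero (r : Row n) (π : Path) : toFun (0 : Chain β) r π = 0 := by
  simpa using toFun_smul 0 (0 : Chain β) r π

theorem sum_markVal (m m' : Bool) : ∑ c, markVal m c * markVal m' c = if m = m' then 2 else 0 := by
  cases m <;> cases m' <;> simp [markVal, sg] <;> norm_num

theorem sum_prod_circles {M : Type*} [CommSemiring M] (g : StateCircle β v → Bool → M) :
    ∑ m : StateCircle β v → Bool, ∏ c, g c (m c) = ∏ c, ∑ b, g c b := by
  rw [Finset.prod_univ_sum, Fintype.piFinset_univ]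

/-- As functions of the colouring, the products of values of marks are the characters of a power of
the group of order two. Their orthogonality recovers each coefficient from the values. -/
theorem eq_zero_of_toFun_eq_zero {x : Chain β}
    (h : ∀ r π, IsClosedPath β r π → toFun x r π = 0) : x = 0 := by
  ext ⟨v, m⟩
  have h0 : ∀ χ : StateCircle β v → Bool, eval x v χ = 0 := by
    intro χ
    obtain ⟨h1, h2⟩ := pathOf_spec χ
    have h3 := h _ _ h1
    rw [toFun_eq x h1 (shapeRes_pathOf χ) fun y => (h2 y).symm] at h3
    exact (mul_eq_zero.1 h3).resolve_left (weight_ne_zero _ _ _)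
  have h1 : ∑ χ : StateCircle β v → Bool, eval x v χ * ∏ c, markVal (m c) (χ c) =
      x ⟨v, m⟩ * 2 ^ Fintype.card (StateCircle β v) := by
    simp only [eval, Finset.sum_mul]
    rw [Finset.sum_comm, Finset.sum_eq_single m]
    · simp only [mul_assoc, ← Finset.prod_mul_distrib, ← Finset.mul_sum]
      rw [sum_prod_circles fun c b => markVal (m c) b * markVal (m c) b]
      simp only [sum_markVal, if_true, Finset.prod_const, Finset.card_univ]
    · intro m' _ hm'
      obtain ⟨c, hc⟩ := Function.ne_iff.1 hm'
      simp only [mul_assoc, ← Finset.prod_mul_distrib, ← Finset.mul_sum]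
      rw [sum_prod_circles fun c b => markVal (m' c) b * markVal (m c) b,
        Finset.prod_eq_zero (Finset.mem_univ c), mul_zero]
      rw [sum_markVal, if_neg hc]
    · simp
  simp only [h0, zero_mul, Finset.sum_const_zero] at h1
  simpa using h1.symm

end

/-! The canonical generator. -/

theorem shapeRes_replicate (β : BraidWord n) :
    shapeRes β (List.replicate β.length false) = orientedRes β := by
  funext l
  have : (List.replicate β.length false).getD l.val false = false := by simp
  unfold shapeRes orientedRes
  rw [this]
  cases (β.get l).2 <;> rfl

theorem braidlike_orientedRes (β : BraidWord n) (l : Fin β.length) :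
    Braidlike β (orientedRes β) l := rfl

theorem circ_orientedRes (β : BraidWord n) (x : Node β) :
    circ β (orientedRes β) x = circ β (orientedRes β) (x.1, 0) := by
  obtain ⟨p, s⟩ := x
  induction s using Fin.induction with
  | zero => rfl
  | succ l ih =>
    rw [← ih]
    by_cases h1 : p = leftPos (β.get l).1
    · subst h1; exact (Quot.sound (Arc.left l (braidlike_orientedRes β l))).symm
    by_cases h2 : p = rightPos (β.get l).1
    · subst h2; exact (Quot.sound (Arc.right l (braidlike_orientedRes β l))).symm
    exact (Quot.sound (Arc.pass l p h1 h2)).symm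

/-- The circles of the oriented resolution. -/
noncomputable def orientedCircles (β : BraidWord n) : Fin n ≃ StateCircle β (orientedRes β) where
  toFun p := circ β (orientedRes β) (p, 0)
  invFun := Quot.lift Prod.fst fun x y h => by
    cases h with
    | closing p => rfl
    | pass l p _ _ => rfl
    | left l _ => rfl
    | right l _ => rfl
    | lower l h => exact absurd (braidlike_orientedRes β l) h
    | upper l h => exact absurd (braidlike_orientedRes β l) h
  left_inv _ := rfl
  right_inv c := by
    induction c using Quot.ind with
    | mk x => exact (circ_orientedRes β x).symm

/-- The labels `v₋ ± v₊` are multiples of the two idempotents: each vanishes at one colour. The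
surviving colour is `false` for `𝐛`, which is why `altRow` is `false` outermost. -/
theorem sum_canonicalCoeff (p : Fin n) (c : Bool) :
    ∑ b, canonicalCoeff p b * markVal b c =
      if c = altRow n p then 2 * (if Even (n - 1 - p.val) then -1 else 1) else 0 := by
  by_cases h : Even (n - 1 - p.val) <;> cases c <;>
    simp [canonicalCoeff, markVal, sg, altRow, h] <;> norm_num

theorem canonicalGen_apply (β : BraidWord n) (S : EnhancedState β) : canonicalGen β S =
    if S.1 = orientedRes β then ∏ p : Fin n, canonicalCoeff p (S.2 (circ β S.1 (p, 0))) else 0 := by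
  classical
  rw [canonicalGen, Finsupp.equivFunOnFinite_symm_apply_apply]

theorem eval_canonicalGen {β : BraidWord n} (χ : StateCircle β (orientedRes β) → Bool) :
    eval (canonicalGen β) (orientedRes β) χ =
      if rowOf χ = altRow n then ∏ p : Fin n, 2 * (if Even (n - 1 - p.val) then -1 else 1)
      else 0 := by
  have h1 : ∀ m : StateCircle β (orientedRes β) → Bool, canonicalGen β ⟨orientedRes β, m⟩ =
      ∏ c, canonicalCoeff ((orientedCircles β).symm c) (m c) := by
    intro m
    rw [← (orientedCircles β).prod_comp, canonicalGen_apply, if_pos rfl]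
    simp only [Equiv.symm_apply_apply]
    rfl
  simp only [eval, h1, ← Finset.prod_mul_distrib]
  rw [sum_prod_circles fun c b => canonicalCoeff ((orientedCircles β).symm c) b * markVal b (χ c),
    ← (orientedCircles β).prod_comp]
  simp only [Equiv.symm_apply_apply, sum_canonicalCoeff]
  split_ifs with h
  · exact Finset.prod_congr rfl fun p _ => if_pos (congrFun h p)
  · obtain ⟨p, hp⟩ := Function.ne_iff.1 h
    exact Finset.prod_eq_zero (Finset.mem_univ p) (if_neg hp)

theorem toFun_canonicalGen (β : BraidWord n) : ∃ k : ℂ, k ≠ 0 ∧ ∀ r π, IsClosedPath β r π →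
    toFun (canonicalGen β) r π = k * altState r π := by
  refine ⟨weight β (altRow n) (List.replicate β.length none) *
    ∏ p : Fin n, 2 * (if Even (n - 1 - p.val) then -1 else 1), mul_ne_zero (weight_ne_zero _ _ _)
      (Finset.prod_ne_zero_iff.2 fun p _ => by split_ifs <;> norm_num), fun r π h => ?_⟩
  have hlen := h.1.length_eq
  by_cases hπ : ∀ o ∈ π, o = none
  · have hrep : π = List.replicate β.length none := by
      rw [← hlen]; exact List.eq_replicate_of_mem hπ
    have hv : shapeRes β (shape π) = orientedRes β := by
      rw [← shapeRes_replicate, hrep]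
      simp [shape]
    obtain ⟨χ, hχ⟩ := h.exists_col hv
    have hrow : rowOf χ = r := by
      funext p
      rw [rowOf, hχ, nodeColor]
      simp
    rw [toFun_eq _ h hv hχ, eval_canonicalGen, hrow, altState]
    by_cases hr : r = altRow n
    · rw [if_pos hr, if_pos ⟨hr, hπ⟩, mul_one, hr, hrep]
    · rw [if_neg hr, if_neg fun h => hr h.1, mul_zero, mul_zero]
  · have hv : shapeRes β (shape π) ≠ orientedRes β := by
      rw [← shapeRes_replicate]
      intro hc
      have := shapeRes_injective (by simpa) (by simp) hc
      refine hπ fun o ho => ?_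
      have h2 : o.isSome ∈ shape π := List.mem_map_of_mem ho
      rw [this] at h2
      have := List.eq_of_mem_replicate h2
      simpa using this
    rw [altState, if_neg fun h => hπ h.2, mul_zero, toFun, dif_pos h, eval,
      Finset.sum_eq_zero, mul_zero]
    intro m _
    rw [canonicalGen_apply, if_neg hv, zero_mul]

theorem colD_altRow (β : BraidWord n) (Y : Path → ℂ) :
    colD β (altRow n) Y (List.replicate β.length none) = 0 := by
  induction β generalizing Y with
  | nil => rfl
  | cons a β ih => simp [List.replicate_succ, colD, ih, not_isFlat_altRow]

/-- The differential preserves the initial row. It vanishes at the alternating row, and the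
generator vanishes at all others. -/
theorem leeD_canonicalGen (β : BraidWord n) : leeD β (canonicalGen β) = 0 := by
  obtain ⟨k, -, hk⟩ := toFun_canonicalGen β
  refine eq_zero_of_toFun_eq_zero fun r π h => ?_
  rw [toFun_leeD _ h]
  by_cases hr : r = altRow n
  · subst hr
    rw [valid_altRow h.1, colD_altRow]
  · have : toFun (canonicalGen β) r = fun _ => 0 := by
      funext ρ
      by_cases hρ : IsClosedPath β r ρ
      · rw [hk _ _ hρ, altState, if_neg fun h => hr h.1, mul_zero]
      · rw [toFun, dif_neg hρ]
    rw [this, colD_zero]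

theorem isClosedPath_altRow (β : BraidWord n) :
    IsClosedPath β (altRow n) (List.replicate β.length none) := by
  refine ⟨?_, finalRow_of_forall_none fun o ho => List.eq_of_mem_replicate ho⟩
  induction β with
  | nil => trivial
  | cons a β ih => exact ih

/-- Every boundary vanishes at the alternating path, where no saddle arrives, while the generator
does not. -/
theorem canonicalGen_notMem_range (β : BraidWord n) :
    canonicalGen β ∉ LinearMap.range (leeD β) := by
  rintro ⟨y, hy⟩
  obtain ⟨k, hk0, hk⟩ := toFun_canonicalGen β
  have h := isClosedPath_altRow β
  have h1 := hk _ _ h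
  rw [← hy, toFun_leeD _ h, colD_altRow, altState_valid h.1, mul_one] at h1
  exact hk0 h1.symm

/-! The filtration by the gradings. -/

theorem height_eq_sum (β : BraidWord n) (v : Resolution β) :
    height β v = ∑ l, if v l = true then 1 else 0 := by
  rw [height, Finset.card_filter]

theorem shift_eq {β : BraidWord n} {e : List Bool} (h : e.length = β.length) :
    shift β e = height β (shapeRes β e) + nPos β - 2 * nNeg β := by
  rw [height_eq_sum]
  induction β generalizing e with
  | nil => simp [shift, nPos, nNeg]
  | cons a β ih =>
    rcases e with _ | ⟨x, e⟩
    · simp at h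
    · have hs : (∑ l, if shapeRes (a :: β) (x :: e) l = true then 1 else 0) =
          (if (x == a.2) = true then 1 else 0) +
            ∑ l, if shapeRes β e l = true then 1 else 0 := by
        refine (Fin.sum_univ_succ (n := β.length) _).trans ?_
        rfl
      rw [shift, ih (e := e) (by simpa using h), hs]
      obtain ⟨i, s⟩ := a
      cases s <;> cases x <;> simp [letterShift, nPos, nNeg] <;> ring

section
variable {β : BraidWord n} {v : Resolution β}

theorem sum_markSign (m : StateCircle β v → Bool) : ∑ c, markSign (m c) =
    (Fintype.card (StateCircle β v) : ℤ) - 2 * (Finset.univ.filter fun c => m c = false).card := by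
  rw [Finset.card_filter, ← Finset.card_univ, Finset.card_eq_sum_ones]
  push_cast
  rw [Finset.mul_sum, ← Finset.sum_sub_distrib]
  refine Finset.sum_congr rfl fun c _ => ?_
  cases m c <;> simp [markSign]

/-- The value of a marking is the monomial in the signs of the circles marked `v₋`. The number of
circles minus twice its degree is the number of `v₊` minus the number of `v₋`. -/
theorem filtAt_marks {e : List Bool} (he : e.length = β.length) (hv : shapeRes β e = v)
    (m : StateCircle β v → Bool) {b : ℝ} (hb : -((∑ c, markSign (m c) : ℤ) : ℝ) ≤ b)
    {Y : Row n → Path → ℂ}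
    (hY : ∀ r π (χ : StateCircle β v → Bool), shape π = e → IsClosedPath β r π →
      (∀ y, χ (circ β v y) = nodeColor β r π y) →
      Y r π = weight β r π * ∏ c, markVal (m c) (χ c)) : FiltAt β e b Y := by
  let q : List (ℕ × Fin n) := (Finset.univ.filter fun c => m c = false).toList.map
    fun c : StateCircle β v => ((Quot.out c).2.val, (Quot.out c).1)
  have hq : q.length = (Finset.univ.filter fun c => m c = false).card := by simp [q]
  refine ⟨mon q, mon_mem_polySpace ?_, fun r π h1 h2 => ?_⟩
  · have := sum_markSign m
    have h3 : ((∑ c, markSign (m c) : ℤ) : ℝ) = (Fintype.card (StateCircle β v) : ℝ) -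
        2 * (q.length : ℝ) := by rw [this, hq]; push_cast; ring
    have h4 : numCircles β e = Fintype.card (StateCircle β v) := by rw [numCircles_eq he, hv]
    rw [h4]
    linarith
  · obtain ⟨χ, hχ⟩ := h2.exists_col (v := v) (by rw [h1, hv])
    rw [hY r π χ h1 h2 hχ]
    congr 1
    have h3 : ∀ c : StateCircle β v, sg (rowAt β r π (Quot.out c).2.val (Quot.out c).1) =
        sg (χ c) := by
      intro c
      have := hχ (Quot.out c)
      rw [circ, Quot.out_eq] at this
      rw [this]; rfl
    simp only [mon, q, List.map_map, Function.comp_def, h3]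
    rw [Finset.prod_map_toList, Finset.prod_filter]
    refine Finset.prod_congr rfl fun c _ => ?_
    cases m c <;> simp [markVal]

end

theorem eval_single {β : BraidWord n} (S : EnhancedState β) (χ : StateCircle β S.1 → Bool) :
    eval (Finsupp.single S 1) S.1 χ = ∏ c, markVal (S.2 c) (χ c) := by
  obtain ⟨v, m⟩ := S
  rw [eval, Finset.sum_eq_single m]
  · simp
  · intro m' _ hm
    rw [Finsupp.single_eq_of_ne, zero_mul]
    intro h
    simp only [Sigma.mk.injEq, heq_eq_eq, true_and] at h
    exact hm h
  · simp

theorem eval_single_of_ne {β : BraidWord n} {S : EnhancedState β} {v : Resolution β} (h : v ≠ S.1)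
    (χ : StateCircle β v → Bool) : eval (Finsupp.single S 1) v χ = 0 := by
  refine Finset.sum_eq_zero fun m _ => ?_
  rw [Finsupp.single_eq_of_ne, zero_mul]
  rintro rfl
  exact h rfl

/-- The multiplier `ε` on rows turns the marking of `S` into the marking `m`, which then determines
the grading. It is used with `ε = 1` and with the product of all signs. -/
theorem filt_single {β : BraidWord n} (S : EnhancedState β) (m : StateCircle β S.1 → Bool)
    (ε : Row n → ℂ)
    (hε : ∀ χ : StateCircle β S.1 → Bool, ε (rowOf χ) * ∏ c, markVal (S.2 c) (χ c) =
      ∏ c, markVal (m c) (χ c)) {b : ℝ}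
    (hb : b ≤ ((∑ c, markSign (m c) : ℤ) : ℝ) + height β S.1 + nPos β - 2 * nNeg β) :
    Filt β b fun r π => ε r * toFun (Finsupp.single S 1) r π := by
  intro e he
  by_cases hv : shapeRes β e = S.1
  · refine filtAt_marks he hv m ?_ fun r π χ h1 h2 hχ => ?_
    · rw [shift_eq he, hv]
      linarith
    · rw [toFun_eq _ h2 (by rw [h1, hv]) hχ, eval_single, ← hε]
      have : rowOf χ = r := by
        funext p
        rw [rowOf, hχ, nodeColor]
        simp
      rw [this]
      ring
  · refine (filtAt_zero β e _).congr fun r π h1 h2 => ?_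
    rw [toFun, dif_pos h2, eval_single_of_ne (by rw [h1]; exact hv), mul_zero, mul_zero]

/-! ### From the `j_t` filtration to the quantum filtration. -/

theorem filt_of_mem_filtration {β : BraidWord n} {t a b : ℝ} {ε : Row n → ℂ}
    (h : ∀ S, a ≤ jtGr β t S → Filt β b fun r π => ε r * toFun (Finsupp.single S 1) r π)
    {x : Chain β} (hx : x ∈ filtration β t a) : Filt β b fun r π => ε r * toFun x r π := by
  induction hx using Submodule.span_induction with
  | mem x hx =>
    obtain ⟨S, hS, rfl⟩ := hx
    exact h S hS
  | zero =>
    intro e he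
    exact (filtAt_zero β e _).congr fun r π _ _ => by rw [toFun_zero, mul_zero]
  | add x y _ _ hx hy =>
    intro e he
    exact ((hx e he).add (hy e he)).congr fun r π _ _ => by rw [toFun_add, mul_add]
  | smul k x _ hx =>
    intro e he
    exact ((hx e he).mul k).congr fun r π _ _ => by rw [toFun_smul, mul_left_comm]

-- Distinct nontrivial circles pass through distinct ones of the `n` points on `γ`.
open Classical in
theorem abs_kGr_le (β : BraidWord n) (S : EnhancedState β) : |(kGr β S : ℝ)| ≤ n := by
  have h1 : |kGr β S| ≤ ∑ c, if IsNontrivial β S.1 c then 1 else 0 := by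
    refine (Finset.abs_sum_le_sum_abs _ _).trans (Finset.sum_le_sum fun c _ => ?_)
    split_ifs
    · cases S.2 c <;> simp [markSign]
    · simp
  have h2 : (Finset.univ.filter fun c => IsNontrivial β S.1 c).card ≤ n := by
    have : (Finset.univ.filter fun c => IsNontrivial β S.1 c) ⊆
        Finset.univ.image fun p : Fin n => circ β S.1 (p, 0) := by
      intro c hc
      obtain ⟨p, hp⟩ := (Set.ncard_pos (Set.toFinite _)).1 (Finset.mem_filter.1 hc).2.pos
      exact Finset.mem_image.2 ⟨p, Finset.mem_univ _, hp⟩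
    exact (Finset.card_le_card this).trans (Finset.card_image_le.trans (by simp))
  rw [← Finset.sum_filter, Finset.sum_const, nsmul_one] at h1
  have : |kGr β S| ≤ n := h1.trans (by exact_mod_cast h2)
  exact_mod_cast this

-- A circle contributes its sign once for each crossing with `γ`, and signs square to one, so
-- exactly the nontrivial circles remain. Multiplication by this product thus exchanges `v₊` and
-- `v₋` on them.
open Classical in
theorem prod_sg_rowOf {β : BraidWord n} {v : Resolution β} (χ : StateCircle β v → Bool) :
    ∏ p, sg (rowOf χ p) = ∏ c, if IsNontrivial β v c then sg (χ c) else 1 := by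
  rw [← Finset.prod_fiberwise Finset.univ (fun p : Fin n => circ β v (p, 0))]
  refine Finset.prod_congr rfl fun c _ => ?_
  have h1 : ∏ p ∈ Finset.univ.filter (fun p : Fin n => circ β v (p, 0) = c), sg (rowOf χ p) =
      sg (χ c) ^ {p : Fin n | circ β v (p, 0) = c}.ncard := by
    rw [Set.ncard_eq_toFinset_card', Set.toFinset_setOf, ← Finset.prod_const]
    refine Finset.prod_congr (by congr) fun p hp => ?_
    rw [rowOf, (Finset.mem_filter.1 hp).2]
  rw [h1]
  have h2 : sg (χ c) ^ 2 = 1 := by rw [sq, sg_mul_self]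
  split_ifs with hc
  · obtain ⟨k, hk⟩ := hc
    rw [hk, pow_succ, pow_mul, h2, one_pow, one_mul]
  · obtain ⟨k, hk⟩ := Nat.not_odd_iff_even.1 hc
    rw [hk, ← two_mul, pow_mul, h2, one_pow]

/-- For `t ≥ 0` this is `j = j_t + t k ≥ b - t n`. -/
theorem filt_toFun {β : BraidWord n} {t b : ℝ} (ht : 0 ≤ t) {x : Chain β}
    (hx : x ∈ filtration β t b) : Filt β (b - t * n) fun r π => 1 * toFun x r π := by
  refine filt_of_mem_filtration (ε := fun _ => 1) (fun S hS => filt_single S S.2 (fun _ => 1)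
    (fun χ => one_mul _) ?_) hx
  have h1 := neg_le_of_abs_le (abs_kGr_le β S)
  have h2 : (jGr β S : ℝ) = ((∑ c, markSign (S.2 c) : ℤ) : ℝ) + height β S.1 + nPos β -
      2 * nNeg β := by rw [jGr]; push_cast; ring
  rw [jtGr, h2] at hS
  have := mul_le_mul_of_nonneg_left h1 ht
  linarith

-- After the exchange of marks on the nontrivial circles the quantum grading is `j - 2 k = j_t - (2
-- - t) k`, and `t ≤ 2` gives the bound.
open Classical in
theorem filt_sg_mul_toFun {β : BraidWord n} {t b : ℝ} (ht : t ≤ 2) {x : Chain β}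
    (hx : x ∈ filtration β t b) :
    Filt β (b - (2 - t) * n) fun r π => (∏ p, sg (r p)) * toFun x r π := by
  refine filt_of_mem_filtration (ε := fun r => ∏ p, sg (r p)) (fun S hS => filt_single S
    (fun c => if IsNontrivial β S.1 c then !S.2 c else S.2 c) (fun r => ∏ p, sg (r p))
    (fun χ => ?_) ?_) hx
  · rw [prod_sg_rowOf, ← Finset.prod_mul_distrib]
    refine Finset.prod_congr rfl fun c _ => ?_
    split_ifs
    · cases S.2 c <;> simp [markVal, sg_mul_self]
    · rw [one_mul]
  · have h1 := le_of_abs_le (abs_kGr_le β S)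
    have h2 : (jGr β S : ℝ) = ((∑ c, markSign (S.2 c) : ℤ) : ℝ) + height β S.1 + nPos β -
        2 * nNeg β := by rw [jGr]; push_cast; ring
    have h3 : ∑ c, markSign (if IsNontrivial β S.1 c then !S.2 c else S.2 c) =
        ∑ c, markSign (S.2 c) - 2 * kGr β S := by
      rw [kGr, Finset.mul_sum, ← Finset.sum_sub_distrib]
      refine Finset.sum_congr rfl fun c _ => ?_
      split_ifs
      · cases S.2 c <;> simp [markSign]
      · simp
    rw [h3]
    rw [jtGr, h2] at hS
    have := mul_le_mul_of_nonneg_left h1 (sub_nonneg.2 ht)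
    push_cast
    push_cast at hS
    linarith

/-- The multiplier depends on the row only, so it commutes with the differential. The product is
again a nonzero multiple of the generator plus a boundary. -/
theorem le_of_mem_filtration_of_upperBound {β : BraidWord n} {w : ℝ} (hw : UpperBound β w)
    {ε : Row n → ℂ} (hε : ε (altRow n) ≠ 0) {b : ℝ} {x : Chain β}
    (hx : x - canonicalGen β ∈ LinearMap.range (leeD β))
    (hf : Filt β b fun r π => ε r * toFun x r π) : b ≤ w - n := by
  obtain ⟨y, hy⟩ := hx
  obtain ⟨k, hk0, hk⟩ := toFun_canonicalGen β
  refine hw (fun r π => ε r * toFun y r π) (ε (altRow n) * k) b (mul_ne_zero hε hk0) fun e he =>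
    (hf e he).congr fun r π _ h => ?_
  have hx : x = canonicalGen β + leeD β y := by rw [hy]; abel
  rw [hx, toFun_add, hk _ _ h, toFun_leeD _ h, colD_mul, altState]
  split_ifs with hr
  · rw [hr.1]; ring
  · ring

theorem le_of_mem_filtration {β : BraidWord n} {w : ℝ} (hw : UpperBound β w) {t : ℝ}
    (ht : t ∈ Set.Icc (0 : ℝ) 2) {b : ℝ} {x : Chain β}
    (hx : x - canonicalGen β ∈ LinearMap.range (leeD β)) (hb : x ∈ filtration β t b) :
    b ≤ -(n : ℝ) * |1 - t| + w := by
  rcases le_total t 1 with h | h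
  · have := le_of_mem_filtration_of_upperBound hw (ε := fun _ => 1) one_ne_zero hx
      (filt_toFun ht.1 hb)
    rw [abs_of_nonneg (by linarith)]
    linarith
  · have := le_of_mem_filtration_of_upperBound hw (ε := fun r => ∏ p, sg (r p))
      (Finset.prod_ne_zero_iff.2 fun p _ h => by
        have := sg_mul_self (altRow n p)
        rw [h] at this
        simp at this) hx (filt_sg_mul_toFun ht.2 hb)
    rw [abs_of_nonpos (by linarith)]
    linarith

/-! ### The lower bound and the value of the invariant. -/

theorem height_orientedRes (β : BraidWord n) : height β (orientedRes β) = nNeg β := by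
  rw [height_eq_sum]
  induction β with
  | nil => rfl
  | cons a β ih =>
    refine (Fin.sum_univ_succ (n := β.length) _).trans ?_
    have h1 : ∀ l : Fin β.length, orientedRes (a :: β) l.succ = orientedRes β l := fun l => rfl
    have h0 : orientedRes (a :: β) (0 : Fin (β.length + 1)) = !a.2 := rfl
    simp only [h1, h0]
    rw [ih, nNeg, nNeg, List.countP_cons, add_comm]

theorem isNontrivial_orientedRes (β : BraidWord n) (c : StateCircle β (orientedRes β)) :
    IsNontrivial β (orientedRes β) c := by
  have : {p : Fin n | circ β (orientedRes β) (p, 0) = c} = {(orientedCircles β).symm c} := by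
    ext p
    exact (orientedCircles β).apply_eq_iff_eq_symm_apply
  rw [IsNontrivial, this, Set.ncard_singleton]
  exact odd_one

theorem jGr_orientedRes (β : BraidWord n) (S : EnhancedState β) (hS : S.1 = orientedRes β) :
    jGr β S = kGr β S + (nPos β - nNeg β) := by
  obtain ⟨v, m⟩ := S
  simp only at hS
  subst hS
  rw [jGr, kGr]
  simp only [isNontrivial_orientedRes, if_true, height_orientedRes]
  ring

/-- On the oriented resolution `j_t = (1 - t) k + w`, and `|k| ≤ n`. -/
theorem canonicalGen_mem_filtration (β : BraidWord n) (t : ℝ) :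
    canonicalGen β ∈ filtration β t (-(n : ℝ) * |1 - t| + writhe (toBraid β)) := by
  rw [← Finsupp.sum_single (canonicalGen β)]
  refine Submodule.sum_mem _ fun S hS => ?_
  rw [← Finsupp.smul_single_one]
  refine Submodule.smul_mem _ _ (Submodule.subset_span ⟨S, ?_, rfl⟩)
  have hv : S.1 = orientedRes β := by
    by_contra h
    rw [Finsupp.mem_support_iff, canonicalGen_apply, if_neg h] at hS
    exact hS rfl
  change _ ≤ jtGr β t S
  rw [jtGr, jGr_orientedRes β S hv, writhe_toBraid]
  have h1 : |(1 - t) * (kGr β S : ℝ)| ≤ |1 - t| * n := by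
    rw [abs_mul]
    exact mul_le_mul_of_nonneg_left (abs_kGr_le β S) (abs_nonneg _)
  have h2 := neg_le_of_abs_le h1
  push_cast
  linarith

theorem isGreatest_classGradings {β : BraidWord n} (h : UpperBound β (writhe (toBraid β))) {t : ℝ}
    (ht : t ∈ Set.Icc (0 : ℝ) 2) :
    IsGreatest (classGradings β t) (-(n : ℝ) * |1 - t| + writhe (toBraid β)) := by
  have h0 : canonicalGen β - canonicalGen β ∈ LinearMap.range (leeD β) := by
    rw [sub_self]; exact Submodule.zero_mem _
  refine ⟨⟨canonicalGen β, leeD_canonicalGen β, h0, canonicalGen_mem_filtration β t,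
    fun b hb => le_of_mem_filtration h ht h0 hb⟩, ?_⟩
  rintro a ⟨x, -, hx, ha⟩
  exact le_of_mem_filtration h ht hx ha.1

end AnnularLee

theorem theorem5p6 (n : ℕ) (σ : AnnularLee.BraidGroup n) (hσ : AnnularLee.IsQuasipositive σ)
    (β : AnnularLee.BraidWord n) (hβ : AnnularLee.toBraid β = σ) :
    AnnularLee.leeD β (AnnularLee.canonicalGen β) = 0 ∧
    AnnularLee.canonicalGen β ∉ LinearMap.range (AnnularLee.leeD β) ∧
    (∀ t ∈ Set.Icc (0 : ℝ) 2,
      IsGreatest (AnnularLee.classGradings β t) (AnnularLee.annularRasmussen β t) ∧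
      AnnularLee.annularRasmussen β t = -(n : ℝ) * |1 - t| + (AnnularLee.writhe σ : ℝ)) ∧
    (∀ t ∈ Set.Ico (0 : ℝ) 1,
      Filter.Tendsto
        (fun ε : ℝ =>
          (AnnularLee.annularRasmussen β (t + ε) - AnnularLee.annularRasmussen β t) / ε)
        (nhdsWithin 0 (Set.Ioi 0)) (nhds (n : ℝ))) := by
  subst hβ
  have hg := fun t ht =>
    AnnularLee.isGreatest_classGradings (AnnularLee.upperBound_writhe hσ) (t := t) ht
  have hd : ∀ t ∈ Set.Icc (0 : ℝ) 2, AnnularLee.annularRasmussen β t =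
      -(n : ℝ) * |1 - t| + (AnnularLee.writhe (AnnularLee.toBraid β) : ℝ) :=
    fun t ht => (hg t ht).csSup_eq
  refine ⟨AnnularLee.leeD_canonicalGen β, AnnularLee.canonicalGen_notMem_range β,
    fun t ht => ⟨by rw [hd t ht]; exact hg t ht, hd t ht⟩, fun t ht => ?_⟩
  -- For small `ε > 0` both `t` and `t + ε` lie in `[0, 1)`, where the invariant is affine with
  -- slope `n`; the difference quotient is constant.
  refine tendsto_const_nhds.congr' ?_
  filter_upwards [self_mem_nhdsWithin,
    mem_nhdsWithin_of_mem_nhds (Iio_mem_nhds (sub_pos.2 ht.2))] with ε h1 h2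
  simp only [Set.mem_Ioi, Set.mem_Iio] at h1 h2
  obtain ⟨h3, h4⟩ := ht
  rw [hd t ⟨h3, by linarith⟩, hd (t + ε) ⟨by linarith, by linarith⟩,
    abs_of_nonneg (by linarith), abs_of_nonneg (by linarith)]
  field_simp
  ring
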